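/- **Setting.** Let $L>0$, let $d_+,d_-\in C^1([0,L])$ satisfy $d_-(x)<0<d_+(x)$ on $[0,L]$, put $D(x)=\operatorname{diag}(d_+(x),d_-(x))$, let $M\in C([0,L];\mathbb R^{2\times2})$ and $\eta_0\le 0$. For $\mu_+,\mu_-\in\mathbb R$ put $E(x)=\operatorname{diag}(e^{-\mu_+x},e^{\mu_-x})$. Assume that there are $\mu_+,\mu_->0$ and $\nu_a<0$ such that for all $x\in[0,L]$ $$\sup_{v^\top E(x)v=1} v^\top\Big[\tfrac{d}{dx}\big(E(x)D(x)\big)-|\eta_0|\big(E(x)M(x)+M(x)^\top E(x)\big)\Big]v\le\nu_a ,$$ and that there are $\mu_+,\mu_-<0$ and $\nu_0>0$ such that for all $x\in[0,L]$ $$\inf_{v^\top E(x)v=1} v^\top\Big[E'(x)D(x)-E(x)D'(x)+|\eta_0|\big(E(x)M(x)+M(x)^\top E(x)\big)\Big]v\ge\nu_0 .$$ Let $A_0,A_L\in\mathbb R^{2\times 2}$ be symmetric positive definite, $c_0,c_L\in\mathbb R^2$, $f_0(z)=\frac12z^\top A_0z+c_0^\top z$ and $f_L(z)=\frac12z^\top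 A_Lz+c_L^\top z$. *Dynamic problem.* For $T>0$ let $u^{(\delta,T)}$ minimize $$\int_0^T f_0\big(u_+(t),r_-(t,0)\big)+f_L\big(u_-(t),r_+(t,L)\big)\,dt$$ over $u=(u_+,u_-)\in L^2(0,T)^2$, where $r=(r_+,r_-)\in C([0,T];L^2((0,L);\mathbb R^2))$, with outflow traces $r_+(\cdot,L),r_-(\cdot,0)\in L^2(0,T)$, is the weak solution of $$r_t+D\,r_x=\eta_0Mr,\quad r(0,x)=0,\quad r_+(t,0)=u_+(t),\quad r_-(t,L)=u_-(t).$$ Let $r^{(\delta,T)}$ be the state generated by $u^{(\delta,T)}$. *Static problem.* Let $u^{(\sigma)}\in\mathbb R^2$ minimize $f_0(u_+,R_-(0))+f_L(u_-,R_+(L))$ over $u=(u_+,u_-)\in\mathbb R^2$, where $R=(R_+,R_-)$ solves $$D R_x=\eta_0MR\ \text{ on }(0,L),\quad R_+(0)=u_+,\quad R_-(L)=u_- .$$ Let $r^{(\sigma)}$ be the state generated by $u^{(\sigma)}$. **Theorem 1.** There is a constant $\tilde C>0$, independent of $T$, such that for all $T>0$ $$\frac1T\int_0^T\big\|u^{(\delta,T)}(\tau)-u^{(\sigma)}\big\|_{\mathbb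 R^2}^2\,d\tau\le\frac{\tilde C}{T},\qquad\text{and thus}\qquad \int_0^1\big\|u^{(\delta,T)}(Ts)-u^{(\sigma)}\big\|_{\mathbb R^2}^2\,ds\le\frac{\tilde C}{T}.$$ Moreover, there is a constant $\tilde D>0$, independent of $T$, such that for all $T>0$ $$\int_0^T\int_0^L\big\|r^{(\delta,T)}(\tau,x)-r^{(\sigma)}(x)\big\|_{\mathbb R^2}^2\,dx\,d\tau\le\tilde D .$$ -/

import Mathlib

open MeasureTheory Set
open scoped Matrix

noncomputable section

namespace Turnpike

/-- The Euclidean plane. Index `0` stands for the component `+`, index `1` for the component `-`. -/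
abbrev Plane : Type := EuclideanSpace ℝ (Fin 2)

/-- The Hilbert space `L²((0, L); ℝ²)`. -/
abbrev StateSpace (L : ℝ) : Type := Lp Plane 2 (volume.restrict (Ioo (0 : ℝ) L))

/-- The diagonal matrix `D(x) = diag(d₊(x), d₋(x))`. -/
def speedMatrix (dp dm : ℝ → ℝ) (x : ℝ) : Matrix (Fin 2) (Fin 2) ℝ :=
  Matrix.diagonal ![dp x, dm x]

/-- The weight `E(x) = diag(exp(-μ₊ x), exp(μ₋ x))`. -/
def weightMatrix (μp μm : ℝ) (x : ℝ) : Matrix (Fin 2) (Fin 2) ℝ :=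
  Matrix.diagonal ![Real.exp (-μp * x), Real.exp (μm * x)]

/-- The entrywise derivative on `[0, L]` (one-sided at the end points) of a matrix function. -/
def matrixDeriv (L : ℝ) (F : ℝ → Matrix (Fin 2) (Fin 2) ℝ) (x : ℝ) :
    Matrix (Fin 2) (Fin 2) ℝ :=
  Matrix.of fun i j => derivWithin (fun y => F y i j) (Icc 0 L) x

/-- There are `μ₊, μ₋ > 0` and `ν < 0` such that for all `x ∈ [0, L]`
`sup_{vᵀ E v = 1} vᵀ [(E D)' - |η₀| (E M + Mᵀ E)] v ≤ ν`. -/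
def ForwardLyapunov (L : ℝ) (dp dm : ℝ → ℝ) (M : ℝ → Matrix (Fin 2) (Fin 2) ℝ) (η₀ : ℝ) : Prop :=
  ∃ μp > 0, ∃ μm > 0, ∃ ν < 0, ∀ x ∈ Icc 0 L, ∀ v : Fin 2 → ℝ,
    v ⬝ᵥ (weightMatrix μp μm x *ᵥ v) = 1 →
      v ⬝ᵥ ((matrixDeriv L (fun y => weightMatrix μp μm y * speedMatrix dp dm y) x
        - |η₀| • (weightMatrix μp μm x * M x + (M x)ᵀ * weightMatrix μp μm x)) *ᵥ v) ≤ ν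

/-- There are `μ₊, μ₋ < 0` and `ν > 0` such that for all `x ∈ [0, L]`
`inf_{vᵀ E v = 1} vᵀ [E' D - E D' + |η₀| (E M + Mᵀ E)] v ≥ ν`. -/
def BackwardLyapunov (L : ℝ) (dp dm : ℝ → ℝ) (M : ℝ → Matrix (Fin 2) (Fin 2) ℝ) (η₀ : ℝ) : Prop :=
  ∃ μp < 0, ∃ μm < 0, ∃ ν > 0, ∀ x ∈ Icc 0 L, ∀ v : Fin 2 → ℝ,
    v ⬝ᵥ (weightMatrix μp μm x *ᵥ v) = 1 →
      ν ≤ v ⬝ᵥ ((matrixDeriv L (weightMatrix μp μm) x * speedMatrix dp dm x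
        - weightMatrix μp μm x * matrixDeriv L (speedMatrix dp dm) x
        + |η₀| • (weightMatrix μp μm x * M x + (M x)ᵀ * weightMatrix μp μm x)) *ᵥ v)

/-- `φ` is a test function of class `C¹` on the closed rectangle `[0, T] × [0, L]`, with partial
derivatives `φt` and `φx`. -/
structure IsTestFunction (L T : ℝ) (φ φt φx : ℝ → ℝ → Fin 2 → ℝ) : Prop where
  continuousOn : ContinuousOn (Function.uncurry φ) (Icc 0 T ×ˢ Icc 0 L)
  continuousOn_t : ContinuousOn (Function.uncurry φt) (Icc 0 T ×ˢ Icc 0 L)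
  continuousOn_x : ContinuousOn (Function.uncurry φx) (Icc 0 T ×ˢ Icc 0 L)
  hasDeriv_t : ∀ t ∈ Icc 0 T, ∀ x ∈ Icc 0 L,
    HasDerivWithinAt (fun s => φ s x) (φt t x) (Icc 0 T) t
  hasDeriv_x : ∀ t ∈ Icc 0 T, ∀ x ∈ Icc 0 L,
    HasDerivWithinAt (fun y => φ t y) (φx t x) (Icc 0 L) x

/-- `r ∈ C([0, T]; L²((0, L); ℝ²))` is the weak solution, with outflow boundary traces
`R = (r₊(·, L), r₋(·, 0)) ∈ L²(0, T)²`, of the initial boundary value problem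
`r_t + D r_x = η₀ M r`, `r(0, ·) = 0`, `r₊(t, 0) = u₊(t)`, `r₋(t, L) = u₋(t)`
with boundary control `u = (u₊, u₋) ∈ L²(0, T)²`.
The weak form is the equation multiplied by a test function `φ` and integrated by parts over
`(0, τ) × (0, L)`; on the boundary, `r(t, L) = (R₊(t), u₋(t))` and `r(t, 0) = (u₊(t), R₋(t))`. -/
structure IsDynamicSolution (L : ℝ) (dp dm : ℝ → ℝ) (M : ℝ → Matrix (Fin 2) (Fin 2) ℝ) (η₀ T : ℝ)
    (u : ℝ → Plane) (r : ℝ → StateSpace L) (R : ℝ → Plane) : Prop where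
  control_memLp : MemLp u 2 (volume.restrict (Ioo 0 T))
  trace_memLp : MemLp R 2 (volume.restrict (Ioo 0 T))
  continuousOn : ContinuousOn r (Icc 0 T)
  initial : r 0 = 0
  weak : ∀ φ φt φx : ℝ → ℝ → Fin 2 → ℝ, IsTestFunction L T φ φt φx → ∀ τ ∈ Icc 0 T,
    ∫ t in 0..τ, ∫ x in 0..L, (r t x).ofLp ⬝ᵥ
        (φt t x + (speedMatrix dp dm x *ᵥ φx t x + matrixDeriv L (speedMatrix dp dm) x *ᵥ φ t x)
          + η₀ • ((M x)ᵀ *ᵥ φ t x))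
      = (∫ x in 0..L, (r τ x).ofLp ⬝ᵥ φ τ x)
        + ∫ t in 0..τ, (![R t 0, u t 1] ⬝ᵥ (speedMatrix dp dm L *ᵥ φ t L)
            - ![u t 0, R t 1] ⬝ᵥ (speedMatrix dp dm 0 *ᵥ φ t 0))

/-- `f(z) = ½ zᵀ A z + cᵀ z`. -/
def quadratic (A : Matrix (Fin 2) (Fin 2) ℝ) (c z : Fin 2 → ℝ) : ℝ :=
  1 / 2 * (z ⬝ᵥ (A *ᵥ z)) + c ⬝ᵥ z

/-- `f₀(u₊, R₋) + f_L(u₋, R₊)` for a control value `u` and a value `R = (R₊, R₋)` of the traces. -/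
def runningCost (A₀ AL : Matrix (Fin 2) (Fin 2) ℝ) (c₀ cL : Fin 2 → ℝ) (u R : Plane) : ℝ :=
  quadratic A₀ c₀ ![u 0, R 1] + quadratic AL cL ![u 1, R 0]

/-- `J(u, R) = ∫₀ᵀ f₀(u₊(t), R₋(t)) + f_L(u₋(t), R₊(t)) dt`. -/
def dynamicCost (A₀ AL : Matrix (Fin 2) (Fin 2) ℝ) (c₀ cL : Fin 2 → ℝ) (T : ℝ)
    (u R : ℝ → Plane) : ℝ :=
  ∫ t in 0..T, runningCost A₀ AL c₀ cL (u t) (R t)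

/-- `u` is an optimal control of the dynamic problem: minimize `J(u, (r₊(·, L), r₋(·, 0)))` over
`u ∈ L²(0, T)²` subject to the initial boundary value problem; `r` is the corresponding state and
`R` are its outflow traces. -/
def IsDynamicOptimal (L : ℝ) (dp dm : ℝ → ℝ) (M : ℝ → Matrix (Fin 2) (Fin 2) ℝ) (η₀ : ℝ)
    (A₀ AL : Matrix (Fin 2) (Fin 2) ℝ) (c₀ cL : Fin 2 → ℝ) (T : ℝ)
    (u : ℝ → Plane) (r : ℝ → StateSpace L) (R : ℝ → Plane) : Prop :=
  IsDynamicSolution L dp dm M η₀ T u r R ∧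
    ∀ (u' : ℝ → Plane) (r' : ℝ → StateSpace L) (R' : ℝ → Plane),
      IsDynamicSolution L dp dm M η₀ T u' r' R' →
        dynamicCost A₀ AL c₀ cL T u R ≤ dynamicCost A₀ AL c₀ cL T u' R'

/-- `r` solves the boundary value problem `D r_x = η₀ M r` on `[0, L]`, `r₊(0) = u₊`,
`r₋(L) = u₋`. As `D` and `M` are continuous and `D` is invertible, every solution in `L²` is of
class `C¹` on `[0, L]`, so that nothing is lost by asking for differentiability. -/
structure IsStaticSolution (L : ℝ) (dp dm : ℝ → ℝ) (M : ℝ → Matrix (Fin 2) (Fin 2) ℝ) (η₀ : ℝ)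
    (u : Plane) (r : ℝ → Plane) : Prop where
  differentiableOn : DifferentiableOn ℝ r (Icc 0 L)
  ode : ∀ x ∈ Icc 0 L, speedMatrix dp dm x *ᵥ (derivWithin r (Icc 0 L) x).ofLp
    = η₀ • (M x *ᵥ (r x).ofLp)
  left : r 0 0 = u 0
  right : r L 1 = u 1

/-- `J₀(u, r) = f₀(u₊, r₋(0)) + f_L(u₋, r₊(L))`. -/
def staticCost (L : ℝ) (A₀ AL : Matrix (Fin 2) (Fin 2) ℝ) (c₀ cL : Fin 2 → ℝ)
    (u : Plane) (r : ℝ → Plane) : ℝ :=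
  runningCost A₀ AL c₀ cL u !₂[r L 0, r 0 1]

/-- `u` is an optimal control of the static problem, and `r` is the corresponding state. -/
def IsStaticOptimal (L : ℝ) (dp dm : ℝ → ℝ) (M : ℝ → Matrix (Fin 2) (Fin 2) ℝ) (η₀ : ℝ)
    (A₀ AL : Matrix (Fin 2) (Fin 2) ℝ) (c₀ cL : Fin 2 → ℝ) (u : Plane) (r : ℝ → Plane) : Prop :=
  IsStaticSolution L dp dm M η₀ u r ∧
    ∀ (u' : Plane) (r' : ℝ → Plane), IsStaticSolution L dp dm M η₀ u' r' →
      staticCost L A₀ AL c₀ cL u r ≤ staticCost L A₀ AL c₀ cL u' r'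

end Turnpike

end

namespace Turnpike

/-! The running cost is a quadratic polynomial, so around the static optimum it equals its static
value j, plus a linear term, plus a positive definite quadratic form in the deviations of controls
and outflow traces (`runningCost_add`). The first order condition of the static problem says that
the linear term vanishes on all static solutions. Hence there is an adjoint state that solves the
adjoint ODE and has the gradients as boundary values at both ends. Tested with it, the dynamic
equation has no volume term, and the time integral of the linear term collapses to a single terminal
term ⟨p, r(T)⟩ (`IsStaticOptimal.exists_adjoint`). The dynamic cost is therefore T j + ⟨p, r(T)⟩ + ∫
quadratic, and the last integral is at least α X with X = ∫ ‖u - uσ‖².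

From above, the optimal cost is at most T j + K: some control steers the system from 0 to the static
state in a time independent of T, and can be held there (`exists_steering`). So α X ≤ K - ⟨p, r(T)⟩.
The forward Lyapunov condition makes a weighted L² energy of r - rσ decay up to the inflow controls,
which gives ‖r(T) - rσ‖² ≤ C (1 + X) with C independent of T (`exists_energy_bound`). The terminal
term thus grows only like √X and is absorbed by Young's inequality (`exists_control_bound`). The
same energy estimate, integrated in time, bounds the states.

Two points need work because solutions are only weak. For the energy estimate, Steklov averages in
time have an L² time derivative, hence are absolutely continuous in x; the energy identity holds for
them and passes to the limit (`energy_of_steklov`). For the steering, the system is solved with x as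
the evolution variable, from data at x = 0 proportional to a bump in time of mass one; the time
integral of that solution moves from 0 to the static state. -/

/-! ### Coefficients, and the weak forms tested with `D⁻¹ ζ` -/

/-- The characteristic speed of the `i`-th component. -/
def speed (dp dm : ℝ → ℝ) (i : Fin 2) : ℝ → ℝ := ![dp, dm] i

/-- The standing assumptions on the coefficients. -/
structure Regular (L : ℝ) (dp dm : ℝ → ℝ) (M : ℝ → Matrix (Fin 2) (Fin 2) ℝ) : Prop where
  pos : 0 < L
  contDiffOn : ∀ i, ContDiffOn ℝ 1 (speed dp dm i) (Icc 0 L)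
  speed_zero : ∀ x ∈ Icc 0 L, 0 < speed dp dm 0 x
  speed_one : ∀ x ∈ Icc 0 L, speed dp dm 1 x < 0
  coupling : ContinuousOn M (Icc 0 L)

variable {L : ℝ} {dp dm : ℝ → ℝ} {M : ℝ → Matrix (Fin 2) (Fin 2) ℝ}

lemma Regular.speed_ne (h : Regular L dp dm M) (i : Fin 2) {x : ℝ} (hx : x ∈ Icc 0 L) :
    speed dp dm i x ≠ 0 := by
  fin_cases i
  · exact (h.speed_zero x hx).ne'
  · exact (h.speed_one x hx).ne

lemma Regular.continuousOn_speed (h : Regular L dp dm M) (i : Fin 2) :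
    ContinuousOn (speed dp dm i) (Icc 0 L) := (h.contDiffOn i).continuousOn

lemma Regular.hasDerivWithinAt_speed (h : Regular L dp dm M) (i : Fin 2) {x : ℝ}
    (hx : x ∈ Icc 0 L) : HasDerivWithinAt (speed dp dm i)
      (derivWithin (speed dp dm i) (Icc 0 L) x) (Icc 0 L) x :=
  ((h.contDiffOn i).differentiableOn one_ne_zero x hx).hasDerivWithinAt

lemma Regular.continuousOn_deriv_speed (h : Regular L dp dm M) (i : Fin 2) :
    ContinuousOn (derivWithin (speed dp dm i) (Icc 0 L)) (Icc 0 L) :=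
  (h.contDiffOn i).continuousOn_derivWithin (uniqueDiffOn_Icc h.pos) le_rfl

lemma Regular.continuousOn_coupling (h : Regular L dp dm M) (i j : Fin 2) :
    ContinuousOn (fun x => M x i j) (Icc 0 L) := by
  have := h.coupling
  fun_prop

lemma speedMatrix_mulVec (x : ℝ) (v : Fin 2 → ℝ) :
    speedMatrix dp dm x *ᵥ v = fun i => speed dp dm i x * v i := by
  ext i
  rw [speedMatrix, Matrix.mulVec_diagonal]
  fin_cases i <;> rfl

lemma matrixDeriv_speedMatrix_mulVec (x : ℝ) (v : Fin 2 → ℝ) :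
    matrixDeriv L (speedMatrix dp dm) x *ᵥ v
      = fun i => derivWithin (speed dp dm i) (Icc 0 L) x * v i := by
  ext i
  fin_cases i <;>
    simp [matrixDeriv, Matrix.mulVec, dotProduct, Fin.sum_univ_two, speedMatrix, speed]

/-- The adjoint coupling term `η₀ Mᵀ D⁻¹ ζ`. -/
noncomputable def adjointCoupling (dp dm : ℝ → ℝ) (M : ℝ → Matrix (Fin 2) (Fin 2) ℝ) (η₀ : ℝ)
    (ζ : ℝ → Fin 2 → ℝ) (x : ℝ) : Fin 2 → ℝ :=
  η₀ • ((M x)ᵀ *ᵥ fun i => ζ x i / speed dp dm i x)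

lemma Regular.continuousOn_div (h : Regular L dp dm M) {ζ : ℝ → Fin 2 → ℝ}
    (hζ : ContinuousOn ζ (Icc 0 L)) :
    ContinuousOn (fun x i => ζ x i / speed dp dm i x) (Icc 0 L) := by
  refine continuousOn_pi.2 fun i => ?_
  exact (continuousOn_pi.1 hζ i).div (h.continuousOn_speed i) fun x hx => h.speed_ne i hx

lemma Regular.continuousOn_adjointCoupling (h : Regular L dp dm M) (η₀ : ℝ) {ζ : ℝ → Fin 2 → ℝ}
    (hζ : ContinuousOn ζ (Icc 0 L)) :
    ContinuousOn (adjointCoupling dp dm M η₀ ζ) (Icc 0 L) := by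
  refine continuousOn_pi.2 fun i => ?_
  simp only [adjointCoupling, Pi.smul_apply, Matrix.mulVec, dotProduct, Matrix.transpose_apply,
    smul_eq_mul]
  refine continuousOn_const.mul (continuousOn_finsetSum _ fun j _ => ?_)
  exact (h.continuousOn_coupling j i).mul (continuousOn_pi.1 (h.continuousOn_div hζ) j)

/-- The weak form tested with the time-independent function `D⁻¹ ζ`. -/
lemma IsDynamicSolution.weak_static {η₀ T : ℝ} {u R : ℝ → Plane} {r : ℝ → StateSpace L}
    (h : Regular L dp dm M) (hr : IsDynamicSolution L dp dm M η₀ T u r R)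
    {ζ ζ' : ℝ → Fin 2 → ℝ} (hζ : ∀ x ∈ Icc 0 L, HasDerivWithinAt ζ (ζ' x) (Icc 0 L) x)
    (hζ' : ContinuousOn ζ' (Icc 0 L)) {τ : ℝ} (hτ : τ ∈ Icc 0 T) :
    ∫ t in 0..τ, ∫ x in 0..L, (r t x).ofLp ⬝ᵥ (ζ' x + adjointCoupling dp dm M η₀ ζ x)
      = (∫ x in 0..L, (r τ x).ofLp ⬝ᵥ fun i => ζ x i / speed dp dm i x)
        + ∫ t in 0..τ, (![R t 0, u t 1] ⬝ᵥ ζ L - ![u t 0, R t 1] ⬝ᵥ ζ 0) := by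
  have hc : ContinuousOn ζ (Icc 0 L) := fun x hx => (hζ x hx).continuousWithinAt
  have hzi : ∀ i, ∀ x ∈ Icc 0 L, HasDerivWithinAt (fun y => ζ y i) (ζ' x i) (Icc 0 L) x :=
    fun i x hx => hasDerivWithinAt_pi.1 (hζ x hx) i
  -- For φ = D⁻¹ζ the product Dφ is ζ, so Dφ_x + D'φ collapses to ζ', the derivative of the speeds
  -- drops out, and the boundary terms only see ζ.
  set φ : ℝ → Fin 2 → ℝ := fun x i => ζ x i / speed dp dm i x
  set φx : ℝ → Fin 2 → ℝ := fun x i =>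
    (ζ' x i * speed dp dm i x - ζ x i * derivWithin (speed dp dm i) (Icc 0 L) x)
      / speed dp dm i x ^ 2
  have hφ : ContinuousOn φ (Icc 0 L) := h.continuousOn_div hc
  have hφx : ContinuousOn φx (Icc 0 L) := by
    refine continuousOn_pi.2 fun i => ?_
    refine ContinuousOn.div ?_ ((h.continuousOn_speed i).pow 2)
      fun x hx => pow_ne_zero _ (h.speed_ne i hx)
    exact ((continuousOn_pi.1 hζ' i).mul (h.continuousOn_speed i)).sub
      ((continuousOn_pi.1 hc i).mul (h.continuousOn_deriv_speed i))
  have htest : IsTestFunction L T (fun _ => φ) (fun _ _ => 0) (fun _ => φx) := by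
    refine ⟨?_, continuousOn_const, ?_, fun t _ x _ => hasDerivWithinAt_const _ _ _, ?_⟩
    · exact hφ.comp continuousOn_snd fun p hp => hp.2
    · exact hφx.comp continuousOn_snd fun p hp => hp.2
    · intro t _ x hx
      exact hasDerivWithinAt_pi.2 fun i => (hzi i x hx).div (h.hasDerivWithinAt_speed i hx)
        (h.speed_ne i hx)
  have key := hr.weak _ _ _ htest τ hτ
  have hD : ∀ x ∈ Icc 0 L, speedMatrix dp dm x *ᵥ φ x = ζ x := fun x hx => by
    rw [speedMatrix_mulVec]
    ext i
    exact mul_div_cancel₀ _ (h.speed_ne i hx)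
  rw [hD L ⟨h.pos.le, le_rfl⟩, hD 0 ⟨le_rfl, h.pos.le⟩] at key
  rw [← key]
  refine intervalIntegral.integral_congr fun t _ => intervalIntegral.integral_congr fun x hx => ?_
  rw [uIcc_of_le h.pos.le] at hx
  simp only [speedMatrix_mulVec, matrixDeriv_speedMatrix_mulVec]
  congr 1
  ext i
  have := h.speed_ne i hx
  simp only [adjointCoupling, Pi.add_apply, Pi.zero_apply, φ, φx]
  field_simp
  ring

lemma IsStaticSolution.hasDerivWithinAt {η₀ : ℝ} {u : Plane} {r : ℝ → Plane}
    (h : Regular L dp dm M) (hr : IsStaticSolution L dp dm M η₀ u r) {x : ℝ} (hx : x ∈ Icc 0 L)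
    (i : Fin 2) : HasDerivWithinAt (fun y => r y i)
      (η₀ * (M x *ᵥ (r x).ofLp) i / speed dp dm i x) (Icc 0 L) x := by
  have h1 := (hr.differentiableOn x hx).hasDerivWithinAt
  have h2 : HasDerivWithinAt (fun y => r y i) (derivWithin r (Icc 0 L) x i) (Icc 0 L) x :=
    ((EuclideanSpace.proj (𝕜 := ℝ) i).hasFDerivAt.comp_hasDerivWithinAt x h1)
  convert h2 using 1
  have h3 := congrFun (hr.ode x hx) i
  rw [speedMatrix_mulVec] at h3
  simp only [Pi.smul_apply, smul_eq_mul] at h3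
  rw [← h3, mul_div_cancel_left₀ _ (h.speed_ne i hx)]

lemma IsStaticSolution.continuousOn {η₀ : ℝ} {u : Plane} {r : ℝ → Plane}
    (hr : IsStaticSolution L dp dm M η₀ u r) : ContinuousOn r (Icc 0 L) :=
  hr.differentiableOn.continuousOn

/-- The static equation tested with `D⁻¹ ζ`. -/
lemma IsStaticSolution.weak {η₀ : ℝ} {u : Plane} {r : ℝ → Plane}
    (h : Regular L dp dm M) (hr : IsStaticSolution L dp dm M η₀ u r)
    {ζ ζ' : ℝ → Fin 2 → ℝ} (hζ : ∀ x ∈ Icc 0 L, HasDerivWithinAt ζ (ζ' x) (Icc 0 L) x)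
    (hζ' : ContinuousOn ζ' (Icc 0 L)) :
    ∫ x in 0..L, (r x).ofLp ⬝ᵥ (ζ' x + adjointCoupling dp dm M η₀ ζ x)
      = (r L).ofLp ⬝ᵥ ζ L - (r 0).ofLp ⬝ᵥ ζ 0 := by
  have hc : ContinuousOn ζ (Icc 0 L) := fun x hx => (hζ x hx).continuousWithinAt
  have hrc : ContinuousOn (fun x => (r x).ofLp) (Icc 0 L) := by
    have := hr.continuousOn
    fun_prop
  have hcont : ContinuousOn
      (fun x => (r x).ofLp ⬝ᵥ (ζ' x + adjointCoupling dp dm M η₀ ζ x)) (Icc 0 L) := by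
    have := hζ'.add (h.continuousOn_adjointCoupling η₀ hc)
    exact continuousOn_finsetSum _ fun i _ =>
      (continuousOn_pi.1 hrc i).mul (continuousOn_pi.1 this i)
  have hder : ∀ x ∈ Icc 0 L, HasDerivWithinAt (fun x => (r x).ofLp ⬝ᵥ ζ x)
      ((r x).ofLp ⬝ᵥ (ζ' x + adjointCoupling dp dm M η₀ ζ x)) (Icc 0 L) x := by
    intro x hx
    have h0 := (hr.hasDerivWithinAt h hx 0).mul (hasDerivWithinAt_pi.1 (hζ x hx) 0)
    have h1 := (hr.hasDerivWithinAt h hx 1).mul (hasDerivWithinAt_pi.1 (hζ x hx) 1)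
    have h2 := h0.add h1
    simp only [dotProduct, Fin.sum_univ_two]
    refine (h2.congr_deriv ?_)
    simp only [adjointCoupling, Matrix.mulVec, dotProduct, Fin.sum_univ_two, Pi.add_apply,
      Pi.smul_apply, smul_eq_mul, Matrix.transpose_apply]
    have := h.speed_ne 0 hx
    have := h.speed_ne 1 hx
    field_simp
    ring
  refine intervalIntegral.integral_eq_sub_of_hasDeriv_right_of_le h.pos.le
    (fun x hx => (hder x hx).continuousWithinAt) (fun x hx => ?_) ?_
  · exact ((hder x (Ioo_subset_Icc_self hx)).hasDerivAt (Icc_mem_nhds hx.1 hx.2)).hasDerivWithinAt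
  · exact (hcont.mono (uIcc_of_le h.pos.le).subset).intervalIntegrable

/-! ### Transport systems with x as evolution variable: fixed point along characteristics -/

/-- The exponential weight has mass at most 1/κ on any interval, so a large κ makes the integral
operator `charMap` contract whatever the length L. -/
lemma integral_exp_decay_le {κ x : ℝ} (hκ : 0 < κ) :
    ∫ y in 0..x, Real.exp (-κ * (x - y)) ≤ 1 / κ := by
  have hd : ∀ y ∈ uIcc 0 x, HasDerivAt (fun y => Real.exp (-κ * (x - y)) / κ)
      (Real.exp (-κ * (x - y))) y := by
    intro y _
    have h1 : HasDerivAt (fun y => -κ * (x - y)) κ y := by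
      simpa using ((hasDerivAt_id y).const_sub x).const_mul (-κ)
    have := h1.exp.div_const κ
    rwa [mul_div_cancel_right₀ _ hκ.ne'] at this
  rw [intervalIntegral.integral_eq_sub_of_hasDerivAt hd
    (Continuous.intervalIntegrable (by fun_prop) _ _)]
  have : 0 ≤ Real.exp (-κ * (x - 0)) / κ := by positivity
  simp at this ⊢
  linarith

lemma abs_integral_exp_decay_mul_le {κ x C : ℝ} {f : ℝ → ℝ} (hκ : 0 < κ) (hx : 0 ≤ x)
    (hC : 0 ≤ C) (hf : ∀ y ∈ Icc 0 x, |f y| ≤ C) :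
    |∫ y in 0..x, Real.exp (-κ * (x - y)) * f y| ≤ C / κ := by
  have h1 : ‖∫ y in 0..x, Real.exp (-κ * (x - y)) * f y‖
      ≤ ∫ y in 0..x, C * Real.exp (-κ * (x - y)) := by
    refine intervalIntegral.norm_integral_le_of_norm_le hx (ae_of_all _ fun y hy => ?_)
      (Continuous.intervalIntegrable (by fun_prop) _ _)
    rw [norm_mul, Real.norm_eq_abs, Real.norm_eq_abs, Real.abs_exp, mul_comm]
    exact mul_le_mul_of_nonneg_right (hf y ⟨hy.1.le, hy.2⟩) (Real.exp_pos _).le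
  rw [intervalIntegral.integral_const_mul] at h1
  calc _ ≤ _ := h1
    _ ≤ C * (1 / κ) := mul_le_mul_of_nonneg_left (integral_exp_decay_le hκ) hC
    _ = C / κ := by ring

lemma abs_mulVec_le {A : Matrix (Fin 2) (Fin 2) ℝ} {b c : ℝ} {v : Fin 2 → ℝ} (hb : 0 ≤ b)
    (hA : ∀ i j, |A i j| ≤ b) (hv : ∀ i, |v i| ≤ c) (i : Fin 2) :
    |(A *ᵥ v) i| ≤ 2 * b * c := by
  simp only [Matrix.mulVec, dotProduct, Fin.sum_univ_two]
  have h0 := mul_le_mul (hA i 0) (hv 0) (abs_nonneg _) hb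
  have h1 := mul_le_mul (hA i 1) (hv 1) (abs_nonneg _) hb
  rw [← abs_mul] at h0 h1
  linarith [abs_add_le (A i 0 * v 0) (A i 1 * v 1)]

/-- Bounded continuous functions on the strip `ℝ × [0, L]`. -/
abbrev StripFunction (L : ℝ) : Type :=
  BoundedContinuousFunction (ℝ × Icc (0 : ℝ) L) (Fin 2 → ℝ)

/-- The integral operator along the characteristics with exponential weight. -/
noncomputable def charMap {L : ℝ} (hL : 0 ≤ L) (a : Fin 2 → ℝ → ℝ)
    (B : ℝ → Matrix (Fin 2) (Fin 2) ℝ) (g : ℝ → Fin 2 → ℝ) (κ : ℝ) (p : StripFunction L)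
    (z : ℝ × Icc (0 : ℝ) L) (i : Fin 2) : ℝ :=
  Real.exp (-κ * z.2) * g (z.1 - a i z.2) i + ∫ y in (0 : ℝ)..z.2, Real.exp (-κ * (z.2 - y)) *
    (B y *ᵥ p (z.1 - a i z.2 + a i y, projIcc 0 L hL y)) i

lemma continuous_charMap {L : ℝ} (hL : 0 ≤ L) {a : Fin 2 → ℝ → ℝ} (ha : ∀ i, Continuous (a i))
    {B : ℝ → Matrix (Fin 2) (Fin 2) ℝ} (hB : Continuous B) {g : ℝ → Fin 2 → ℝ}
    (hg : Continuous g) (κ : ℝ) (p : StripFunction L) : Continuous (charMap hL a B g κ p) := by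
  have hp := p.continuous
  have hpr : Continuous (projIcc 0 L hL) := continuous_projIcc
  refine continuous_pi fun i => ?_
  have hai := ha i
  refine Continuous.add (by fun_prop) ?_
  refine intervalIntegral.continuous_parametric_intervalIntegral_of_continuous
    (f := fun (z : ℝ × Icc (0 : ℝ) L) y => Real.exp (-κ * (z.2 - y)) *
    (B y *ᵥ p (z.1 - a i z.2 + a i y, projIcc 0 L hL y)) i) ?_ (by fun_prop)
  refine Continuous.mul (by fun_prop) ?_
  have : Continuous fun w : (ℝ × Icc (0 : ℝ) L) × ℝ =>
    B w.2 *ᵥ p (w.1.1 - a i w.1.2 + a i w.2, projIcc 0 L hL w.2) :=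
    Continuous.matrix_mulVec (by fun_prop) (by fun_prop)
  exact (continuous_apply i).comp this

/-- The data g cancel in the difference; what remains is linear and gains the factor 1/κ from the
weight. The 2 counts the columns of B. -/
lemma charMap_sub {L : ℝ} (hL : 0 ≤ L) {a : Fin 2 → ℝ → ℝ} (ha : ∀ i, Continuous (a i))
    {B : ℝ → Matrix (Fin 2) (Fin 2) ℝ} (hB : Continuous B) (g : ℝ → Fin 2 → ℝ)
    {b κ : ℝ} (hb : 0 ≤ b) (hκ : 0 < κ) (hBb : ∀ y ∈ Icc 0 L, ∀ i j, |B y i j| ≤ b)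
    (p p' : StripFunction L) (z : ℝ × Icc (0 : ℝ) L) (i : Fin 2) :
    |charMap hL a B g κ p z i - charMap hL a B g κ p' z i| ≤ 2 * b * ‖p - p'‖ / κ := by
  have hpr : Continuous (projIcc 0 L hL) := continuous_projIcc
  have hai := ha i
  have hint : ∀ p : StripFunction L, IntervalIntegrable (fun y => Real.exp (-κ * (z.2 - y)) *
    (B y *ᵥ p (z.1 - a i z.2 + a i y, projIcc 0 L hL y)) i) volume 0 z.2 := by
    intro p
    have hp := p.continuous
    refine Continuous.intervalIntegrable ?_ _ _
    refine Continuous.mul (by fun_prop) ?_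
    have : Continuous fun w : ℝ => B w *ᵥ p (z.1 - a i z.2 + a i w, projIcc 0 L hL w) :=
      Continuous.matrix_mulVec (by fun_prop) (by fun_prop)
    exact (continuous_apply i).comp this
  simp only [charMap]
  rw [add_sub_add_left_eq_sub, ← intervalIntegral.integral_sub (hint p) (hint p')]
  simp_rw [← mul_sub, ← Pi.sub_apply, ← Matrix.mulVec_sub]
  refine abs_integral_exp_decay_mul_le hκ z.2.2.1 (by positivity) fun y hy => ?_
  refine abs_mulVec_le hb (hBb y ⟨hy.1, hy.2.trans z.2.2.2⟩) (fun j => ?_) i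
  have h1 := (p - p').norm_coe_le_norm (z.1 - a i z.2 + a i y, projIcc 0 L hL y)
  exact (norm_le_pi_norm _ j).trans h1

lemma exists_entry_bound {L : ℝ} {B : ℝ → Matrix (Fin 2) (Fin 2) ℝ}
    (hB : ContinuousOn B (Icc 0 L)) : ∃ b, 0 ≤ b ∧ ∀ y ∈ Icc 0 L, ∀ i j, |B y i j| ≤ b := by
  have hc : ∀ i j, ∃ b, ∀ y ∈ Icc 0 L, |B y i j| ≤ b := fun i j =>
    isCompact_Icc.exists_bound_of_continuousOn
      (f := fun y => B y i j) (by fun_prop)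
  choose c hc using hc
  refine ⟨∑ i, ∑ j, |c i j|, by positivity, fun y hy i j => (hc i j y hy).trans ?_⟩
  refine (le_abs_self _).trans ?_
  refine le_trans ?_ (Finset.single_le_sum (f := fun i => ∑ j, |c i j|)
    (fun i _ => by positivity) (Finset.mem_univ i))
  exact Finset.single_le_sum (f := fun j => |c i j|) (fun i _ => by positivity)
    (Finset.mem_univ j)

/-- The hyperbolic system `a_i' ∂_t q_i + ∂_x q_i = (B q)_i` on the strip `ℝ × [0, L]`, with Cauchy
data `g` at `x = 0`, has a continuous solution in the sense of integration along the characteristics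
`t - a_i(x) = const`, and its support propagates at finite speed. -/
theorem exists_transport_solution {L : ℝ} (hL : 0 ≤ L) {a : Fin 2 → ℝ → ℝ}
    (ha : ∀ i, Continuous (a i)) {B : ℝ → Matrix (Fin 2) (Fin 2) ℝ} (hB : Continuous B)
    {g : ℝ → Fin 2 → ℝ} (hg : Continuous g) {G : ℝ} (hG : ∀ t i, |g t i| ≤ G) :
    ∃ q : ℝ → ℝ → Fin 2 → ℝ, Continuous (Function.uncurry q) ∧
      (∃ C, ∀ t x i, |q t x i| ≤ C) ∧
      (∀ t, ∀ x ∈ Icc 0 L, ∀ i, q t x i = g (t - a i x) i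
        + ∫ y in 0..x, (B y *ᵥ q (t - a i x + a i y) y) i) ∧
      ∀ K α β, (∀ i, ∀ x ∈ Icc 0 L, ∀ y ∈ Icc 0 x, |a i x - a i y| ≤ K * (x - y)) →
        (∀ i, a i 0 = 0) → (∀ t, t ≤ α ∨ β ≤ t → g t = 0) →
        ∀ t, ∀ x ∈ Icc 0 L, t ≤ α - K * x ∨ β + K * x ≤ t → q t x = 0 := by
  obtain ⟨b, hb0, hb⟩ := exists_entry_bound (L := L) hB.continuousOn
  -- This choice gives 2b/κ ≤ 1/2, the contraction constant below.
  set κ : ℝ := 4 * b + 1 with hκ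
  have hκ0 : 0 < κ := by positivity
  have hG0 : 0 ≤ G := (abs_nonneg _).trans (hG 0 0)
  have hbound : ∀ (p : StripFunction L) z, ‖charMap hL a B g κ p z‖ ≤ G + 2 * b * ‖p‖ / κ := by
    intro p z
    refine (pi_norm_le_iff_of_nonneg (by positivity)).2 fun i => ?_
    have h1 := charMap_sub hL ha hB g hb0 hκ0 hb p 0 z i
    rw [sub_zero] at h1
    have h2 : |charMap hL a B g κ 0 z i| ≤ G := by
      simp only [charMap, BoundedContinuousFunction.coe_zero, Pi.zero_apply, Matrix.mulVec_zero,
        mul_zero, intervalIntegral.integral_zero, add_zero, abs_mul, Real.abs_exp]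
      calc _ ≤ 1 * G := by
            refine mul_le_mul ?_ (hG _ _) (abs_nonneg _) zero_le_one
            rw [Real.exp_le_one_iff]
            have := z.2.2.1
            nlinarith
        _ = G := one_mul G
    rw [Real.norm_eq_abs]
    have h3 := abs_add_le (charMap hL a B g κ p z i - charMap hL a B g κ 0 z i)
      (charMap hL a B g κ 0 z i)
    rw [sub_add_cancel] at h3
    linarith
  let Φ : StripFunction L → StripFunction L := fun p =>
    BoundedContinuousFunction.ofNormedAddCommGroup (charMap hL a B g κ p)
      (continuous_charMap hL ha hB hg κ p) (G + 2 * b * ‖p‖ / κ) (hbound p)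
  have hΦ : ContractingWith (1 / 2 : NNReal) Φ := by
    refine ⟨by rw [← NNReal.coe_lt_coe]; norm_num, LipschitzWith.of_dist_le_mul fun p p' => ?_⟩
    refine (BoundedContinuousFunction.dist_le (by positivity)).2 fun z => ?_
    refine (dist_pi_le_iff (by positivity)).2 fun i => ?_
    rw [Real.dist_eq, dist_eq_norm]
    refine (charMap_sub hL ha hB g hb0 hκ0 hb p p' z i).trans ?_
    rw [div_le_iff₀ hκ0]
    simp only [NNReal.coe_div, NNReal.coe_one, NNReal.coe_ofNat]
    nlinarith [norm_nonneg (p - p')]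
  set p := hΦ.fixedPoint Φ with hp
  have hfix : ∀ z i, p z i = charMap hL a B g κ p z i := by
    intro z i
    have : Φ p = p := hΦ.fixedPoint_isFixedPt
    conv_lhs => rw [← this]
    rfl
  have hpc := p.continuous
  have hpr : Continuous (projIcc 0 L hL) := continuous_projIcc
  -- The fixed point is exp(-κx) q; the factor undoes the weight, and the projection to [0, L] makes
  -- q continuous on the whole plane.
  refine ⟨fun t x => Real.exp (κ * projIcc 0 L hL x) • p (t, projIcc 0 L hL x), ?_, ?_, ?_, ?_⟩
  · simp only [Function.uncurry_def]
    fun_prop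
  · refine ⟨Real.exp (κ * L) * ‖p‖, fun t x i => ?_⟩
    beta_reduce
    rw [Pi.smul_apply, smul_eq_mul, abs_mul, Real.abs_exp]
    refine mul_le_mul ?_ ((norm_le_pi_norm (p _) i).trans (p.norm_coe_le_norm _))
      (abs_nonneg _) (Real.exp_pos _).le
    exact Real.exp_le_exp.2 (mul_le_mul_of_nonneg_left (projIcc 0 L hL x).2.2 hκ0.le)
  · intro t x hx i
    beta_reduce
    rw [projIcc_of_mem hL hx, Pi.smul_apply, hfix, charMap, smul_eq_mul, mul_add,
      ← mul_assoc, ← Real.exp_add, ← intervalIntegral.integral_const_mul]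
    simp only [neg_mul, add_neg_cancel, Real.exp_zero, one_mul, add_right_inj]
    refine intervalIntegral.integral_congr fun y hy => ?_
    rw [uIcc_of_le hx.1] at hy
    have hy' : y ∈ Icc 0 L := ⟨hy.1, hy.2.trans hx.2⟩
    simp only [projIcc_of_mem hL hy', Matrix.mulVec_smul, Pi.smul_apply, smul_eq_mul]
    rw [← mul_assoc, ← Real.exp_add]
    congr 2
    ring
  · intro K α β hK ha0 hsupp t x hx htx
    -- The support condition is closed and preserved by Φ, because a characteristic traced back from
    -- x to y moves in time by at most K(x - y). The fixed point inherits it as the limit of the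
    -- iterates of 0.
    let S : Set (StripFunction L) :=
      {f | ∀ z : ℝ × Icc (0 : ℝ) L, z.1 ≤ α - K * z.2 ∨ β + K * z.2 ≤ z.1 → f z = 0}
    have hS : IsClosed S := by
      simp only [S, ofPred_forall]
      refine isClosed_iInter fun z => isClosed_iInter fun _ => ?_
      exact isClosed_eq (by fun_prop) continuous_const
    have hmaps : ∀ f ∈ S, Φ f ∈ S := by
      intro f hf z hz
      ext i
      change charMap hL a B g κ f z i = 0
      have hz2 := z.2.2
      have h0 := abs_le.1 (hK i z.2 hz2 0 ⟨le_rfl, hz2.1⟩)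
      rw [ha0 i] at h0
      rw [charMap, hsupp, Pi.zero_apply, mul_zero, zero_add]
      · rw [intervalIntegral.integral_congr (g := fun _ => (0 : ℝ))]
        · simp
        intro y hy
        rw [uIcc_of_le hz2.1] at hy
        have hy' : y ∈ Icc 0 L := ⟨hy.1, hy.2.trans hz2.2⟩
        have h1 := abs_le.1 (hK i z.2 hz2 y hy)
        simp only
        rw [hf, Matrix.mulVec_zero, Pi.zero_apply, mul_zero]
        simp only [projIcc_of_mem hL hy']
        rcases hz with hz | hz
        · left; linarith
        · right; linarith
      · rcases hz with hz | hz
        · left; linarith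
        · right; linarith
    have hiter : ∀ n : ℕ, Φ^[n] 0 ∈ S := by
      intro n
      induction n with
      | zero => intro z _; rfl
      | succ n ih => rw [Function.iterate_succ_apply']; exact hmaps _ ih
    have hmem : p ∈ S :=
      hS.mem_of_tendsto (hΦ.tendsto_iterate_fixedPoint 0) (Filter.Eventually.of_forall hiter)
    simp only [projIcc_of_mem hL hx]
    rw [hmem (t, ⟨x, hx⟩) htx, smul_zero]

/-! ### Linear ODEs on [0, L] -/

/-- A solution of the integral form of a linear system is a solution of the system. -/
lemma hasDerivWithinAt_of_integral_eq {L : ℝ} {B : ℝ → Matrix (Fin 2) (Fin 2) ℝ}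
    (hB : Continuous B) {f : ℝ → Fin 2 → ℝ} (hf : Continuous f) {v : Fin 2 → ℝ}
    (h : ∀ x ∈ Icc 0 L, ∀ i, f x i = v i + ∫ y in 0..x, (B y *ᵥ f y) i) {x : ℝ}
    (hx : x ∈ Icc 0 L) : HasDerivWithinAt f (B x *ᵥ f x) (Icc 0 L) x := by
  refine hasDerivWithinAt_pi.2 fun i => ?_
  have hc : Continuous fun y => (B y *ᵥ f y) i :=
    (continuous_apply i).comp (hB.matrix_mulVec hf)
  have h1 : HasDerivAt (fun x => v i + ∫ y in 0..x, (B y *ᵥ f y) i) ((B x *ᵥ f x) i) x :=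
    (hc.integral_hasStrictDerivAt 0 x).hasDerivAt.const_add (v i)
  exact h1.hasDerivWithinAt.congr (fun y hy => h y hy i) (h x hx i)

/-- With zero travel times the characteristics are the lines t = const, so a time slice of the
transport solution solves the ODE. -/
theorem exists_linear_ode_solution {L : ℝ} (hL : 0 ≤ L) {B : ℝ → Matrix (Fin 2) (Fin 2) ℝ}
    (hB : ContinuousOn B (Icc 0 L)) (v : Fin 2 → ℝ) :
    ∃ f : ℝ → Fin 2 → ℝ, f 0 = v ∧
      ∀ x ∈ Icc 0 L, HasDerivWithinAt f (B x *ᵥ f x) (Icc 0 L) x := by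
  set B' := IccExtend hL (domRestrict (Icc 0 L) B) with hB'
  have hBc : Continuous B' := (continuousOn_iff_continuous_domRestrict.1 hB).Icc_extend'
  have hBe : ∀ x ∈ Icc 0 L, B' x = B x := fun x hx => IccExtend_of_mem hL _ hx
  obtain ⟨q, hqc, -, hq, -⟩ := exists_transport_solution hL (a := fun _ _ => 0)
    (fun _ => continuous_const) hBc (g := fun _ => v) continuous_const (G := ∑ i, |v i|)
    (fun _ i => Finset.single_le_sum (f := fun i => |v i|) (fun _ _ => abs_nonneg _)
      (Finset.mem_univ i))
  simp only [sub_zero, add_zero] at hq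
  have hc : Continuous (q 0) := hqc.comp (by fun_prop : Continuous fun x : ℝ => ((0 : ℝ), x))
  refine ⟨q 0, ?_, fun x hx => ?_⟩
  · ext i
    simpa using hq 0 0 ⟨le_rfl, hL⟩ i
  · rw [← hBe x hx]
    exact hasDerivWithinAt_of_integral_eq hBc hc (hq 0) hx

theorem linear_ode_unique {L : ℝ} {B : ℝ → Matrix (Fin 2) (Fin 2) ℝ}
    (hB : ContinuousOn B (Icc 0 L)) {f g : ℝ → Fin 2 → ℝ}
    (hf : ∀ x ∈ Icc 0 L, HasDerivWithinAt f (B x *ᵥ f x) (Icc 0 L) x)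
    (hg : ∀ x ∈ Icc 0 L, HasDerivWithinAt g (B x *ᵥ g x) (Icc 0 L) x)
    (h0 : f 0 = g 0) : EqOn f g (Icc 0 L) := by
  obtain ⟨b, hb0, hb⟩ := exists_entry_bound hB
  have hright : ∀ h : ℝ → Fin 2 → ℝ, (∀ x ∈ Icc 0 L, HasDerivWithinAt h (B x *ᵥ h x)
      (Icc 0 L) x) → ∀ x ∈ Ico 0 L, HasDerivWithinAt h (B x *ᵥ h x) (Ici x) x :=
    fun h hh x hx => (hh x ⟨hx.1, hx.2.le⟩).mono_of_mem_nhdsWithin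
      (Filter.mem_of_superset (Icc_mem_nhdsGE hx.2) (Icc_subset_Icc_left hx.1))
  refine ODE_solution_unique_of_mem_Icc_right (v := fun x w => B x *ᵥ w) (s := fun _ => univ)
    (K := ⟨2 * b, mul_nonneg zero_le_two hb0⟩) (fun x hx => ?_)
    (fun x hx => (hf x hx).continuousWithinAt)
    (hright f hf) (fun _ _ => trivial) (fun x hx => (hg x hx).continuousWithinAt)
    (hright g hg) (fun _ _ => trivial) h0
  refine (LipschitzWith.of_dist_le_mul fun w w' => ?_).lipschitzOnWith
  rw [dist_eq_norm, dist_eq_norm, ← Matrix.mulVec_sub]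
  refine (pi_norm_le_iff_of_nonneg (mul_nonneg (NNReal.coe_nonneg _) (norm_nonneg _))).2 fun i => ?_
  exact abs_mulVec_le hb0 (hb x ⟨hx.1, hx.2.le⟩) (fun j => norm_le_pi_norm (w - w') j) i

/-! ### Steering from rest to a static state -/

/-- The shift also moves the lower limit, from c to c - δ, but both lie where f vanishes. -/
lemma integral_comp_sub_eq_of_eq_zero {f : ℝ → ℝ} {c m δ t : ℝ}
    (hf : Continuous f) (h0 : ∀ s ≤ m, f s = 0) (h1 : c ≤ m) (h2 : c - δ ≤ m) :
    ∫ s in c..t, f (s - δ) = ∫ s in c..t - δ, f s := by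
  rw [intervalIntegral.integral_comp_sub_right,
    ← intervalIntegral.integral_add_adjacent_intervals (hf.intervalIntegrable (c - δ) c)
      (hf.intervalIntegrable c (t - δ)), intervalIntegral.integral_congr (g := fun _ => 0)]
  · simp
  · intro s hs
    exact h0 s (hs.2.trans (max_le h2 h1))

/-- The matrix `η₀ D⁻¹ M` of the static equation. -/
noncomputable def staticMatrix (dp dm : ℝ → ℝ) (M : ℝ → Matrix (Fin 2) (Fin 2) ℝ) (η₀ : ℝ)
    (x : ℝ) : Matrix (Fin 2) (Fin 2) ℝ :=
  Matrix.of fun i j => η₀ * M x i j / speed dp dm i x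

lemma staticMatrix_mulVec (η₀ x : ℝ) (v : Fin 2 → ℝ) (i : Fin 2) :
    (staticMatrix dp dm M η₀ x *ᵥ v) i = η₀ * (M x *ᵥ v) i / speed dp dm i x := by
  simp only [staticMatrix, Matrix.mulVec, dotProduct, Fin.sum_univ_two, Matrix.of_apply]
  ring

lemma Regular.continuousOn_staticMatrix (h : Regular L dp dm M) (η₀ : ℝ) :
    ContinuousOn (staticMatrix dp dm M η₀) (Icc 0 L) := by
  refine continuousOn_pi.2 fun i => continuousOn_pi.2 fun j => ?_
  exact (continuousOn_const.mul (h.continuousOn_coupling i j)).div (h.continuousOn_speed i)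
    fun x hx => h.speed_ne i hx

lemma IsStaticSolution.hasDerivWithinAt_ofLp {η₀ : ℝ} {u : Plane} {r : ℝ → Plane}
    (h : Regular L dp dm M) (hr : IsStaticSolution L dp dm M η₀ u r) {x : ℝ} (hx : x ∈ Icc 0 L) :
    HasDerivWithinAt (fun y => (r y).ofLp) (staticMatrix dp dm M η₀ x *ᵥ (r x).ofLp)
      (Icc 0 L) x := by
  refine hasDerivWithinAt_pi.2 fun i => ?_
  rw [staticMatrix_mulVec]
  exact hr.hasDerivWithinAt h hx i

/-- Integrating a solution of the transport system in time gives a solution. -/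
lemma integral_transport_eq {L : ℝ} {a : Fin 2 → ℝ → ℝ} (hac : ∀ i, Continuous (a i))
    {B : ℝ → Matrix (Fin 2) (Fin 2) ℝ} (hB : Continuous B) {ψ : ℝ → ℝ} (hψc : Continuous ψ)
    {v : Fin 2 → ℝ} {q : ℝ → ℝ → Fin 2 → ℝ} (hqc : Continuous (Function.uncurry q)) {K : ℝ}
    (hK0 : 0 ≤ K)
    (haK : ∀ i, ∀ x ∈ Icc 0 L, ∀ y ∈ Icc 0 x, |a i x - a i y| ≤ K * (x - y))
    (ha0 : ∀ i, a i 0 = 0) (hψ0 : ∀ t, t ≤ -1 ∨ 1 ≤ t → ψ t = 0)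
    (hq : ∀ t, ∀ x ∈ Icc 0 L, ∀ i, q t x i = (ψ (t - a i x) • v) i
        + ∫ y in 0..x, (B y *ᵥ q (t - a i x + a i y) y) i)
    (hqlow : ∀ t, ∀ x ∈ Icc 0 L, t ≤ -1 - K * L → q t x = 0) (t : ℝ) {x : ℝ}
    (hx : x ∈ Icc 0 L) (i : Fin 2) :
    ∫ s in -1 - 3 * (K * L)..t, q s x i = (∫ s in -1 - 3 * (K * L)..t - a i x, ψ s * v i)
      + ∫ y in 0..x, (B y *ᵥ fun j => ∫ s in -1 - 3 * (K * L)..t - a i x + a i y, q s y j) i := by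
  set c : ℝ := -1 - 3 * (K * L) with hc
  have hKL : 0 ≤ K * L := mul_nonneg hK0 (hx.1.trans hx.2)
  have hqi : ∀ i, Continuous fun p : ℝ × ℝ => q p.1 p.2 i := fun i =>
    (continuous_apply i).comp hqc
  have hqx : ∀ i x, Continuous fun s => q s x i := fun i x =>
    (hqi i).comp (by fun_prop : Continuous fun s : ℝ => (s, x))
  have hkc : ∀ i, Continuous fun p : ℝ × ℝ => (B p.2 *ᵥ q p.1 p.2) i := fun i =>
    (continuous_apply i).comp ((hB.comp continuous_snd).matrix_mulVec hqc)
  have hmul : ∀ y t i, (B y *ᵥ fun j => ∫ s in c..t, q s y j) i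
      = ∫ s in c..t, (B y *ᵥ q s y) i := by
    intro y t i
    simp only [Matrix.mulVec, dotProduct, Fin.sum_univ_two]
    rw [intervalIntegral.integral_add, intervalIntegral.integral_const_mul,
      intervalIntegral.integral_const_mul]
    · exact (continuous_const.mul (hqx 0 y)).intervalIntegrable _ _
    · exact (continuous_const.mul (hqx 1 y)).intervalIntegrable _ _
  have hax := abs_le.1 (haK i x hx 0 ⟨le_rfl, hx.1⟩)
  rw [ha0 i, sub_zero, sub_zero] at hax
  have hKx : K * x ≤ K * L := mul_le_mul_of_nonneg_left hx.2 hK0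
  have hcomp : Continuous fun p : ℝ × ℝ =>
      (B p.2 *ᵥ q (p.1 - a i x + a i p.2) p.2) i := by
    have := hac i
    exact (hkc i).comp
      (by fun_prop : Continuous fun p : ℝ × ℝ => (p.1 - a i x + a i p.2, p.2))
  calc ∫ s in c..t, q s x i = ∫ s in c..t, (ψ (s - a i x) * v i
        + ∫ y in 0..x, (B y *ᵥ q (s - a i x + a i y) y) i) := by
        refine intervalIntegral.integral_congr fun s _ => ?_
        exact hq s x hx i
    _ = (∫ s in c..t, ψ (s - a i x) * v i)
        + ∫ s in c..t, ∫ y in 0..x, (B y *ᵥ q (s - a i x + a i y) y) i := by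
        refine intervalIntegral.integral_add (Continuous.intervalIntegrable (by fun_prop) _ _) ?_
        exact (intervalIntegral.continuous_parametric_intervalIntegral_of_continuous
          (f := fun s y => (B y *ᵥ q (s - a i x + a i y) y) i) hcomp
          continuous_const).intervalIntegrable _ _
    _ = _ := by
        congr 1
        · exact integral_comp_sub_eq_of_eq_zero (f := fun s => ψ s * v i) (m := -1)
            (by fun_prop) (fun s hs => by simp [hψ0 s (Or.inl hs)]) (by linarith)
            (by linarith)
        · rw [intervalIntegral_intervalIntegral_swap]
          · refine intervalIntegral.integral_congr fun y hy => ?_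
            rw [uIcc_of_le hx.1] at hy
            have hy' : y ∈ Icc 0 L := ⟨hy.1, hy.2.trans hx.2⟩
            have hxy := abs_le.1 (haK i x hx y hy)
            have hKxy : K * (x - y) ≤ K * L :=
              mul_le_mul_of_nonneg_left (by linarith [hy.1, hx.2]) hK0
            simp only [hmul]
            have := integral_comp_sub_eq_of_eq_zero (f := fun s => (B y *ᵥ q s y) i)
              (c := c) (m := -1 - K * L) (δ := a i x - a i y) (t := t)
              ((hkc i).comp (by fun_prop : Continuous fun s : ℝ => (s, y)))
              (fun s hs => by simp [hqlow s y hy' hs]) (by linarith) (by linarith)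
            simpa only [sub_sub_eq_add_sub, sub_add_eq_add_sub] using this
          · exact (hcomp.continuousOn.integrableOn_compact
              (isCompact_uIcc.prod isCompact_uIcc)).mono_set
              (prod_mono uIoc_subset_uIcc uIoc_subset_uIcc)

/-- A function given by integration along the characteristics `t - a(x) = const` that is of class
`C¹` in time satisfies the differential equation. -/
lemma hasDerivAt_of_char_integral_eq {L : ℝ} {i : Fin 2} {a w : ℝ → ℝ} (ha : Continuous a)
    (had : ∀ x, HasDerivAt a (w x) x) {B : ℝ → Matrix (Fin 2) (Fin 2) ℝ} (hB : Continuous B)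
    {q ρ : ℝ → ℝ → Fin 2 → ℝ} (hqc : Continuous (Function.uncurry q))
    (hρc : Continuous (Function.uncurry ρ))
    (hρt : ∀ t x, HasDerivAt (fun s => ρ s x) (q t x) t) {G : ℝ → ℝ}
    (hρint : ∀ t, ∀ x ∈ Icc 0 L, ρ t x i = G (t - a x)
      + ∫ y in 0..x, (B y *ᵥ ρ (t - a x + a y) y) i) (t : ℝ) {x : ℝ} (hx : x ∈ Ioo 0 L) :
    HasDerivAt (fun y => ρ t y i) ((B x *ᵥ ρ t x) i - q t x i * w x) x := by
  have hqi : Continuous fun p : ℝ × ℝ => q p.1 p.2 i := (continuous_apply i).comp hqc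
  have hhc : Continuous fun p : ℝ × ℝ => (B p.2 *ᵥ ρ p.1 p.2) i :=
    (continuous_apply i).comp ((hB.comp continuous_snd).matrix_mulVec hρc)
  -- In the coordinates y and τ = t - a(y) the characteristics become τ = const. There ∂_y is the
  -- integrand and ∂_τ is q, both continuous, so S is jointly differentiable; its restriction to the
  -- curve τ = t - a(y) is the function of y at fixed t.
  let S : ℝ → ℝ → ℝ := fun y τ => ρ (τ + a y) y i
  let S₁ : ℝ → ℝ → ℝ →L[ℝ] ℝ := fun y τ =>
    ContinuousLinearMap.toSpanSingleton ℝ ((B y *ᵥ ρ (τ + a y) y) i)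
  let S₂ : ℝ → ℝ → ℝ →L[ℝ] ℝ := fun y τ =>
    ContinuousLinearMap.toSpanSingleton ℝ (q (τ + a y) y i)
  have hSeq : ∀ y ∈ Icc 0 L, ∀ τ, S y τ = G τ
      + ∫ z in 0..y, (B z *ᵥ ρ (τ + a z) z) i := by
    intro y hy τ
    simp only [S]
    rw [hρint _ y hy]
    simp only [add_sub_cancel_right]
  have hS := hasStrictFDerivAt_uncurry_coprod (𝕜 := ℝ) (u := (x, t - a x)) (f := S)
    (f₁ := S₁) (f₂ := S₂) ?_ ?_ ?_ ?_
  · have hcurve : HasDerivAt (fun y => (y, t - a y)) ((1 : ℝ), -w x) x :=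
      (hasDerivAt_id x).prodMk ((had x).const_sub t)
    have := hS.hasFDerivAt.comp_hasDerivAt x hcurve
    refine (this.congr_deriv ?_).congr_of_eventuallyEq ?_
    · simp [S₁, S₂, Function.HasUncurry.uncurry]
      ring
    · refine Filter.Eventually.of_forall fun y => ?_
      simp [S, Function.HasUncurry.uncurry]
  · have : ∀ᶠ p : ℝ × ℝ in nhds (x, t - a x), p.1 ∈ Ioo 0 L :=
      continuous_fst.continuousAt.eventually (isOpen_Ioo.mem_nhds hx)
    filter_upwards [this] with p hp
    have hcz : Continuous fun z => (B z *ᵥ ρ (p.2 + a z) z) i :=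
      hhc.comp (by fun_prop : Continuous fun z : ℝ => (p.2 + a z, z))
    have h1 : HasDerivAt (fun y => G p.2
        + ∫ z in 0..y, (B z *ᵥ ρ (p.2 + a z) z) i) ((B p.1 *ᵥ ρ (p.2 + a p.1) p.1) i) p.1 :=
      (hcz.integral_hasStrictDerivAt 0 p.1).hasDerivAt.const_add _
    refine (h1.congr_of_eventuallyEq ?_).hasFDerivAt
    filter_upwards [isOpen_Ioo.mem_nhds hp] with y hy
    exact hSeq y (Ioo_subset_Icc_self hy) p.2
  · refine Filter.Eventually.of_forall fun p => ?_
    have h1 := hasDerivAt_pi.1 (hρt (p.2 + a p.1) p.1) i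
    exact (h1.comp_add_const p.2 (a p.1)).hasFDerivAt
  · refine Continuous.continuousAt ?_
    have : Continuous fun p : ℝ × ℝ => (B p.1 *ᵥ ρ (p.2 + a p.1) p.1) i :=
      hhc.comp (by fun_prop : Continuous fun p : ℝ × ℝ => (p.2 + a p.1, p.1))
    exact (ContinuousLinearMap.toSpanSingletonCLE (𝕜 := ℝ) (E := ℝ)).continuous.comp this
  · refine Continuous.continuousAt ?_
    have : Continuous fun p : ℝ × ℝ => q (p.2 + a p.1) p.1 i :=
      hqi.comp (by fun_prop : Continuous fun p : ℝ × ℝ => (p.2 + a p.1, p.1))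
    exact (ContinuousLinearMap.toSpanSingletonCLE (𝕜 := ℝ) (E := ℝ)).continuous.comp this

/-- There is a classical solution of the differential equation, with suitable boundary values, that
starts at `0` and reaches a given static solution in finite time. -/
theorem exists_classical_steering {η₀ : ℝ} {u : Plane} {r : ℝ → Plane}
    (h : Regular L dp dm M) (hr : IsStaticSolution L dp dm M η₀ u r) :
    ∃ (T₀ : ℝ) (ρ ρt : ℝ → ℝ → Fin 2 → ℝ),
      Continuous (Function.uncurry ρ) ∧ Continuous (Function.uncurry ρt) ∧
      (∃ C, ∀ t x i, |ρt t x i| ≤ C) ∧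
      (∀ t x, HasDerivAt (fun s => ρ s x) (ρt t x) t) ∧
      (∀ t, ∀ x ∈ Ioo 0 L, ∀ i, HasDerivAt (fun y => ρ t y i)
        ((η₀ * (M x *ᵥ ρ t x) i - ρt t x i) / speed dp dm i x) x) ∧
      (∀ x ∈ Icc 0 L, ρ 0 x = 0) ∧ ∀ t ≥ T₀, ∀ x ∈ Icc 0 L, ρ t x = (r x).ofLp := by
  have hL := h.pos.le
  set B := IccExtend hL (domRestrict (Icc 0 L) (staticMatrix dp dm M η₀)) with hBdef
  have hB : Continuous B :=
    (continuousOn_iff_continuous_domRestrict.1 (h.continuousOn_staticMatrix η₀)).Icc_extend'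
  have hBe : ∀ x ∈ Icc 0 L, B x = staticMatrix dp dm M η₀ x :=
    fun x hx => IccExtend_of_mem hL _ hx
  set w : Fin 2 → ℝ → ℝ := fun i =>
    IccExtend hL (domRestrict (Icc 0 L) fun x => (speed dp dm i x)⁻¹) with hw
  have hwc : ∀ i, Continuous (w i) := fun i => (continuousOn_iff_continuous_domRestrict.1
    ((h.continuousOn_speed i).inv₀ fun x hx => h.speed_ne i hx)).Icc_extend'
  have hwe : ∀ i, ∀ x ∈ Icc 0 L, w i x = (speed dp dm i x)⁻¹ :=
    fun i x hx => IccExtend_of_mem hL _ hx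
  -- The signed travel time from 0 to x, negative for the left-going component. Its slope is bounded
  -- by K on [0, L].
  set a : Fin 2 → ℝ → ℝ := fun i x => ∫ y in 0..x, w i y with ha
  have had : ∀ i x, HasDerivAt (a i) (w i x) x := fun i x =>
    ((hwc i).integral_hasStrictDerivAt 0 x).hasDerivAt
  have hac : ∀ i, Continuous (a i) := fun i =>
    continuous_iff_continuousAt.2 fun x => (had i x).continuousAt
  obtain ⟨K, hK0, hK⟩ : ∃ K, 0 ≤ K ∧ ∀ i, ∀ x ∈ Icc 0 L, |w i x| ≤ K := by
    have hc : ∀ i, ∃ b, ∀ y ∈ Icc 0 L, |w i y| ≤ b := fun i =>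
      isCompact_Icc.exists_bound_of_continuousOn (hwc i).continuousOn
    choose c hc using hc
    refine ⟨∑ i, |c i|, by positivity, fun i x hx => (hc i x hx).trans ((le_abs_self _).trans ?_)⟩
    exact Finset.single_le_sum (f := fun i => |c i|) (fun _ _ => abs_nonneg _) (Finset.mem_univ i)
  have haK : ∀ i, ∀ x ∈ Icc 0 L, ∀ y ∈ Icc 0 x, |a i x - a i y| ≤ K * (x - y) := by
    intro i x hx y hy
    have h1 : a i x - a i y = ∫ z in y..x, w i z :=
      intervalIntegral.integral_interval_sub_left ((hwc i).intervalIntegrable _ _)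
        ((hwc i).intervalIntegrable _ _)
    rw [h1, ← abs_of_nonneg (sub_nonneg.2 hy.2)]
    refine intervalIntegral.norm_integral_le_of_norm_le_const (f := w i) fun z hz => hK i z ?_
    rw [uIoc_of_le hy.2] at hz
    exact ⟨hy.1.trans hz.1.le, hz.2.trans hx.2⟩
  have ha0 : ∀ i, a i 0 = 0 := fun i => by simp [ha]
  -- The bump lives in [-1, 1]; its normalization to mass one makes the time integral of the data at
  -- x = 0 run from 0 to r(0).
  let bump : ContDiffBump (0 : ℝ) := ⟨1 / 2, 1, by norm_num, by norm_num⟩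
  set ψ : ℝ → ℝ := bump.normed volume with hψ
  have hψc : Continuous ψ := bump.continuous_normed
  have hψ0 : ∀ t, t ≤ -1 ∨ 1 ≤ t → ψ t = 0 := by
    intro t ht
    rw [← Function.notMem_support, hψ, bump.support_normed_eq]
    simp only [Metric.mem_ball, Real.dist_eq, sub_zero, not_lt, bump]
    exact le_abs'.2 ht
  have hψ1 : ∫ t, ψ t = 1 := bump.integral_normed
  obtain ⟨Cψ, hCψ⟩ : ∃ C, ∀ t, |ψ t| ≤ C :=
    bump.hasCompactSupport_normed.exists_bound_of_continuous hψc
  have hCψ0 : 0 ≤ Cψ := (abs_nonneg _).trans (hCψ 0)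
  set v : Fin 2 → ℝ := (r 0).ofLp with hv
  obtain ⟨q, hqc, ⟨C, hC⟩, hq, hqs⟩ := exists_transport_solution hL hac hB
    (g := fun t => ψ t • v) (by fun_prop) (G := Cψ * ‖v‖) (fun t i => by
      rw [Pi.smul_apply, smul_eq_mul, abs_mul]
      exact mul_le_mul (hCψ t) (norm_le_pi_norm v i) (abs_nonneg _) hCψ0)
  have hqs' := hqs K (-1) 1 haK ha0 (fun t ht => by simp [hψ0 t ht])
  have hqlow : ∀ t, ∀ x ∈ Icc 0 L, t ≤ -1 - K * L → q t x = 0 := fun t x hx ht =>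
    hqs' t x hx (Or.inl (by nlinarith [hx.2]))
  have hqhigh : ∀ t, ∀ x ∈ Icc 0 L, 1 + K * L ≤ t → q t x = 0 := fun t x hx ht =>
    hqs' t x hx (Or.inr (by nlinarith [hx.2]))
  have hKL : 0 ≤ K * L := by positivity
  -- q vanishes before -1 - KL and time shifts along characteristics are at most KL, so both c and
  -- its shifts lie before the support.
  set c : ℝ := -1 - 3 * (K * L) with hc
  set ρ : ℝ → ℝ → Fin 2 → ℝ := fun t x i => ∫ s in c..t, q s x i with hρ
  have hqi : ∀ i, Continuous fun p : ℝ × ℝ => q p.1 p.2 i := fun i =>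
    (continuous_apply i).comp hqc
  have hqx : ∀ i x, Continuous fun s => q s x i := fun i x =>
    (hqi i).comp (by fun_prop : Continuous fun s : ℝ => (s, x))
  have hρi : ∀ i, Continuous fun p : ℝ × ℝ => ρ p.1 p.2 i := fun i =>
    intervalIntegral.continuous_parametric_intervalIntegral_of_continuous
      (f := fun (p : ℝ × ℝ) s => q s p.2 i)
      ((hqi i).comp (by fun_prop : Continuous fun z : (ℝ × ℝ) × ℝ => (z.2, z.1.2)))
      continuous_fst
  have hρc : Continuous (Function.uncurry ρ) := continuous_pi hρi
  have hρt : ∀ t x, HasDerivAt (fun s => ρ s x) (q t x) t := fun t x =>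
    hasDerivAt_pi.2 fun i => ((hqx i x).integral_hasStrictDerivAt c t).hasDerivAt
  have hρlow : ∀ t ≤ -1 - K * L, ∀ x ∈ Icc 0 L, ρ t x = 0 := by
    intro t ht x hx
    ext i
    rw [hρ]
    simp only [Pi.zero_apply]
    rw [intervalIntegral.integral_congr (g := fun _ => 0)]
    · simp
    intro s hs
    have : s ≤ -1 - K * L := hs.2.trans (max_le (by linarith) ht)
    simp [hqlow s x hx this]
  have hρhigh : ∀ t, 1 + K * L ≤ t → ∀ x ∈ Icc 0 L, ρ t x = ρ (1 + K * L) x := by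
    intro t ht x hx
    ext i
    simp only [hρ]
    rw [← sub_eq_zero, intervalIntegral.integral_interval_sub_left
      ((hqx i x).intervalIntegrable _ _) ((hqx i x).intervalIntegrable _ _),
      intervalIntegral.integral_congr (g := fun _ => 0)]
    · simp
    intro s hs
    rw [uIcc_of_le ht] at hs
    simp [hqhigh s x hx hs.1]
  have hρint : ∀ t, ∀ x ∈ Icc 0 L, ∀ i, ρ t x i = (∫ s in c..t - a i x, ψ s * v i)
      + ∫ y in 0..x, (B y *ᵥ ρ (t - a i x + a i y) y) i :=
    fun t x hx i => integral_transport_eq hac hB hψc hqc hK0 haK ha0 hψ0 hq hqlow t hx i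
  have hx_deriv : ∀ t, ∀ x ∈ Ioo 0 L, ∀ i, HasDerivAt (fun y => ρ t y i)
      ((B x *ᵥ ρ t x) i - q t x i * w i x) x := fun t x hx i =>
    hasDerivAt_of_char_integral_eq (hac i) (had i) hB hqc hρc hρt
      (G := fun τ => ∫ s in c..τ, ψ s * v i) (fun t x hx => hρint t x hx i) t hx
  -- After time 1 + KL the function ρ no longer depends on t, so the characteristic form loses its
  -- time shifts and becomes the integral form of the static ODE with value r(0) at 0; uniqueness
  -- identifies it with r.
  have hfinal : ∀ x ∈ Icc 0 L, ρ (1 + K * L) x = (r x).ofLp := by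
    have hρ1 : Continuous (ρ (1 + K * L)) :=
      hρc.comp (by fun_prop : Continuous fun x : ℝ => (1 + K * L, x))
    have heq : ∀ x ∈ Icc 0 L, ∀ i, ρ (1 + K * L) x i = v i
        + ∫ y in 0..x, (B y *ᵥ ρ (1 + K * L) y) i := by
      intro x hx i
      -- Starting KL later keeps all shifted times in the stationary range, and past the support of
      -- ψ.
      rw [← hρhigh (1 + 2 * (K * L)) (by linarith) x hx, hρint _ x hx i]
      have hax := abs_le.1 (haK i x hx 0 ⟨le_rfl, hx.1⟩)
      rw [ha0 i, sub_zero, sub_zero] at hax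
      have hKx : K * x ≤ K * L := mul_le_mul_of_nonneg_left hx.2 hK0
      congr 1
      · rw [intervalIntegral.integral_mul_const,
          intervalIntegral.integral_eq_integral_of_support_subset, hψ1, one_mul]
        intro s hs
        by_contra hcon
        refine hs (hψ0 s ?_)
        rw [mem_Ioc, not_and_or, not_lt, not_le] at hcon
        rcases hcon with hcon | hcon
        · left; linarith
        · right; linarith
      · refine intervalIntegral.integral_congr fun y hy => ?_
        rw [uIcc_of_le hx.1] at hy
        have hxy := abs_le.1 (haK i x hx y hy)
        have hKxy : K * (x - y) ≤ K * L :=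
          mul_le_mul_of_nonneg_left (by linarith [hy.1, hx.2]) hK0
        rw [hρhigh _ (by linarith) y ⟨hy.1, hy.2.trans hx.2⟩]
    refine linear_ode_unique (h.continuousOn_staticMatrix η₀) (fun x hx => ?_)
      (fun x hx => hr.hasDerivWithinAt_ofLp h hx) ?_
    · rw [← hBe x hx]
      exact hasDerivWithinAt_of_integral_eq hB hρ1 heq hx
    · ext i
      simpa using heq 0 ⟨le_rfl, hL⟩ i
  have hshift : Continuous fun p : ℝ × ℝ => (p.1 + (-1 - K * L), p.2) := by fun_prop
  -- The time shift puts 0 at the moment -1 - KL, up to which ρ vanishes, and T₀ at 1 + KL, where ρ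
  -- has become static.
  refine ⟨2 + 2 * (K * L), fun t x => ρ (t + (-1 - K * L)) x, fun t x => q (t + (-1 - K * L)) x,
    hρc.comp hshift, hqc.comp hshift, ⟨C, fun t x i => hC _ _ _⟩, fun t x => ?_,
    fun t x hx i => ?_, fun x hx => ?_, fun t ht x hx => ?_⟩
  · exact (hρt (t + (-1 - K * L)) x).comp_add_const t (-1 - K * L)
  · have hx' := Ioo_subset_Icc_self hx
    refine (hx_deriv (t + (-1 - K * L)) x hx i).congr_deriv ?_
    rw [hBe x hx', hwe i x hx', staticMatrix_mulVec]
    ring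
  · exact hρlow _ (by linarith) x hx
  · exact (hρhigh _ (by linarith) x hx).trans (hfinal x hx)

/-! ### From classical to weak dynamic solutions -/

lemma memLp_of_continuousOn {a b : ℝ} {f : ℝ → Plane} (hf : ContinuousOn f (Icc a b)) :
    MemLp f 2 (volume.restrict (Ioo a b)) := by
  obtain ⟨C, hC⟩ := isCompact_Icc.exists_bound_of_continuousOn hf
  exact MemLp.of_bound ((hf.mono Ioo_subset_Icc_self).aestronglyMeasurable measurableSet_Ioo) C
    ((ae_restrict_mem measurableSet_Ioo).mono fun x hx => hC x (Ioo_subset_Icc_self hx))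

/-- The element of the state space given by a continuous function. -/
noncomputable def stateOf {L : ℝ} (f : ℝ → Plane) (hf : ContinuousOn f (Icc 0 L)) :
    StateSpace L := (memLp_of_continuousOn hf).toLp f

lemma coeFn_stateOf {L : ℝ} {f : ℝ → Plane} (hf : ContinuousOn f (Icc 0 L)) :
    ∀ᵐ x ∂volume.restrict (Ioo 0 L), stateOf f hf x = f x :=
  (memLp_of_continuousOn hf).coeFn_toLp

lemma integral_congr_ae_Ioo {E : Type*} [NormedAddCommGroup E] [NormedSpace ℝ E] {a b : ℝ}
    (hab : a ≤ b) {f g : ℝ → E} (h : ∀ᵐ x ∂volume.restrict (Ioo a b), f x = g x) :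
    ∫ x in a..b, f x = ∫ x in a..b, g x := by
  rw [intervalIntegral.integral_of_le hab, intervalIntegral.integral_of_le hab,
    integral_Ioc_eq_integral_Ioo, integral_Ioc_eq_integral_Ioo]
  exact integral_congr_ae h

lemma integrableOn_uIoc_prod {a b : ℝ} (ha : 0 ≤ a) (hb : 0 ≤ b) {F : ℝ → ℝ → ℝ}
    (hF : ContinuousOn (Function.uncurry F) (Icc 0 a ×ˢ Icc 0 b)) :
    IntegrableOn (Function.uncurry F) (uIoc 0 a ×ˢ uIoc 0 b) := by
  rw [uIoc_of_le ha, uIoc_of_le hb]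
  exact (hF.integrableOn_compact (isCompact_Icc.prod isCompact_Icc)).mono_set
    (prod_mono Ioc_subset_Icc_self Ioc_subset_Icc_self)

lemma intervalIntegrable_integral {a b : ℝ} (ha : 0 ≤ a) (hb : 0 ≤ b) {F : ℝ → ℝ → ℝ}
    (hF : ContinuousOn (Function.uncurry F) (Icc 0 a ×ˢ Icc 0 b)) :
    IntervalIntegrable (fun t => ∫ x in 0..b, F t x) volume 0 a := by
  have h := integrableOn_uIoc_prod ha hb hF
  rw [IntegrableOn, Measure.volume_eq_prod, ← Measure.prod_restrict] at h
  have h2 := h.integral_prod_left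
  rw [intervalIntegrable_iff]
  refine h2.congr (Filter.Eventually.of_forall fun t => ?_)
  simp only [Function.uncurry_apply_pair]
  rw [intervalIntegral.integral_of_le hb, uIoc_of_le hb]

lemma continuousOn_dotProduct {X : Type*} [TopologicalSpace X] {s : Set X} {f g : X → Fin 2 → ℝ}
    (hf : ContinuousOn f s) (hg : ContinuousOn g s) : ContinuousOn (fun x => f x ⬝ᵥ g x) s :=
  continuousOn_finsetSum _ fun i _ => (continuousOn_pi.1 hf i).mul (continuousOn_pi.1 hg i)

lemma Regular.continuousOn_adjoint_test (h : Regular L dp dm M) (η₀ : ℝ) {T : ℝ}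
    {φ φt φx : ℝ → ℝ → Fin 2 → ℝ} (hφ : IsTestFunction L T φ φt φx) :
    ContinuousOn (fun p : ℝ × ℝ => φt p.1 p.2 + (speedMatrix dp dm p.2 *ᵥ φx p.1 p.2
      + matrixDeriv L (speedMatrix dp dm) p.2 *ᵥ φ p.1 p.2) + η₀ • ((M p.2)ᵀ *ᵥ φ p.1 p.2))
      (Icc 0 T ×ˢ Icc 0 L) := by
  have hsnd : ∀ {f : ℝ → ℝ}, ContinuousOn f (Icc 0 L) →
      ContinuousOn (fun p : ℝ × ℝ => f p.2) (Icc 0 T ×ˢ Icc 0 L) := fun hf =>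
    hf.comp continuousOn_snd fun p hp => hp.2
  refine continuousOn_pi.2 fun i => ?_
  simp only [speedMatrix_mulVec, matrixDeriv_speedMatrix_mulVec, Pi.add_apply, Pi.smul_apply,
    Matrix.mulVec, dotProduct, Matrix.transpose_apply, smul_eq_mul]
  have h0 := fun i => continuousOn_pi.1 hφ.continuousOn i
  have h1 := fun i => continuousOn_pi.1 hφ.continuousOn_t i
  have h2 := fun i => continuousOn_pi.1 hφ.continuousOn_x i
  refine ((h1 i).add (((hsnd (h.continuousOn_speed i)).mul (h2 i)).add
    ((hsnd (h.continuousOn_deriv_speed i)).mul (h0 i)))).add (continuousOn_const.mul ?_)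
  exact continuousOn_finsetSum _ fun j _ => (hsnd (h.continuousOn_coupling j i)).mul (h0 j)

/-- A classical solution satisfies the weak form. -/
lemma weak_of_classical (h : Regular L dp dm M) {η₀ : ℝ} {ρ ρt : ℝ → ℝ → Fin 2 → ℝ}
    (hρ : Continuous (Function.uncurry ρ)) (hρt : Continuous (Function.uncurry ρt))
    (hdt : ∀ t x, HasDerivAt (fun s => ρ s x) (ρt t x) t)
    (hdx : ∀ t, ∀ x ∈ Ioo 0 L, ∀ i, HasDerivAt (fun y => ρ t y i)
        ((η₀ * (M x *ᵥ ρ t x) i - ρt t x i) / speed dp dm i x) x)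
    (h0 : ∀ x ∈ Icc 0 L, ρ 0 x = 0) {T : ℝ} {φ φt φx : ℝ → ℝ → Fin 2 → ℝ}
    (hφ : IsTestFunction L T φ φt φx) {τ : ℝ} (hτ : τ ∈ Icc 0 T) :
    ∫ t in 0..τ, ∫ x in 0..L, ρ t x ⬝ᵥ
        (φt t x + (speedMatrix dp dm x *ᵥ φx t x + matrixDeriv L (speedMatrix dp dm) x *ᵥ φ t x)
          + η₀ • ((M x)ᵀ *ᵥ φ t x))
      = (∫ x in 0..L, ρ τ x ⬝ᵥ φ τ x)
        + ∫ t in 0..τ, (ρ t L ⬝ᵥ (speedMatrix dp dm L *ᵥ φ t L)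
            - ρ t 0 ⬝ᵥ (speedMatrix dp dm 0 *ᵥ φ t 0)) := by
  have hL := h.pos.le
  have hsub : Icc 0 τ ⊆ Icc 0 T := Icc_subset_Icc_right hτ.2
  have hsub2 : Icc 0 τ ×ˢ Icc 0 L ⊆ Icc 0 T ×ˢ Icc 0 L := prod_mono hsub subset_rfl
  set I : ℝ → ℝ → ℝ := fun t x => ρ t x ⬝ᵥ
        (φt t x + (speedMatrix dp dm x *ᵥ φx t x + matrixDeriv L (speedMatrix dp dm) x *ᵥ φ t x)
          + η₀ • ((M x)ᵀ *ᵥ φ t x)) with hI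
  set W : ℝ → ℝ → ℝ := fun t x => ρt t x ⬝ᵥ φ t x + ρ t x ⬝ᵥ φt t x with hW
  set S : ℝ → ℝ → ℝ := fun t x => ρ t x ⬝ᵥ (speedMatrix dp dm x *ᵥ φ t x) with hS
  have hIc : ContinuousOn (Function.uncurry I) (Icc 0 τ ×ˢ Icc 0 L) :=
    continuousOn_dotProduct hρ.continuousOn ((h.continuousOn_adjoint_test η₀ hφ).mono hsub2)
  have hWc : ContinuousOn (Function.uncurry W) (Icc 0 τ ×ˢ Icc 0 L) :=
    (continuousOn_dotProduct hρt.continuousOn (hφ.continuousOn.mono hsub2)).add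
      (continuousOn_dotProduct hρ.continuousOn (hφ.continuousOn_t.mono hsub2))
  have hSc : ContinuousOn (Function.uncurry S) (Icc 0 τ ×ˢ Icc 0 L) := by
    refine continuousOn_dotProduct hρ.continuousOn (continuousOn_pi.2 fun i => ?_)
    simp only [speedMatrix_mulVec]
    exact ((h.continuousOn_speed i).comp continuousOn_snd fun p hp => hp.2).mul
      (continuousOn_pi.1 (hφ.continuousOn.mono hsub2) i)
  have hslice : ∀ {F : ℝ → ℝ → ℝ}, ContinuousOn (Function.uncurry F) (Icc 0 τ ×ˢ Icc 0 L) →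
      ∀ t ∈ Icc 0 τ, ContinuousOn (F t) (Icc 0 L) := fun hF t ht =>
    hF.comp (f := fun x => (t, x)) (by fun_prop) fun x hx => ⟨ht, hx⟩
  have hslice' : ∀ {F : ℝ → ℝ → ℝ}, ContinuousOn (Function.uncurry F) (Icc 0 τ ×ˢ Icc 0 L) →
      ∀ x ∈ Icc 0 L, ContinuousOn (fun t => F t x) (Icc 0 τ) := fun hF x hx =>
    hF.comp (f := fun t => (t, x)) (by fun_prop) fun t ht => ⟨ht, hx⟩
  -- By the differential equation, I - W is the x-derivative of ρ · Dφ, while W is the t-derivative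
  -- of ρ · φ.
  have hspace : ∀ t ∈ Icc 0 τ, ∫ x in 0..L, (I t x - W t x) = S t L - S t 0 := by
    intro t ht
    refine intervalIntegral.integral_eq_sub_of_hasDerivAt_of_le hL (hslice hSc t ht)
      (fun x hx => ?_) ?_
    · have hx' := Ioo_subset_Icc_self hx
      have hnhds : Icc 0 L ∈ nhds x := Icc_mem_nhds hx.1 hx.2
      have hsp := fun i => (h.hasDerivWithinAt_speed i hx').hasDerivAt hnhds
      have hph := fun i => hasDerivAt_pi.1 ((hφ.hasDeriv_x t (hsub ht) x hx').hasDerivAt hnhds) i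
      have hder := fun i => (hdx t x hx i).mul ((hsp i).mul (hph i))
      have hsum := (hder 0).add (hder 1)
      simp only [hS, speedMatrix_mulVec, dotProduct, Fin.sum_univ_two]
      refine hsum.congr_deriv ?_
      simp only [hI, hW, speedMatrix_mulVec, matrixDeriv_speedMatrix_mulVec, Pi.add_apply,
        Pi.smul_apply, Matrix.mulVec, dotProduct, Matrix.transpose_apply, smul_eq_mul,
        Fin.sum_univ_two, Pi.mul_apply]
      have := h.speed_ne 0 hx'
      have := h.speed_ne 1 hx'
      field_simp
      ring
    · refine ContinuousOn.intervalIntegrable ?_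
      rw [uIcc_of_le hL]
      exact (hslice hIc t ht).sub (hslice hWc t ht)
  have htime : ∀ x ∈ Icc 0 L, ∫ t in 0..τ, W t x = ρ τ x ⬝ᵥ φ τ x := by
    intro x hx
    have hder : ∀ t ∈ Icc 0 τ, HasDerivWithinAt (fun s => ρ s x ⬝ᵥ φ s x) (W t x) (Icc 0 τ) t := by
      intro t ht
      have h1 := fun i => hasDerivAt_pi.1 (hdt t x) i
      have h2 := fun i => hasDerivWithinAt_pi.1 ((hφ.hasDeriv_t t (hsub ht) x hx).mono hsub) i
      have := ((h1 0).hasDerivWithinAt.mul (h2 0)).add ((h1 1).hasDerivWithinAt.mul (h2 1))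
      simp only [dotProduct, Fin.sum_univ_two]
      refine this.congr_deriv ?_
      simp only [hW, dotProduct, Fin.sum_univ_two]
      ring
    rw [intervalIntegral.integral_eq_sub_of_hasDerivAt_of_le hτ.1
      (fun t ht => (hder t ht).continuousWithinAt)
      (fun t ht => (hder t (Ioo_subset_Icc_self ht)).hasDerivAt (Icc_mem_nhds ht.1 ht.2)), h0 x hx]
    · simp
    · refine ContinuousOn.intervalIntegrable ?_
      rw [uIcc_of_le hτ.1]
      exact hslice' hWc x hx
  have hbd : IntervalIntegrable (fun t => S t L - S t 0) volume 0 τ := by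
    refine ContinuousOn.intervalIntegrable ?_
    rw [uIcc_of_le hτ.1]
    exact (hslice' hSc L ⟨hL, le_rfl⟩).sub (hslice' hSc 0 ⟨le_rfl, hL⟩)
  calc ∫ t in 0..τ, ∫ x in 0..L, I t x
      = ∫ t in 0..τ, ((∫ x in 0..L, W t x) + (S t L - S t 0)) := by
        refine intervalIntegral.integral_congr fun t ht => ?_
        rw [uIcc_of_le hτ.1] at ht
        have hiI : IntervalIntegrable (I t) volume 0 L := by
          refine ContinuousOn.intervalIntegrable ?_
          rw [uIcc_of_le hL]
          exact hslice hIc t ht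
        have hiW : IntervalIntegrable (W t) volume 0 L := by
          refine ContinuousOn.intervalIntegrable ?_
          rw [uIcc_of_le hL]
          exact hslice hWc t ht
        have := hspace t ht
        rw [intervalIntegral.integral_sub hiI hiW] at this
        linarith
    _ = (∫ t in 0..τ, ∫ x in 0..L, W t x) + ∫ t in 0..τ, (S t L - S t 0) :=
        intervalIntegral.integral_add (intervalIntegrable_integral hτ.1 hL hWc) hbd
    _ = _ := by
        rw [intervalIntegral_intervalIntegral_swap (integrableOn_uIoc_prod hτ.1 hL hWc)]
        congr 1
        refine intervalIntegral.integral_congr fun x hx => ?_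
        rw [uIcc_of_le hL] at hx
        exact htime x hx

/-- A static solution can be reached from `0` in finite time, with continuous boundary values. -/
theorem exists_steering {η₀ : ℝ} {u : Plane} {r : ℝ → Plane}
    (h : Regular L dp dm M) (hr : IsStaticSolution L dp dm M η₀ u r) :
    ∃ (T₀ : ℝ) (u' R' : ℝ → Plane) (r' : ℝ → StateSpace L), Continuous u' ∧ Continuous R' ∧
      (∀ T, IsDynamicSolution L dp dm M η₀ T u' r' R') ∧
      ∀ t ≥ T₀, u' t = u ∧ R' t = !₂[r L 0, r 0 1] := by
  have hL := h.pos.le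
  obtain ⟨T₀, ρ, ρt, hρ, hρt, ⟨C, hC⟩, hdt, hdx, h0, hend⟩ := exists_classical_steering h hr
  have hslice : ∀ t, Continuous (ρ t) := fun t =>
    hρ.comp (by fun_prop : Continuous fun x : ℝ => (t, x))
  have hslice' : ∀ x, Continuous fun t => ρ t x := fun x =>
    hρ.comp (by fun_prop : Continuous fun t : ℝ => (t, x))
  have hcont : ∀ t, ContinuousOn (fun x => (WithLp.toLp 2 (ρ t x) : Plane)) (Icc 0 L) := by
    intro t
    have := hslice t
    fun_prop
  have hu : Continuous fun t => (!₂[ρ t 0 0, ρ t L 1] : Plane) := by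
    have := hslice' 0
    have := hslice' L
    fun_prop
  have hR : Continuous fun t => (!₂[ρ t L 0, ρ t 0 1] : Plane) := by
    have := hslice' 0
    have := hslice' L
    fun_prop
  refine ⟨T₀, fun t => !₂[ρ t 0 0, ρ t L 1], fun t => !₂[ρ t L 0, ρ t 0 1],
    fun t => stateOf _ (hcont t), hu, hR, fun T => ?_, fun t ht => ?_⟩
  · refine ⟨memLp_of_continuousOn hu.continuousOn, memLp_of_continuousOn hR.continuousOn, ?_, ?_,
      fun φ φt φx hφ τ hτ => ?_⟩
    · have hlip : ∀ t s x i, |ρ t x i - ρ s x i| ≤ C * |t - s| := fun t s x i =>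
        Convex.norm_image_sub_le_of_norm_hasDerivWithin_le
          (fun z _ => (hasDerivAt_pi.1 (hdt z x) i).hasDerivWithinAt) (fun z _ => hC z x i)
          convex_univ (mem_univ s) (mem_univ t)
      have hC0 : 0 ≤ C := (abs_nonneg _).trans (hC 0 0 0)
      -- The curve is Lipschitz into L² since ρ_t is bounded by C: m converts a sup bound into an L²
      -- bound, and 2C covers the Euclidean norm of two components.
      set m : ℝ := (measureUnivNNReal (volume.restrict (Ioo 0 L)) : ℝ) ^ (ENNReal.toReal 2)⁻¹
      have hm : 0 ≤ m := by positivity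
      refine (LipschitzWith.of_dist_le_mul (K := (m * (2 * C)).toNNReal)
        fun t s => ?_).continuous.continuousOn
      rw [dist_eq_norm, Real.coe_toNNReal _ (by positivity), mul_assoc]
      refine Lp.norm_le_of_ae_bound (by positivity) ?_
      filter_upwards [Lp.coeFn_sub (stateOf _ (hcont t)) (stateOf _ (hcont s)),
        coeFn_stateOf (hcont t), coeFn_stateOf (hcont s)] with x h1 h2 h3
      rw [h1, Pi.sub_apply, h2, h3, Real.dist_eq]
      rw [EuclideanSpace.norm_eq]
      refine Real.sqrt_le_iff.2 ⟨by positivity, ?_⟩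
      simp only [Fin.sum_univ_two, PiLp.sub_apply, Real.norm_eq_abs]
      have ha := hlip t s x 0
      have hb := hlip t s x 1
      have ha' := abs_nonneg (ρ t x 0 - ρ s x 0)
      have hb' := abs_nonneg (ρ t x 1 - ρ s x 1)
      nlinarith [mul_nonneg hC0 (abs_nonneg (t - s))]
    · refine Lp.ext ?_
      filter_upwards [coeFn_stateOf (hcont 0), Lp.coeFn_zero Plane 2 (volume.restrict (Ioo 0 L)),
        ae_restrict_mem measurableSet_Ioo] with x h1 h2 hx
      rw [h1, h2, h0 x (Ioo_subset_Icc_self hx)]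
      rfl
    · have key := weak_of_classical h hρ hρt hdt hdx h0 hφ hτ
      have e1 : ∀ t, ![(!₂[ρ t L 0, ρ t 0 1] : Plane) 0, (!₂[ρ t 0 0, ρ t L 1] : Plane) 1]
          = ρ t L := fun t => by ext i; fin_cases i <;> rfl
      have e2 : ∀ t, ![(!₂[ρ t 0 0, ρ t L 1] : Plane) 0, (!₂[ρ t L 0, ρ t 0 1] : Plane) 1]
          = ρ t 0 := fun t => by ext i; fin_cases i <;> rfl
      simp only [e1, e2]
      have e3 : ∀ (t : ℝ) (g : ℝ → Fin 2 → ℝ),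
          ∫ x in 0..L, (stateOf _ (hcont t) x).ofLp ⬝ᵥ g x = ∫ x in 0..L, ρ t x ⬝ᵥ g x := by
        intro t g
        refine integral_congr_ae_Ioo hL ?_
        filter_upwards [coeFn_stateOf (hcont t)] with x hx
        rw [hx]
      simp only [e3]
      exact key
  · have hr0 := hend t ht 0 ⟨le_rfl, hL⟩
    have hrL := hend t ht L ⟨hL, le_rfl⟩
    simp only [hr0, hrL]
    refine ⟨?_, trivial⟩
    ext i
    fin_cases i
    · exact hr.left
    · exact hr.right

/-! ### Weak derivatives in x and the energy identity -/

lemma ae_hasDerivAt_primitive {g : ℝ → ℝ} (hL : 0 ≤ L) (hg : IntervalIntegrable g volume 0 L)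
    (b : ℝ) : ∀ᵐ x, x ∈ Icc 0 L → HasDerivAt (fun x => b + ∫ s in 0..x, g s) (g x) x := by
  filter_upwards [hg.ae_hasDerivAt_integral] with x hx hxL
  rw [uIcc_of_le hL] at hx
  exact (hx hxL 0 ⟨le_rfl, hL⟩).const_add b

lemma absolutelyContinuousOnInterval_primitive {g : ℝ → ℝ}
    (hg : IntervalIntegrable g volume 0 L) (b : ℝ) :
    AbsolutelyContinuousOnInterval (fun x => b + ∫ s in 0..x, g s) 0 L :=
  (contDiffOn_const (c := b)).absolutelyContinuousOnInterval.fun_add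
    (hg.absolutelyContinuousOnInterval_intervalIntegral left_mem_uIcc)

/-- Integration by parts for a primitive and a function of class `C¹`. -/
lemma integral_primitive_mul (hL : 0 < L) {g ζ ζ' : ℝ → ℝ}
    (hg : IntervalIntegrable g volume 0 L) (b : ℝ) (hζ : ContDiffOn ℝ 1 ζ (Icc 0 L))
    (hζ' : ∀ x ∈ Ioo 0 L, HasDerivAt ζ (ζ' x) x) :
    ∫ x in 0..L, (g x * ζ x + (b + ∫ s in 0..x, g s) * ζ' x)
      = (b + ∫ s in 0..L, g s) * ζ L - b * ζ 0 := by
  have hac := absolutelyContinuousOnInterval_primitive hg b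
  have hζac : AbsolutelyContinuousOnInterval ζ 0 L := by
    rw [← uIcc_of_le hL.le] at hζ
    exact hζ.absolutelyContinuousOnInterval
  have h := hac.integral_deriv_mul_eq_sub hζac
  simp only [intervalIntegral.integral_same, add_zero] at h
  rw [← h]
  refine integral_congr_ae_Ioo hL.le ?_
  filter_upwards [ae_restrict_of_ae (ae_hasDerivAt_primitive hL.le hg b),
    ae_restrict_mem measurableSet_Ioo] with x hx hxL
  rw [(hx (Ioo_subset_Icc_self hxL)).deriv, (hζ' x hxL).deriv]

/-- A function with an integrable weak derivative, tested up to the boundary, is the primitive of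
its weak derivative, and it attains the boundary values. -/
lemma eq_primitive_of_weak_deriv (hL : 0 < L) {y g : ℝ → ℝ}
    (hy : IntervalIntegrable y volume 0 L) (hg : IntervalIntegrable g volume 0 L) {b b' : ℝ}
    (h : ∀ ζ ζ' : ℝ → ℝ, (∀ x, HasDerivAt ζ (ζ' x) x) → Continuous ζ' →
      ∫ x in 0..L, (g x * ζ x + y x * ζ' x) = b' * ζ L - b * ζ 0) :
    (∀ᵐ x ∂volume.restrict (Ioo 0 L), y x = b + ∫ s in 0..x, g s) ∧
      b' = b + ∫ s in 0..L, g s := by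
  set Y : ℝ → ℝ := fun x => b + ∫ s in 0..x, g s with hY
  have hYc : ContinuousOn Y (uIcc 0 L) :=
    (absolutelyContinuousOnInterval_primitive hg b).continuousOn
  have hYi : IntervalIntegrable Y volume 0 L := hYc.intervalIntegrable
  -- The primitive Y satisfies the identity assumed for y, with Y(L) in place of b'; in the
  -- difference g and b cancel.
  have hdiff : ∀ ζ ζ' : ℝ → ℝ, (∀ x, HasDerivAt ζ (ζ' x) x) → Continuous ζ' →
      ∫ x in 0..L, (y x - Y x) * ζ' x = (b' - Y L) * ζ L := by
    intro ζ ζ' hd hc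
    have hζc : Continuous ζ := continuous_iff_continuousAt.2 fun x => (hd x).continuousAt
    have hζ1 : ContDiff ℝ 1 ζ := by
      rw [contDiff_one_iff_deriv]
      refine ⟨fun x => (hd x).differentiableAt, ?_⟩
      rwa [show deriv ζ = ζ' from funext fun x => (hd x).deriv]
    have h1 := h ζ ζ' hd hc
    have h2 := integral_primitive_mul hL hg b hζ1.contDiffOn fun x _ => hd x
    have hi0 : IntervalIntegrable (fun x => g x * ζ x) volume 0 L :=
      hg.mul_continuousOn hζc.continuousOn
    have hi1 : IntervalIntegrable (fun x => y x * ζ' x) volume 0 L :=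
      hy.mul_continuousOn hc.continuousOn
    have hi2 : IntervalIntegrable (fun x => Y x * ζ' x) volume 0 L :=
      hYi.mul_continuousOn hc.continuousOn
    have h3 : ∫ x in 0..L, (y x - Y x) * ζ' x
        = (∫ x in 0..L, (g x * ζ x + y x * ζ' x)) - ∫ x in 0..L, (g x * ζ x + Y x * ζ' x) := by
      rw [← intervalIntegral.integral_sub (hi0.add hi1) (hi0.add hi2)]
      refine intervalIntegral.integral_congr fun x _ => ?_
      ring
    rw [h3, h1, h2]
    ring
  have hb : b' = Y L := by
    have := hdiff (fun _ => 1) (fun _ => 0) (fun x => hasDerivAt_const x 1) continuous_const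
    simp at this
    linarith
  refine ⟨?_, hb⟩
  have hint : IntegrableOn (fun x => y x - Y x) (Ioo 0 L) := by
    have := (hy.sub hYi)
    rw [intervalIntegrable_iff_integrableOn_Ioo_of_le hL.le] at this
    exact this
  have hae := isOpen_Ioo.ae_eq_zero_of_integral_contDiff_smul_eq_zero
    (hint.locallyIntegrableOn) (μ := volume) fun η hη _ hηs => by
      have hηc := hη.continuous
      -- The antiderivative that vanishes at L removes the boundary term. As nothing is asked of ζ
      -- at 0, every η is admissible and y - Y is zero, not merely constant.
      have := hdiff (fun x => ∫ s in L..x, η s) η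
        (fun x => (hηc.integral_hasStrictDerivAt L x).hasDerivAt) hηc
      simp only [intervalIntegral.integral_same, mul_zero] at this
      rw [← this, intervalIntegral.integral_of_le hL.le, integral_Ioc_eq_integral_Ioo,
        setIntegral_eq_integral_of_forall_compl_eq_zero]
      · simp only [smul_eq_mul, mul_comm]
      · intro x hx
        rw [image_eq_zero_of_notMem_tsupport fun hx' => hx (hηs hx'), mul_zero]
  rw [ae_restrict_iff' measurableSet_Ioo]
  filter_upwards [hae] with x hx hxL
  exact sub_eq_zero.1 (hx hxL)

/-- The energy identity for a primitive with a weight of class `C¹`. -/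
lemma integral_weight_mul_primitive_sq (hL : 0 < L) {g w : ℝ → ℝ}
    (hg : IntervalIntegrable g volume 0 L) (b : ℝ) (hw : ContDiffOn ℝ 1 w (Icc 0 L)) :
    ∫ x in 0..L, (2 * w x * ((b + ∫ s in 0..x, g s) * g x)
        + derivWithin w (Icc 0 L) x * (b + ∫ s in 0..x, g s) ^ 2)
      = w L * (b + ∫ s in 0..L, g s) ^ 2 - w 0 * b ^ 2 := by
  have hac := absolutelyContinuousOnInterval_primitive hg b
  have hwac : AbsolutelyContinuousOnInterval w 0 L := by
    rw [← uIcc_of_le hL.le] at hw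
    exact hw.absolutelyContinuousOnInterval
  -- The square is treated as the product (wY) · Y of two absolutely continuous functions.
  have h := (hwac.fun_mul hac).integral_deriv_mul_eq_sub hac
  simp only [intervalIntegral.integral_same, add_zero] at h
  rw [show w L * (b + ∫ s in 0..L, g s) ^ 2 - w 0 * b ^ 2
    = w L * (b + ∫ s in 0..L, g s) * (b + ∫ s in 0..L, g s) - w 0 * b * b by ring, ← h]
  refine integral_congr_ae_Ioo hL.le ?_
  filter_upwards [ae_restrict_of_ae (ae_hasDerivAt_primitive hL.le hg b),
    ae_restrict_mem measurableSet_Ioo] with x hx hxL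
  have hxL' := Ioo_subset_Icc_self hxL
  have hwx : HasDerivAt w (derivWithin w (Icc 0 L) x) x :=
    ((hw.differentiableOn one_ne_zero x hxL').hasDerivWithinAt).hasDerivAt
      (Icc_mem_nhds hxL.1 hxL.2)
  rw [(hx hxL').deriv, (hwx.fun_mul (hx hxL')).deriv]
  ring

/-! ### The Lyapunov condition as energy dissipation in space -/

/-- The weights and the decay rate given by the forward Lyapunov condition: for `v ∈ ℝ²`,
`Σ (eᵢ dᵢ)' vᵢ² + 2 η₀ Σ eᵢ vᵢ (M v)ᵢ ≤ ν Σ eᵢ vᵢ²`. -/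
structure IsDissipative (L : ℝ) (dp dm : ℝ → ℝ) (M : ℝ → Matrix (Fin 2) (Fin 2) ℝ) (η₀ : ℝ)
    (e : Fin 2 → ℝ → ℝ) (ν : ℝ) : Prop where
  rate_neg : ν < 0
  contDiff : ∀ i, ContDiff ℝ 1 (e i)
  pos : ∀ i x, 0 < e i x
  bound : ∀ x ∈ Icc 0 L, ∀ v : Fin 2 → ℝ,
    ∑ i, (derivWithin (fun y => e i y * speed dp dm i y) (Icc 0 L) x * v i ^ 2
      + 2 * η₀ * (e i x * (v i * (M x *ᵥ v) i))) ≤ ν * ∑ i, e i x * v i ^ 2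

/-- Both sides are quadratic in v, so the bound on vectors with vᵀEv = 1 extends to all v by scaling
with the square root of vᵀEv. The sign of η₀ turns -|η₀| into η₀. -/
lemma ForwardLyapunov.exists_isDissipative {L : ℝ} {dp dm : ℝ → ℝ}
    {M : ℝ → Matrix (Fin 2) (Fin 2) ℝ} {η₀ : ℝ} (hη : η₀ ≤ 0)
    (h : ForwardLyapunov L dp dm M η₀) : ∃ e ν, IsDissipative L dp dm M η₀ e ν := by
  obtain ⟨μp, -, μm, -, ν, hν, hb⟩ := h
  set e : Fin 2 → ℝ → ℝ := fun i x => ![Real.exp (-μp * x), Real.exp (μm * x)] i with he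
  have hepos : ∀ i x, 0 < e i x := by
    intro i x
    fin_cases i <;> simp [he, Real.exp_pos]
  refine ⟨e, ν, hν, fun i => ?_, hepos, fun x hx v => ?_⟩
  · fin_cases i
    · change ContDiff ℝ 1 fun x => Real.exp (-μp * x)
      fun_prop
    · change ContDiff ℝ 1 fun x => Real.exp (μm * x)
      fun_prop
  have hE : ∀ v : Fin 2 → ℝ, v ⬝ᵥ (weightMatrix μp μm x *ᵥ v) = ∑ i, e i x * v i ^ 2 := by
    intro v
    simp only [weightMatrix, dotProduct, Matrix.mulVec_diagonal, Fin.sum_univ_two, he]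
    simp
    ring
  have hQ : ∀ v : Fin 2 → ℝ,
      v ⬝ᵥ ((matrixDeriv L (fun y => weightMatrix μp μm y * speedMatrix dp dm y) x
        - |η₀| • (weightMatrix μp μm x * M x + (M x)ᵀ * weightMatrix μp μm x)) *ᵥ v)
      = ∑ i, (derivWithin (fun y => e i y * speed dp dm i y) (Icc 0 L) x * v i ^ 2
        + 2 * η₀ * (e i x * (v i * (M x *ᵥ v) i))) := by
    intro v
    simp only [weightMatrix, speedMatrix, matrixDeriv, speed, Matrix.diagonal_mul_diagonal,
      abs_of_nonpos hη, dotProduct, Matrix.mulVec, Fin.sum_univ_two, he]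
    simp [Matrix.mul_apply, Matrix.diagonal]
    ring
  replace hb := hb x hx
  simp_rw [hQ, hE] at hb
  set s := ∑ i, e i x * v i ^ 2 with hs
  have hs0 : 0 ≤ s := Finset.sum_nonneg fun i _ => mul_nonneg (hepos i x).le (sq_nonneg _)
  rcases hs0.eq_or_lt with h0 | h0
  · have hv : v = 0 := by
      ext i
      have := (Finset.sum_eq_zero_iff_of_nonneg
        (fun i _ => mul_nonneg (hepos i x).le (sq_nonneg (v i)))).1 h0.symm i (Finset.mem_univ i)
      simpa [(hepos i x).ne'] using this
    simp [hv, hs]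
  · have hr : 0 < Real.sqrt s := Real.sqrt_pos.2 h0
    have hr2 : Real.sqrt s ^ 2 = s := Real.sq_sqrt hs0
    have key := hb ((Real.sqrt s)⁻¹ • v) (by
      simp only [Pi.smul_apply, smul_eq_mul, mul_pow, inv_pow, hr2]
      rw [Fin.sum_univ_two] at hs ⊢
      field_simp
      linarith)
    have hscale : ∑ i, (derivWithin (fun y => e i y * speed dp dm i y) (Icc 0 L) x
          * ((Real.sqrt s)⁻¹ • v) i ^ 2
          + 2 * η₀ * (e i x * (((Real.sqrt s)⁻¹ • v) i * (M x *ᵥ (Real.sqrt s)⁻¹ • v) i)))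
        = s⁻¹ * ∑ i, (derivWithin (fun y => e i y * speed dp dm i y) (Icc 0 L) x * v i ^ 2
          + 2 * η₀ * (e i x * (v i * (M x *ᵥ v) i))) := by
      rw [Finset.mul_sum]
      refine Finset.sum_congr rfl fun i _ => ?_
      rw [Matrix.mulVec_smul]
      simp only [Pi.smul_apply, smul_eq_mul]
      have h1 : (Real.sqrt s)⁻¹ * (Real.sqrt s)⁻¹ = s⁻¹ := by rw [← sq, inv_pow, hr2]
      linear_combination (derivWithin (fun y => e i y * speed dp dm i y) (Icc 0 L) x * v i ^ 2
        + 2 * η₀ * (e i x * (v i * (M x *ᵥ v) i))) * h1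
    rw [hscale, inv_mul_le_iff₀ h0] at key
    linarith

lemma memLp_apply {μ : Measure ℝ} {f : ℝ → Plane} (hf : MemLp f 2 μ) (i : Fin 2) :
    MemLp (fun x => f x i) 2 μ :=
  (EuclideanSpace.proj (𝕜 := ℝ) i).comp_memLp' hf

lemma memLp_continuousOn_mul {a b : ℝ} {f c : ℝ → ℝ} (hf : MemLp f 2 (volume.restrict (Ioo a b)))
    (hc : ContinuousOn c (Icc a b)) : MemLp (fun x => c x * f x) 2 (volume.restrict (Ioo a b)) := by
  obtain ⟨C, hC⟩ := isCompact_Icc.exists_bound_of_continuousOn hc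
  refine hf.of_le_mul (c := C) (((hc.mono Ioo_subset_Icc_self).aestronglyMeasurable
    measurableSet_Ioo).mul hf.1) ?_
  filter_upwards [ae_restrict_mem measurableSet_Ioo] with x hx
  rw [norm_mul]
  exact mul_le_mul_of_nonneg_right (hC x (Ioo_subset_Icc_self hx)) (norm_nonneg _)

lemma intervalIntegrable_of_memLp {a b : ℝ} (hab : a ≤ b) {f : ℝ → ℝ}
    (hf : MemLp f 2 (volume.restrict (Ioo a b))) : IntervalIntegrable f volume a b := by
  rw [intervalIntegrable_iff_integrableOn_Ioo_of_le hab]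
  exact hf.integrable one_le_two

lemma intervalIntegrable_mul_of_memLp {a b : ℝ} (hab : a ≤ b) {f g : ℝ → ℝ}
    (hf : MemLp f 2 (volume.restrict (Ioo a b))) (hg : MemLp g 2 (volume.restrict (Ioo a b))) :
    IntervalIntegrable (fun x => f x * g x) volume a b := by
  rw [intervalIntegrable_iff_integrableOn_Ioo_of_le hab]
  exact hf.integrable_mul hg

/-- Energy dissipation: if `y` has the time derivative `f` and boundary values `b` at `0` and `b'`
at `L`, then the derivative of the weighted energy of `y` is bounded by `ν` times the energy plus
the boundary terms. -/
theorem IsDissipative.energy_le (h : Regular L dp dm M) {η₀ ν : ℝ} {e : Fin 2 → ℝ → ℝ}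
    (hd : IsDissipative L dp dm M η₀ e ν) {y f : ℝ → Plane}
    (hy : MemLp y 2 (volume.restrict (Ioo 0 L))) (hf : MemLp f 2 (volume.restrict (Ioo 0 L)))
    {b b' : Fin 2 → ℝ}
    (hweak : ∀ ζ ζ' : ℝ → Fin 2 → ℝ, (∀ x, HasDerivAt ζ (ζ' x) x) → Continuous ζ' →
      ∫ x in 0..L, (y x).ofLp ⬝ᵥ (ζ' x + adjointCoupling dp dm M η₀ ζ x)
        = (∫ x in 0..L, (f x).ofLp ⬝ᵥ fun i => ζ x i / speed dp dm i x)
          + (b' ⬝ᵥ ζ L - b ⬝ᵥ ζ 0)) :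
    2 * ∫ x in 0..L, ∑ i, e i x * (y x i * f x i)
      ≤ ν * (∫ x in 0..L, ∑ i, e i x * y x i ^ 2)
        - ∑ i, (e i L * speed dp dm i L * b' i ^ 2 - e i 0 * speed dp dm i 0 * b i ^ 2) := by
  have hL := h.pos.le
  have hyi := memLp_apply hy
  have hfi := memLp_apply hf
  have hec : ∀ i, Continuous (e i) := fun i => (hd.contDiff i).continuous
  -- This is y_x as dictated by f + D y_x = η₀ M y.
  set g : Fin 2 → ℝ → ℝ := fun i x =>
    (staticMatrix dp dm M η₀ x *ᵥ (y x).ofLp) i - (speed dp dm i x)⁻¹ * f x i with hg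
  have hinv : ∀ i, ContinuousOn (fun x => (speed dp dm i x)⁻¹) (Icc 0 L) := fun i =>
    (h.continuousOn_speed i).inv₀ fun x hx => h.speed_ne i hx
  have hSy : ∀ i, MemLp (fun x => (staticMatrix dp dm M η₀ x *ᵥ (y x).ofLp) i) 2
      (volume.restrict (Ioo 0 L)) := by
    intro i
    have hS : ∀ j, ContinuousOn (fun x => staticMatrix dp dm M η₀ x i j) (Icc 0 L) := fun j =>
      continuousOn_pi.1 (continuousOn_pi.1 (h.continuousOn_staticMatrix η₀) i) j
    simp only [Matrix.mulVec, dotProduct, Fin.sum_univ_two]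
    exact (memLp_continuousOn_mul (hyi 0) (hS 0)).add (memLp_continuousOn_mul (hyi 1) (hS 1))
  have hgi : ∀ i, MemLp (g i) 2 (volume.restrict (Ioo 0 L)) := fun i =>
    (hSy i).sub (memLp_continuousOn_mul (hfi i) (hinv i))
  -- Test functions with a single nonzero component turn the weak system into the weak derivative of
  -- each component, boundary values included.
  have hprim : ∀ i, (∀ᵐ x ∂volume.restrict (Ioo 0 L), y x i = b i + ∫ s in 0..x, g i s) ∧
      b' i = b i + ∫ s in 0..L, g i s := by
    intro i
    refine eq_primitive_of_weak_deriv h.pos (intervalIntegrable_of_memLp hL (hyi i))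
      (intervalIntegrable_of_memLp hL (hgi i)) fun ζ ζ' hζ hζ' => ?_
    have hζc : Continuous ζ := continuous_iff_continuousAt.2 fun x => (hζ x).continuousAt
    have key := hweak (fun x => Pi.single i (ζ x)) (fun x => Pi.single i (ζ' x))
      (fun x => by
        refine hasDerivAt_pi.2 fun j => ?_
        by_cases hij : j = i
        · subst hij
          simpa using hζ x
        · simpa [hij] using hasDerivAt_const x (0 : ℝ))
      (continuous_pi fun j => by
        by_cases hij : j = i
        · subst hij
          simpa using hζ'
        · simpa [hij] using continuous_const)
    have e1 : ∀ x ∈ Icc 0 L, (y x).ofLp ⬝ᵥ ((Pi.single i (ζ' x) : Fin 2 → ℝ)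
        + adjointCoupling dp dm M η₀ (fun x => Pi.single i (ζ x)) x)
        = y x i * ζ' x + (staticMatrix dp dm M η₀ x *ᵥ (y x).ofLp) i * ζ x := by
      intro x _
      rw [dotProduct_add, dotProduct_single, staticMatrix_mulVec, adjointCoupling]
      simp only [Matrix.mulVec, dotProduct, Fin.sum_univ_two, Matrix.transpose_apply,
        Pi.smul_apply, smul_eq_mul]
      fin_cases i <;> simp <;> ring
    have e2 : ∀ x, ((f x).ofLp ⬝ᵥ fun j => (Pi.single i (ζ x) : Fin 2 → ℝ) j / speed dp dm j x)
        = (speed dp dm i x)⁻¹ * f x i * ζ x := by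
      intro x
      simp only [dotProduct, Fin.sum_univ_two]
      fin_cases i <;> simp <;> ring
    rw [intervalIntegral.integral_congr fun x hx => e1 x (uIcc_of_le hL ▸ hx),
      intervalIntegral.integral_congr fun x _ => e2 x, dotProduct_single, dotProduct_single] at key
    have i1 : IntervalIntegrable (fun x => y x i * ζ' x
        + (staticMatrix dp dm M η₀ x *ᵥ (y x).ofLp) i * ζ x) volume 0 L :=
      ((intervalIntegrable_of_memLp hL (hyi i)).mul_continuousOn hζ'.continuousOn).add
        ((intervalIntegrable_of_memLp hL (hSy i)).mul_continuousOn hζc.continuousOn)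
    have i2 : IntervalIntegrable (fun x => (speed dp dm i x)⁻¹ * f x i * ζ x) volume 0 L :=
      (intervalIntegrable_of_memLp hL
        (memLp_continuousOn_mul (hfi i) (hinv i))).mul_continuousOn hζc.continuousOn
    rw [← sub_eq_iff_eq_add', ← intervalIntegral.integral_sub i1 i2] at key
    rw [← key]
    refine intervalIntegral.integral_congr fun x _ => ?_
    simp only [hg]
    ring
  have hwC : ∀ i, ContDiffOn ℝ 1 (fun x => e i x * speed dp dm i x) (Icc 0 L) := fun i =>
    (hd.contDiff i).contDiffOn.mul (h.contDiffOn i)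
  have hwc' : ∀ i, ContinuousOn (derivWithin (fun x => e i x * speed dp dm i x) (Icc 0 L))
      (Icc 0 L) := fun i =>
    (hwC i).continuousOn_derivWithin (uniqueDiffOn_Icc h.pos) le_rfl
  have henergy : ∀ i, ∫ x in 0..L, (2 * (e i x * speed dp dm i x) * (y x i * g i x)
      + derivWithin (fun x => e i x * speed dp dm i x) (Icc 0 L) x * y x i ^ 2)
      = e i L * speed dp dm i L * b' i ^ 2 - e i 0 * speed dp dm i 0 * b i ^ 2 := by
    intro i
    rw [(hprim i).2, ← integral_weight_mul_primitive_sq h.pos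
      (intervalIntegrable_of_memLp hL (hgi i)) (b i) (hwC i)]
    refine integral_congr_ae_Ioo hL ?_
    filter_upwards [(hprim i).1] with x hx
    rw [hx]
  have hu := uIcc_of_le hL
  have hint1 : ∀ i, IntervalIntegrable (fun x => 2 * (e i x * speed dp dm i x) * (y x i * g i x)
      + derivWithin (fun x => e i x * speed dp dm i x) (Icc 0 L) x * y x i ^ 2) volume 0 L := by
    intro i
    refine ((intervalIntegrable_mul_of_memLp hL (hyi i) (hgi i)).continuousOn_mul ?_).add ?_
    · rw [hu]
      exact continuousOn_const.mul ((hec i).continuousOn.mul (h.continuousOn_speed i))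
    · simp only [sq]
      refine (intervalIntegrable_mul_of_memLp hL (hyi i) (hyi i)).continuousOn_mul ?_
      rw [hu]
      exact hwc' i
  have hint2 : ∀ i, IntervalIntegrable (fun x => e i x * (y x i * f x i)) volume 0 L := fun i =>
    (intervalIntegrable_mul_of_memLp hL (hyi i) (hfi i)).continuousOn_mul (hec i).continuousOn
  have hint3 : ∀ i, IntervalIntegrable (fun x => e i x * y x i ^ 2) volume 0 L := fun i => by
    simp only [sq]
    exact (intervalIntegrable_mul_of_memLp hL (hyi i) (hyi i)).continuousOn_mul
      (hec i).continuousOn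
  have hsum2 : IntervalIntegrable (fun x => ∑ i, e i x * (y x i * f x i)) volume 0 L := by
    simp only [Fin.sum_univ_two]
    exact (hint2 0).add (hint2 1)
  have hsum3 : IntervalIntegrable (fun x => ∑ i, e i x * y x i ^ 2) volume 0 L := by
    simp only [Fin.sum_univ_two]
    exact (hint3 0).add (hint3 1)
  -- Inserting the equation for g turns 2 e d y g into 2η₀ e y (My) - 2 e y f; the rest is the
  -- pointwise dissipation bound.
  have hmono : ∫ x in 0..L, ((2 * (e 0 x * speed dp dm 0 x) * (y x 0 * g 0 x)
      + derivWithin (fun x => e 0 x * speed dp dm 0 x) (Icc 0 L) x * y x 0 ^ 2)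
      + (2 * (e 1 x * speed dp dm 1 x) * (y x 1 * g 1 x)
      + derivWithin (fun x => e 1 x * speed dp dm 1 x) (Icc 0 L) x * y x 1 ^ 2))
      ≤ ∫ x in 0..L, (ν * (∑ i, e i x * y x i ^ 2) - 2 * ∑ i, e i x * (y x i * f x i)) := by
    refine intervalIntegral.integral_mono_on hL ((hint1 0).add (hint1 1))
      ((hsum3.const_mul ν).sub (hsum2.const_mul 2)) fun x hx => ?_
    have hb := hd.bound x hx (y x).ofLp
    have hd0 := h.speed_ne 0 hx
    have hd1 := h.speed_ne 1 hx
    have hg' : ∀ i, e i x * speed dp dm i x * (y x i * g i x)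
        = η₀ * (e i x * (y x i * (M x *ᵥ (y x).ofLp) i)) - e i x * (y x i * f x i) := by
      intro i
      have := h.speed_ne i hx
      simp only [hg, staticMatrix_mulVec]
      field_simp
    have h0 := hg' 0
    have h1 := hg' 1
    simp only [Fin.sum_univ_two] at hb ⊢
    linarith
  rw [intervalIntegral.integral_add (hint1 0) (hint1 1), henergy, henergy,
    intervalIntegral.integral_sub (hsum3.const_mul ν) (hsum2.const_mul 2),
    intervalIntegral.integral_const_mul, intervalIntegral.integral_const_mul] at hmono
  rw [Fin.sum_univ_two (f := fun i => (e i L * speed dp dm i L * b' i ^ 2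
    - e i 0 * speed dp dm i 0 * b i ^ 2))]
  linarith

/-! ### Steklov averages in time -/

/-- The integral of (f - m)² about the mean m is nonnegative. This passes from averaged controls to
the average of their squares. -/
lemma sq_average_le {f : ℝ → ℝ} {a h : ℝ} (hh : 0 < h)
    (hf : IntervalIntegrable f volume a (a + h))
    (hf2 : IntervalIntegrable (fun x => f x ^ 2) volume a (a + h)) :
    (h⁻¹ * ∫ x in a..a + h, f x) ^ 2 ≤ h⁻¹ * ∫ x in a..a + h, f x ^ 2 := by
  set m := h⁻¹ * ∫ x in a..a + h, f x with hm
  have hI : ∫ x in a..a + h, f x = h * m := by rw [hm]; field_simp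
  have h0 : 0 ≤ ∫ x in a..a + h, (f x - m) ^ 2 :=
    intervalIntegral.integral_nonneg (by linarith) fun x _ => sq_nonneg _
  have h1 : ∫ x in a..a + h, (f x - m) ^ 2
      = (∫ x in a..a + h, f x ^ 2) - 2 * m * (∫ x in a..a + h, f x) + h * m ^ 2 := by
    rw [← intervalIntegral.integral_const_mul, ← intervalIntegral.integral_sub hf2
      (hf.const_mul _)]
    have : h * m ^ 2 = ∫ _ in a..a + h, m ^ 2 := by simp
    rw [this, ← intervalIntegral.integral_add (hf2.sub (hf.const_mul _)) (by simp)]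
    refine intervalIntegral.integral_congr fun x _ => ?_
    ring
  rw [h1, hI] at h0
  rw [le_inv_mul_iff₀ hh]
  nlinarith

section Steklov

variable {H : Type*} [NormedAddCommGroup H] [InnerProductSpace ℝ H] [CompleteSpace H]

/-- The integral of forward difference quotients of a primitive of a nonnegative function. -/
lemma integral_diff_primitive_le {k : ℝ → ℝ} (hk : Integrable k) (hk0 : ∀ t, 0 ≤ k t)
    {T T' h : ℝ} (hh : 0 < h) (hT : T' + h ≤ T) :
    ∫ t in 0..T', h⁻¹ * ∫ s in t..t + h, k s ≤ ∫ s in 0..T, k s := by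
  have hki : ∀ a b, IntervalIntegrable k volume a b := fun a b => hk.intervalIntegrable
  set Q : ℝ → ℝ := fun t => ∫ s in 0..t, k s with hQ
  have hQc : Continuous Q := intervalIntegral.continuous_primitive hki 0
  have hQi : ∀ a b, IntervalIntegrable Q volume a b := fun a b => hQc.intervalIntegrable a b
  have hQmono : Monotone Q := by
    intro a b hab
    have : Q b - Q a = ∫ s in a..b, k s :=
      intervalIntegral.integral_interval_sub_left (hki _ _) (hki _ _)
    linarith [intervalIntegral.integral_nonneg (μ := volume) hab fun x _ => hk0 x]
  have hQ0 : Q 0 = 0 := by simp [hQ]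
  have e1 : ∀ t, ∫ s in t..t + h, k s = Q (t + h) - Q t := fun t =>
    (intervalIntegral.integral_interval_sub_left (hki _ _) (hki _ _)).symm
  simp_rw [e1]
  have hQh : IntervalIntegrable (fun t => Q (t + h)) volume 0 T' :=
    (hQc.comp (continuous_add_const h)).intervalIntegrable _ _
  rw [intervalIntegral.integral_const_mul, intervalIntegral.integral_sub hQh (hQi _ _),
    intervalIntegral.integral_comp_add_right, zero_add,
    intervalIntegral.integral_interval_sub_interval_comm' (hQi _ _) (hQi _ _) (hQi _ _)]
  -- The integral of Q(t + h) - Q(t) telescopes to the integral of Q over [T', T' + h] minus that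
  -- over [0, h]. As Q increases from 0, the first is at most h Q(T) and the second is nonnegative.
  have h1 : ∫ t in T'..T' + h, Q t ≤ ∫ _ in T'..T' + h, Q T :=
    intervalIntegral.integral_mono_on (by linarith) (hQi _ _) (by simp)
      fun t ht => hQmono (ht.2.trans hT)
  have h2 : 0 ≤ ∫ t in 0..h, Q t :=
    intervalIntegral.integral_nonneg hh.le fun t ht => hQ0 ▸ hQmono ht.1
  simp only [intervalIntegral.integral_const, add_sub_cancel_left, smul_eq_mul] at h1
  rw [inv_mul_le_iff₀ hh]
  linarith

/-- An energy inequality for all Steklov averages of a continuous curve in a Hilbert space implies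
the energy inequality for the curve. -/
theorem energy_of_steklov (E : H →L[ℝ] H) (hE : ∀ x y, inner ℝ (E x) y = inner ℝ x (E y))
    {z : ℝ → H} (hz : Continuous z) {k : ℝ → ℝ} (hk : Integrable k) (hk0 : ∀ t, 0 ≤ k t)
    {T ν : ℝ} (hT : 0 < T)
    (hdiss : ∀ h > 0, ∀ t ≥ 0, t + h ≤ T →
      2 * inner ℝ (E (h⁻¹ • ∫ s in t..t + h, z s)) (h⁻¹ • (z (t + h) - z t))
        ≤ ν * inner ℝ (E (h⁻¹ • ∫ s in t..t + h, z s)) (h⁻¹ • ∫ s in t..t + h, z s)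
          + h⁻¹ * ∫ s in t..t + h, k s) :
    inner ℝ (E (z T)) (z T) - ν * (∫ t in 0..T, inner ℝ (E (z t)) (z t))
      ≤ inner ℝ (E (z 0)) (z 0) + ∫ t in 0..T, k t := by
  have hzi : ∀ a b, IntervalIntegrable z volume a b := fun a b => hz.intervalIntegrable a b
  set P : ℝ → H := fun t => ∫ s in 0..t, z s with hP
  have hPd : ∀ t, HasDerivAt P (z t) t := fun t => (hz.integral_hasStrictDerivAt 0 t).hasDerivAt
  have hPc : Continuous P := continuous_iff_continuousAt.2 fun t => (hPd t).continuousAt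
  -- The averages of a merely continuous curve are C¹ in time, with the difference quotient as
  -- derivative, so their energy can be differentiated.
  set Z : ℝ → ℝ → H := fun h t => h⁻¹ • (P (t + h) - P t) with hZ
  have hZeq : ∀ h t, h⁻¹ • ∫ s in t..t + h, z s = Z h t := by
    intro h t
    simp only [hZ, hP]
    rw [intervalIntegral.integral_interval_sub_left (hzi _ _) (hzi _ _)]
  have hZc : ∀ h, Continuous (Z h) := fun h => by
    simp only [hZ]
    fun_prop
  set V : ℝ → ℝ → ℝ := fun h t => inner ℝ (E (Z h t)) (Z h t) with hV
  have hVc : ∀ h, Continuous (V h) := fun h => by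
    have := hZc h
    simp only [hV]
    fun_prop
  have hZd : ∀ h t, HasDerivAt (Z h) (h⁻¹ • (z (t + h) - z t)) t := fun h t =>
    (((hPd (t + h)).comp_add_const t h).sub (hPd t)).const_smul h⁻¹
  have hVd : ∀ h t, HasDerivAt (V h) (2 * inner ℝ (E (Z h t)) (h⁻¹ • (z (t + h) - z t))) t := by
    intro h t
    have := (E.hasFDerivAt.comp_hasDerivAt t (hZd h t)).inner ℝ (hZd h t)
    refine this.congr_deriv ?_
    rw [hE (h⁻¹ • (z (t + h) - z t)), real_inner_comm (E (Z h t)), Function.comp_apply]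
    ring
  have hstep : ∀ T' ≥ 0, ∀ h > 0, T' + h ≤ T →
      V h T' - ν * (∫ t in 0..T', V h t) ≤ V h 0 + ∫ t in 0..T, k t := by
    intro T' hT' h hh hTh
    have hqc : Continuous fun t => h⁻¹ * ∫ s in t..t + h, k s := by
      have hki : ∀ a b, IntervalIntegrable k volume a b := fun a b => hk.intervalIntegrable
      have hQc : Continuous fun t => ∫ s in 0..t, k s :=
        intervalIntegral.continuous_primitive hki 0
      have e1 : ∀ t, ∫ s in t..t + h, k s = (∫ s in 0..t + h, k s) - ∫ s in 0..t, k s := fun t =>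
        (intervalIntegral.integral_interval_sub_left (hki _ _) (hki _ _)).symm
      simp_rw [e1]
      exact continuous_const.mul ((hQc.comp (continuous_add_const h)).sub hQc)
    have hdc : Continuous fun t => 2 * inner ℝ (E (Z h t)) (h⁻¹ • (z (t + h) - z t)) := by
      have := hZc h
      fun_prop
    have h1 := intervalIntegral.integral_eq_sub_of_hasDerivAt (fun t _ => hVd h t)
      (hdc.intervalIntegrable 0 T')
    have h2 : ∫ t in 0..T', 2 * inner ℝ (E (Z h t)) (h⁻¹ • (z (t + h) - z t))
        ≤ ∫ t in 0..T', (ν * V h t + h⁻¹ * ∫ s in t..t + h, k s) := by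
      refine intervalIntegral.integral_mono_on hT' (hdc.intervalIntegrable _ _)
        ((((hVc h).const_mul ν).add hqc).intervalIntegrable _ _) fun t ht => ?_
      have := hdiss h hh t ht.1 (by linarith [ht.2])
      rwa [hZeq] at this
    rw [intervalIntegral.integral_add (((hVc h).const_mul ν).intervalIntegrable _ _)
      (hqc.intervalIntegrable _ _), intervalIntegral.integral_const_mul ν] at h2
    have h3 := integral_diff_primitive_le hk hk0 hh hTh
    linarith
  have hlim : ∀ t, Filter.Tendsto (fun h => V h t) (nhdsWithin 0 (Ioi 0))
      (nhds (inner ℝ (E (z t)) (z t))) := by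
    intro t
    have h1 : Filter.Tendsto (fun h => Z h t) (nhdsWithin 0 (Ioi 0)) (nhds (z t)) :=
      (hPd t).tendsto_slope_zero_right
    exact ((E.continuous.tendsto _).comp h1).inner h1
  have hmain : ∀ T' ∈ Ico 0 T, inner ℝ (E (z T')) (z T')
      - ν * (∫ t in 0..T', inner ℝ (E (z t)) (z t))
      ≤ inner ℝ (E (z 0)) (z 0) + ∫ t in 0..T, k t := by
    intro T' hT'
    obtain ⟨K, hK⟩ := (isCompact_Icc (a := (0 : ℝ)) (b := T)).exists_bound_of_continuousOn
      hz.continuousOn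
    have hsmall : ∀ᶠ h in nhdsWithin (0 : ℝ) (Ioi 0), h ∈ Ioc 0 (T - T') :=
      Ioc_mem_nhdsGT (by linarith [hT'.2])
    have hZK : ∀ h ∈ Ioc 0 (T - T'), ∀ t ∈ Icc 0 T', ‖Z h t‖ ≤ K := by
      intro h hh t ht
      rw [← hZeq, norm_smul, norm_inv, Real.norm_of_nonneg hh.1.le, inv_mul_le_iff₀ hh.1]
      have := intervalIntegral.norm_integral_le_of_norm_le_const (f := z) (a := t) (b := t + h)
        (C := K) fun s hs => by
          rw [uIoc_of_le (by linarith [hh.1])] at hs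
          exact hK s ⟨ht.1.trans hs.1.le, by linarith [hs.2, ht.2, hh.2]⟩
      rwa [add_sub_cancel_left, abs_of_pos hh.1, mul_comm] at this
    have hint : Filter.Tendsto (fun h => ∫ t in 0..T', V h t) (nhdsWithin 0 (Ioi 0))
        (nhds (∫ t in 0..T', inner ℝ (E (z t)) (z t))) := by
      refine intervalIntegral.tendsto_integral_filter_of_dominated_convergence
        (fun _ => ‖E‖ * K * K) (Filter.Eventually.of_forall fun h =>
          (hVc h).aestronglyMeasurable) ?_ (by simp) (ae_of_all _ fun t _ => hlim t)
      filter_upwards [hsmall] with h hh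
      refine ae_of_all _ fun t ht => ?_
      rw [uIoc_of_le hT'.1] at ht
      have hb := hZK h hh t ⟨ht.1.le, ht.2⟩
      calc ‖V h t‖ ≤ ‖E (Z h t)‖ * ‖Z h t‖ := norm_inner_le_norm _ _
        _ ≤ ‖E‖ * K * K := by
          refine mul_le_mul ((E.le_opNorm _).trans ?_) hb (norm_nonneg _) ?_
          · exact mul_le_mul_of_nonneg_left hb (norm_nonneg _)
          · exact mul_nonneg (norm_nonneg _) ((norm_nonneg _).trans hb)
    refine le_of_tendsto_of_tendsto ((hlim T').sub (hint.const_mul ν))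
      ((hlim 0).add_const _) ?_
    filter_upwards [hsmall] with h hh
    exact hstep T' hT'.1 h hh.1 (by linarith [hh.2])
  have hqc : Continuous fun t => inner ℝ (E (z t)) (z t) := by fun_prop
  -- A forward average at T would need values beyond T. The inequality is therefore obtained for T'
  -- < T and reaches T by closedness.
  have hcl : IsClosed {T' | inner ℝ (E (z T')) (z T')
      - ν * (∫ t in 0..T', inner ℝ (E (z t)) (z t))
      ≤ inner ℝ (E (z 0)) (z 0) + ∫ t in 0..T, k t} := by
    refine isClosed_le (hqc.sub (continuous_const.mul ?_)) continuous_const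
    exact intervalIntegral.continuous_primitive (fun a b => hqc.intervalIntegrable a b) 0
  have := closure_minimal hmain hcl
  rw [closure_Ico hT.ne] at this
  exact this ⟨hT.le, le_rfl⟩

end Steklov

/-! ### Energy estimate for the distance to a static solution, uniform in T -/

lemma inner_plane (v w : Plane) : inner ℝ v w = w.ofLp ⬝ᵥ v.ofLp := by
  rw [EuclideanSpace.inner_eq_star_dotProduct]
  simp

lemma inner_state_eq_integral (hL : 0 ≤ L) (Y F : StateSpace L) :
    inner ℝ Y F = ∫ x in 0..L, (F x).ofLp ⬝ᵥ (Y x).ofLp := by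
  rw [L2.inner_def, intervalIntegral.integral_of_le hL, integral_Ioc_eq_integral_Ioo]
  simp only [inner_plane]

lemma inner_stateOf (hL : 0 ≤ L) {f : ℝ → Plane} (hf : ContinuousOn f (Icc 0 L))
    (Y : StateSpace L) :
    inner ℝ (stateOf f hf) Y = ∫ x in 0..L, (Y x).ofLp ⬝ᵥ (f x).ofLp := by
  rw [inner_state_eq_integral hL]
  refine integral_congr_ae_Ioo hL ?_
  filter_upwards [coeFn_stateOf hf] with x hx
  rw [hx]

lemma norm_state_sq (hL : 0 ≤ L) (Y : StateSpace L) :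
    ‖Y‖ ^ 2 = ∫ x in 0..L, ∑ i, Y x i ^ 2 := by
  rw [← real_inner_self_eq_norm_sq, inner_state_eq_integral hL]
  simp only [dotProduct, sq]

/-- Multiplication by a continuous diagonal weight is a bounded operator on the state space. -/
lemma exists_weight_operator {e : Fin 2 → ℝ → ℝ} (he : ∀ i, Continuous (e i)) :
    ∃ E : StateSpace L →L[ℝ] StateSpace L, ∀ Y, ∀ᵐ x ∂volume.restrict (Ioo 0 L),
      ∀ i, E Y x i = e i x * Y x i := by
  let P : Fin 2 → Plane →L[ℝ] Plane := fun i =>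
    (EuclideanSpace.proj (𝕜 := ℝ) i).smulRight (EuclideanSpace.single i (1 : ℝ))
  let A : ℝ → Plane →L[ℝ] Plane := fun x => e 0 x • P 0 + e 1 x • P 1
  have hA : Continuous A := by
    have := he 0
    have := he 1
    fun_prop
  obtain ⟨C, hC⟩ := (isCompact_Icc (a := (0 : ℝ)) (b := L)).exists_bound_of_continuousOn
    hA.continuousOn
  have hAm : MemLp A ⊤ (volume.restrict (Ioo 0 L)) := MemLp.of_bound hA.aestronglyMeasurable C
    ((ae_restrict_mem measurableSet_Ioo).mono fun x hx => hC x (Ioo_subset_Icc_self hx))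
  let B : (Plane →L[ℝ] Plane) →L[ℝ] Plane →L[ℝ] Plane :=
    ContinuousLinearMap.id ℝ (Plane →L[ℝ] Plane)
  refine ⟨B.holderL (volume.restrict (Ioo 0 L)) ⊤ 2 2 (hAm.toLp A), fun Y => ?_⟩
  have h1 : ∀ᵐ x ∂volume.restrict (Ioo 0 L),
      B.holderL (volume.restrict (Ioo 0 L)) ⊤ 2 2 (hAm.toLp A) Y x = B (hAm.toLp A x) (Y x) :=
    B.coeFn_holder (hAm.toLp A) Y
  filter_upwards [h1, hAm.coeFn_toLp] with x h1 h2 i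
  rw [h1, h2]
  fin_cases i <;> simp [B, A, P]

lemma inner_weight_operator (hL : 0 ≤ L) {e : Fin 2 → ℝ → ℝ}
    {E : StateSpace L →L[ℝ] StateSpace L}
    (hE : ∀ Y, ∀ᵐ x ∂volume.restrict (Ioo 0 L), ∀ i, E Y x i = e i x * Y x i)
    (Y F : StateSpace L) :
    inner ℝ (E Y) F = ∫ x in 0..L, ∑ i, e i x * (Y x i * F x i) := by
  rw [inner_state_eq_integral hL]
  refine integral_congr_ae_Ioo hL ?_
  filter_upwards [hE Y] with x hx
  refine Finset.sum_congr rfl fun i _ => ?_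
  rw [hx i]
  ring

/-- The continuous positive weights attain positive minima on [0, L], so the weighted energy
controls the L² norm. -/
lemma IsDissipative.exists_lower_bound (h : Regular L dp dm M) {η₀ ν : ℝ} {e : Fin 2 → ℝ → ℝ}
    (hd : IsDissipative L dp dm M η₀ e ν) {E : StateSpace L →L[ℝ] StateSpace L}
    (hE : ∀ Y, ∀ᵐ x ∂volume.restrict (Ioo 0 L), ∀ i, E Y x i = e i x * Y x i) :
    ∃ m > 0, ∀ Y, m * ‖Y‖ ^ 2 ≤ inner ℝ (E Y) Y := by
  have hL := h.pos.le
  have hec : ∀ i, Continuous (e i) := fun i => (hd.contDiff i).continuous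
  have hmin : ∀ i, ∃ m > 0, ∀ x ∈ Icc 0 L, m ≤ e i x := by
    intro i
    obtain ⟨x₀, -, hx₀⟩ := isCompact_Icc.exists_isMinOn (nonempty_Icc.2 hL)
      (hec i).continuousOn
    exact ⟨e i x₀, hd.pos i x₀, fun x hx => hx₀ hx⟩
  choose m hm0 hm using hmin
  refine ⟨min (m 0) (m 1), lt_min (hm0 0) (hm0 1), fun Y => ?_⟩
  have hY := fun i => memLp_apply (Lp.memLp Y) i
  have hint : ∀ i, IntervalIntegrable (fun x => Y x i * Y x i) volume 0 L := fun i =>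
    intervalIntegrable_mul_of_memLp hL (hY i) (hY i)
  rw [norm_state_sq hL, inner_weight_operator hL hE, ← intervalIntegral.integral_const_mul]
  simp only [Fin.sum_univ_two, sq]
  refine intervalIntegral.integral_mono_on hL (((hint 0).add (hint 1)).const_mul _)
    (((hint 0).continuousOn_mul (hec 0).continuousOn).add
      ((hint 1).continuousOn_mul (hec 1).continuousOn)) fun x hx => ?_
  have h0 := (min_le_left (m 0) (m 1)).trans (hm 0 x hx)
  have h1 := (min_le_right (m 0) (m 1)).trans (hm 1 x hx)
  have := mul_le_mul_of_nonneg_right h0 (mul_self_nonneg (Y x 0))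
  have := mul_le_mul_of_nonneg_right h1 (mul_self_nonneg (Y x 1))
  linarith

/-- The weak form, in terms of the inner product of the state space, between two times, for the
difference of a dynamic and a static solution. -/
lemma IsDynamicSolution.weak_sub_static (h : Regular L dp dm M) {η₀ T : ℝ} {u R : ℝ → Plane}
    {r : ℝ → StateSpace L} (hr : IsDynamicSolution L dp dm M η₀ T u r R) {uσ : Plane}
    {rσ : ℝ → Plane} (hσ : IsStaticSolution L dp dm M η₀ uσ rσ)
    {ζ ζ' : ℝ → Fin 2 → ℝ} (hζ : ∀ x ∈ Icc 0 L, HasDerivWithinAt ζ (ζ' x) (Icc 0 L) x)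
    (hζ' : ContinuousOn ζ' (Icc 0 L))
    (hA : ContinuousOn (fun x => (WithLp.toLp 2 (ζ' x + adjointCoupling dp dm M η₀ ζ x) : Plane))
      (Icc 0 L))
    (hG : ContinuousOn (fun x => (WithLp.toLp 2 (fun i => ζ x i / speed dp dm i x) : Plane))
      (Icc 0 L)) {t t' : ℝ} (ht : 0 ≤ t) (htt' : t ≤ t') (ht' : t' ≤ T) :
    ∫ s in t..t', inner ℝ (stateOf _ hA) (r s - stateOf rσ hσ.continuousOn)
      = inner ℝ (stateOf _ hG) (r t' - r t)
        + ((![∫ s in t..t', (R s 0 - rσ L 0), ∫ s in t..t', (u s 1 - uσ 1)] : Fin 2 → ℝ) ⬝ᵥ ζ L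
          - (![∫ s in t..t', (u s 0 - uσ 0), ∫ s in t..t', (R s 1 - rσ 0 1)] : Fin 2 → ℝ)
            ⬝ᵥ ζ 0) := by
  have hL := h.pos.le
  have hT : 0 ≤ T := by linarith
  have hw := fun τ (hτ : τ ∈ Icc 0 T) => hr.weak_static h hζ hζ' hτ
  have hstat : inner ℝ (stateOf _ hA) (stateOf rσ hσ.continuousOn)
      = (rσ L).ofLp ⬝ᵥ ζ L - (rσ 0).ofLp ⬝ᵥ ζ 0 := by
    rw [inner_stateOf hL, ← hσ.weak h hζ hζ']
    refine integral_congr_ae_Ioo hL ?_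
    filter_upwards [coeFn_stateOf hσ.continuousOn] with x hx
    rw [hx]
  have hui : ∀ i, IntervalIntegrable (fun s => u s i) volume 0 T := fun i =>
    intervalIntegrable_of_memLp hT (memLp_apply hr.control_memLp i)
  have hRi : ∀ i, IntervalIntegrable (fun s => R s i) volume 0 T := fun i =>
    intervalIntegrable_of_memLp hT (memLp_apply hr.trace_memLp i)
  set bd : ℝ → ℝ := fun s => ![R s 0, u s 1] ⬝ᵥ ζ L - ![u s 0, R s 1] ⬝ᵥ ζ 0 with hbd
  have hbdi : IntervalIntegrable bd volume 0 T := by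
    simp only [hbd, dotProduct, Fin.sum_univ_two, Matrix.cons_val_zero, Matrix.cons_val_one]
    exact (((hRi 0).mul_const _).add ((hui 1).mul_const _)).sub
      (((hui 0).mul_const _).add ((hRi 1).mul_const _))
  have hsubI : ∀ {a b : ℝ}, 0 ≤ a → a ≤ b → b ≤ T → uIcc a b ⊆ uIcc 0 T := by
    intro a b ha hab hb
    rw [uIcc_of_le hab, uIcc_of_le hT]
    exact Icc_subset_Icc ha hb
  have hrc : ContinuousOn (fun s => inner ℝ (stateOf _ hA) (r s)) (Icc 0 T) :=
    continuousOn_const.inner hr.continuousOn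
  have hri : IntervalIntegrable (fun s => inner ℝ (stateOf _ hA) (r s)) volume 0 T := by
    refine ContinuousOn.intervalIntegrable ?_
    rwa [uIcc_of_le hT]
  have hw' : ∀ τ ∈ Icc 0 T, ∫ s in 0..τ, inner ℝ (stateOf _ hA) (r s)
      = inner ℝ (stateOf _ hG) (r τ) + ∫ s in 0..τ, bd s := by
    intro τ hτ
    have := hw τ hτ
    simp only [inner_stateOf hL]
    exact this
  have hdiff : ∫ s in t..t', inner ℝ (stateOf _ hA) (r s)
      = inner ℝ (stateOf _ hG) (r t' - r t) + ∫ s in t..t', bd s := by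
    have h0t := hsubI le_rfl ht (htt'.trans ht')
    have h0t' := hsubI le_rfl (ht.trans htt') ht'
    rw [← intervalIntegral.integral_interval_sub_left (hri.mono_set h0t') (hri.mono_set h0t),
      ← intervalIntegral.integral_interval_sub_left (hbdi.mono_set h0t') (hbdi.mono_set h0t),
      hw' t ⟨ht, htt'.trans ht'⟩, hw' t' ⟨ht.trans htt', ht'⟩, inner_sub_right]
    ring
  have htt := hsubI ht htt' ht'
  have hu0 := (hui 0).mono_set htt
  have hu1 := (hui 1).mono_set htt
  have hR0 := (hRi 0).mono_set htt
  have hR1 := (hRi 1).mono_set htt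
  simp only [inner_sub_right (𝕜 := ℝ) (stateOf _ hA)]
  rw [intervalIntegral.integral_sub (hri.mono_set htt) (by simp), hdiff, hstat]
  have hl : rσ 0 0 = uσ 0 := hσ.left
  have hrr : rσ L 1 = uσ 1 := hσ.right
  simp only [hbd, dotProduct, Fin.sum_univ_two, Matrix.cons_val_zero, Matrix.cons_val_one]
  rw [intervalIntegral.integral_sub ((hR0.mul_const _).add (hu1.mul_const _))
      ((hu0.mul_const _).add (hR1.mul_const _)),
    intervalIntegral.integral_add (hR0.mul_const _) (hu1.mul_const _),
    intervalIntegral.integral_add (hu0.mul_const _) (hR1.mul_const _),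
    intervalIntegral.integral_sub hR0 (by simp), intervalIntegral.integral_sub hu1 (by simp),
    intervalIntegral.integral_sub hu0 (by simp), intervalIntegral.integral_sub hR1 (by simp)]
  simp only [intervalIntegral.integral_mul_const, intervalIntegral.integral_const, smul_eq_mul,
    hl, hrr]
  ring

lemma norm_plane_sq (v : Plane) : ‖v‖ ^ 2 = v 0 ^ 2 + v 1 ^ 2 := by
  rw [EuclideanSpace.norm_sq_eq, Fin.sum_univ_two, Real.norm_eq_abs, Real.norm_eq_abs, sq_abs,
    sq_abs]

lemma intervalIntegrable_sq_of_memLp {T : ℝ} (hT : 0 ≤ T) {f : ℝ → ℝ}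
    (hf : MemLp f 2 (volume.restrict (Ioo 0 T))) :
    IntervalIntegrable (fun s => f s ^ 2) volume 0 T := by
  simp only [sq]
  exact intervalIntegrable_mul_of_memLp hT hf hf

/-- The energy inequality for Steklov averages of the difference of a dynamic and a static
solution. -/
lemma IsDissipative.steklov_le (h : Regular L dp dm M) {η₀ ν : ℝ} {e : Fin 2 → ℝ → ℝ}
    (hd : IsDissipative L dp dm M η₀ e ν) {E : StateSpace L →L[ℝ] StateSpace L}
    (hE : ∀ Y, ∀ᵐ x ∂volume.restrict (Ioo 0 L), ∀ i, E Y x i = e i x * Y x i)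
    {uσ : Plane} {rσ : ℝ → Plane} (hσ : IsStaticSolution L dp dm M η₀ uσ rσ)
    {T : ℝ} {u R : ℝ → Plane} {r : ℝ → StateSpace L}
    (hr : IsDynamicSolution L dp dm M η₀ T u r R) {τ t : ℝ} (hτ : 0 < τ) (ht : 0 ≤ t)
    (htT : t + τ ≤ T) :
    2 * inner ℝ (E (τ⁻¹ • ∫ s in t..t + τ, (r s - stateOf rσ hσ.continuousOn)))
        (τ⁻¹ • (r (t + τ) - r t))
      ≤ ν * inner ℝ (E (τ⁻¹ • ∫ s in t..t + τ, (r s - stateOf rσ hσ.continuousOn)))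
          (τ⁻¹ • ∫ s in t..t + τ, (r s - stateOf rσ hσ.continuousOn))
        + τ⁻¹ * ∫ s in t..t + τ,
          (e 0 0 * speed dp dm 0 0 - e 1 L * speed dp dm 1 L) * ‖u s - uσ‖ ^ 2 := by
  have hL := h.pos.le
  have hT : 0 ≤ T := by linarith
  set Z : StateSpace L := τ⁻¹ • ∫ s in t..t + τ, (r s - stateOf rσ hσ.continuousOn) with hZ
  set F : StateSpace L := τ⁻¹ • (r (t + τ) - r t) with hF
  set b' : Fin 2 → ℝ := τ⁻¹ • ![∫ s in t..t + τ, (R s 0 - rσ L 0), ∫ s in t..t + τ, (u s 1 - uσ 1)]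
    with hb'
  set b : Fin 2 → ℝ := τ⁻¹ • ![∫ s in t..t + τ, (u s 0 - uσ 0), ∫ s in t..t + τ, (R s 1 - rσ 0 1)]
    with hb
  have hsub : uIcc t (t + τ) ⊆ uIcc 0 T := by
    rw [uIcc_of_le (by linarith), uIcc_of_le hT]
    exact Icc_subset_Icc ht htT
  have hzi : IntervalIntegrable (fun s => r s - stateOf rσ hσ.continuousOn) volume t (t + τ) := by
    refine (ContinuousOn.intervalIntegrable ?_).mono_set hsub
    rw [uIcc_of_le hT]
    exact hr.continuousOn.sub continuousOn_const
  -- Averaged over [t, t + τ], the weak form makes Z a weak solution in x with time derivative F in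
  -- L², and with averaged boundary values.
  have hen := hd.energy_le h (Lp.memLp Z) (Lp.memLp F) (b := b) (b' := b') fun ζ ζ' hζ hζ' => by
    have hζc : Continuous ζ := continuous_iff_continuousAt.2 fun x => (hζ x).continuousAt
    have hA : ContinuousOn (fun x =>
        (WithLp.toLp 2 (ζ' x + adjointCoupling dp dm M η₀ ζ x) : Plane)) (Icc 0 L) := by
      have := h.continuousOn_adjointCoupling η₀ hζc.continuousOn
      fun_prop
    have hG : ContinuousOn (fun x =>
        (WithLp.toLp 2 (fun i => ζ x i / speed dp dm i x) : Plane)) (Icc 0 L) := by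
      exact (PiLp.continuous_toLp 2 _).comp_continuousOn (h.continuousOn_div hζc.continuousOn)
    have key := hr.weak_sub_static h hσ (fun x _ => (hζ x).hasDerivWithinAt) hζ'.continuousOn
      hA hG ht (by linarith : t ≤ t + τ) htT
    have e1 : ∫ s in t..t + τ, inner ℝ (stateOf _ hA) (r s - stateOf rσ hσ.continuousOn)
        = inner ℝ (stateOf _ hA) (∫ s in t..t + τ, (r s - stateOf rσ hσ.continuousOn)) :=
      (innerSL ℝ (stateOf _ hA)).intervalIntegral_comp_comm hzi
    rw [e1] at key
    have e2 : inner ℝ (stateOf _ hA) Z = inner ℝ (stateOf _ hG) F + (b' ⬝ᵥ ζ L - b ⬝ᵥ ζ 0) := by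
      rw [hZ, inner_smul_right, key, hF, inner_smul_right, hb', hb, smul_dotProduct,
        smul_dotProduct, smul_eq_mul, smul_eq_mul]
      ring
    rwa [inner_stateOf hL, inner_stateOf hL] at e2
  rw [inner_weight_operator hL hE, inner_weight_operator hL hE]
  simp only [sq] at hen
  refine hen.trans ?_
  rw [sub_eq_add_neg]
  refine add_le_add le_rfl ?_
  have hui : ∀ i, MemLp (fun s => u s i - uσ i) 2 (volume.restrict (Ioo 0 T)) := fun i =>
    (memLp_apply hr.control_memLp i).sub (memLp_const _)
  have hi1 := fun i => (intervalIntegrable_of_memLp hT (hui i)).mono_set hsub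
  have hi2 := fun i => (intervalIntegrable_sq_of_memLp hT (hui i)).mono_set hsub
  have hav := fun i => sq_average_le hτ (hi1 i) (hi2 i)
  have hnorm : ∫ s in t..t + τ, ‖u s - uσ‖ ^ 2 = (∫ s in t..t + τ, (u s 0 - uσ 0) ^ 2)
      + ∫ s in t..t + τ, (u s 1 - uσ 1) ^ 2 := by
    rw [← intervalIntegral.integral_add (hi2 0) (hi2 1)]
    simp only [norm_plane_sq, PiLp.sub_apply]
  rw [intervalIntegral.integral_const_mul, hnorm]
  have b0 : b 0 = τ⁻¹ * ∫ s in t..t + τ, (u s 0 - uσ 0) := rfl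
  have b1 : b' 1 = τ⁻¹ * ∫ s in t..t + τ, (u s 1 - uσ 1) := rfl
  have ha0 := hav 0
  have ha1 := hav 1
  rw [← b0] at ha0
  rw [← b1] at ha1
  rw [Fin.sum_univ_two]
  -- The signs of the speeds make both outflow terms favourable, so they are dropped. The inflow
  -- terms are bounded by averages of squares; adding both weights into one constant only enlarges
  -- the bound.
  have p1 : 0 < e 0 0 * speed dp dm 0 0 := mul_pos (hd.pos 0 0) (h.speed_zero 0 ⟨le_rfl, hL⟩)
  have p2 : 0 < e 0 L * speed dp dm 0 L := mul_pos (hd.pos 0 L) (h.speed_zero L ⟨hL, le_rfl⟩)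
  have p3 : e 1 0 * speed dp dm 1 0 < 0 :=
    mul_neg_of_pos_of_neg (hd.pos 1 0) (h.speed_one 0 ⟨le_rfl, hL⟩)
  have p4 : e 1 L * speed dp dm 1 L < 0 :=
    mul_neg_of_pos_of_neg (hd.pos 1 L) (h.speed_one L ⟨hL, le_rfl⟩)
  set S0 := τ⁻¹ * ∫ s in t..t + τ, (u s 0 - uσ 0) ^ 2
  set S1 := τ⁻¹ * ∫ s in t..t + τ, (u s 1 - uσ 1) ^ 2
  have q1 : e 0 0 * speed dp dm 0 0 * b 0 ^ 2 ≤ e 0 0 * speed dp dm 0 0 * S0 :=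
    mul_le_mul_of_nonneg_left ha0 p1.le
  have q2 : e 1 L * speed dp dm 1 L * S1 ≤ e 1 L * speed dp dm 1 L * b' 1 ^ 2 :=
    mul_le_mul_of_nonpos_left ha1 p4.le
  have q3 : 0 ≤ e 0 L * speed dp dm 0 L * b' 0 ^ 2 := mul_nonneg p2.le (sq_nonneg _)
  have q4 : e 1 0 * speed dp dm 1 0 * b 1 ^ 2 ≤ 0 :=
    mul_nonpos_of_nonpos_of_nonneg p3.le (sq_nonneg _)
  have q5 : 0 ≤ e 0 0 * speed dp dm 0 0 * S1 := mul_nonneg p1.le ((sq_nonneg _).trans ha1)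
  have q6 : e 1 L * speed dp dm 1 L * S0 ≤ 0 :=
    mul_nonpos_of_nonpos_of_nonneg p4.le ((sq_nonneg _).trans ha0)
  have e3 : τ⁻¹ * ((e 0 0 * speed dp dm 0 0 - e 1 L * speed dp dm 1 L)
      * ((∫ s in t..t + τ, (u s 0 - uσ 0) ^ 2) + ∫ s in t..t + τ, (u s 1 - uσ 1) ^ 2))
      = (e 0 0 * speed dp dm 0 0 - e 1 L * speed dp dm 1 L) * (S0 + S1) := by
    simp only [S0, S1]
    ring
  rw [e3]
  linarith

/-- The distance of a dynamic solution to a static solution is controlled by the distance of the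
controls, uniformly in the time horizon. -/
theorem exists_energy_bound (h : Regular L dp dm M) {η₀ ν : ℝ} {e : Fin 2 → ℝ → ℝ}
    (hd : IsDissipative L dp dm M η₀ e ν) {uσ : Plane} {rσ : ℝ → Plane}
    (hσ : IsStaticSolution L dp dm M η₀ uσ rσ) :
    ∃ C > 0, ∀ T > 0, ∀ (u R : ℝ → Plane) (r : ℝ → StateSpace L),
      IsDynamicSolution L dp dm M η₀ T u r R →
        ‖r T - stateOf rσ hσ.continuousOn‖ ^ 2 ≤ C * (1 + ∫ t in 0..T, ‖u t - uσ‖ ^ 2) ∧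
        ∫ t in 0..T, ‖r t - stateOf rσ hσ.continuousOn‖ ^ 2
          ≤ C * (1 + ∫ t in 0..T, ‖u t - uσ‖ ^ 2) := by
  have hL := h.pos.le
  obtain ⟨E, hE⟩ := exists_weight_operator (L := L) fun i => (hd.contDiff i).continuous
  obtain ⟨m, hm0, hm⟩ := hd.exists_lower_bound h hE
  set s := stateOf rσ hσ.continuousOn with hs
  set c := e 0 0 * speed dp dm 0 0 - e 1 L * speed dp dm 1 L with hc
  have hc0 : 0 < c := by
    have p1 : 0 < e 0 0 * speed dp dm 0 0 := mul_pos (hd.pos 0 0) (h.speed_zero 0 ⟨le_rfl, hL⟩)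
    have p4 : e 1 L * speed dp dm 1 L < 0 :=
      mul_neg_of_pos_of_neg (hd.pos 1 L) (h.speed_one L ⟨hL, le_rfl⟩)
    linarith
  -- The initial energy: the dynamic state starts at 0, so the difference starts at -s.
  set K := inner ℝ (E s) s with hK
  have hK0 : 0 ≤ K := le_trans (by positivity) (hm s)
  have hν := hd.rate_neg
  have hn : 0 < -ν := by linarith
  -- The first summand serves the terminal estimate, the second the time integral, which enters the
  -- energy inequality with the factor -ν > 0.
  refine ⟨(K + c) / m + (K + c) / (m * -ν), by positivity, fun T hT u R r hr => ?_⟩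
  -- The curve is frozen outside [0, T] and the control term below is cut off there, to have a
  -- continuous z and an integrable k on all of ℝ.
  set z : ℝ → StateSpace L := IccExtend hT.le (domRestrict (Icc 0 T) fun t => r t - s) with hz
  have hzc : Continuous z := (continuousOn_iff_continuous_domRestrict.1
    (hr.continuousOn.sub continuousOn_const)).Icc_extend'
  have hze : ∀ t ∈ Icc 0 T, z t = r t - s := fun t ht => IccExtend_of_mem hT.le _ ht
  set k : ℝ → ℝ := (Ioc 0 T).indicator fun t => c * ‖u t - uσ‖ ^ 2 with hk
  have hui : ∀ i, MemLp (fun s => u s i - uσ i) 2 (volume.restrict (Ioo 0 T)) := fun i =>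
    (memLp_apply hr.control_memLp i).sub (memLp_const _)
  have huI : IntervalIntegrable (fun t => ‖u t - uσ‖ ^ 2) volume 0 T := by
    simp only [norm_plane_sq, PiLp.sub_apply]
    exact (intervalIntegrable_sq_of_memLp hT.le (hui 0)).add
      (intervalIntegrable_sq_of_memLp hT.le (hui 1))
  have hki : Integrable k := by
    rw [hk, integrable_indicator_iff measurableSet_Ioc,
      ← intervalIntegrable_iff_integrableOn_Ioc_of_le hT.le]
    exact huI.const_mul c
  have hk0 : ∀ t, 0 ≤ k t := fun t => indicator_nonneg (fun t _ => by positivity) t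
  have hkeq : ∀ a b, 0 ≤ a → a ≤ b → b ≤ T →
      ∫ t in a..b, k t = ∫ t in a..b, c * ‖u t - uσ‖ ^ 2 := by
    intro a b ha hab hb
    refine intervalIntegral.integral_congr_ae (ae_of_all _ fun t ht => ?_)
    rw [uIoc_of_le hab] at ht
    exact indicator_of_mem (Ioc_subset_Ioc ha hb ht) _
  have hsym : ∀ x y, inner ℝ (E x) y = inner ℝ x (E y) := by
    intro x y
    rw [real_inner_comm (E y) x, inner_weight_operator hL hE, inner_weight_operator hL hE]
    simp only [mul_comm]
  have key := energy_of_steklov E hsym hzc hki hk0 (ν := ν) hT fun τ hτ t ht htT => by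
    have hzint : ∫ s in t..t + τ, z s = ∫ s' in t..t + τ, (r s' - s) := by
      refine intervalIntegral.integral_congr fun t' ht' => ?_
      rw [uIcc_of_le (by linarith)] at ht'
      exact hze t' ⟨ht.le.trans ht'.1, ht'.2.trans htT⟩
    rw [hzint, hze t ⟨ht, by linarith⟩, hze (t + τ) ⟨by linarith, htT⟩, sub_sub_sub_cancel_right,
      hkeq t (t + τ) ht (by linarith) htT]
    exact hd.steklov_le h hE hσ hr hτ ht htT
  have hz0 : inner ℝ (E (z 0)) (z 0) = K := by
    rw [hze 0 ⟨le_rfl, hT.le⟩, hr.initial, zero_sub, map_neg, inner_neg_neg]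
  rw [hz0, hkeq 0 T le_rfl hT.le le_rfl, intervalIntegral.integral_const_mul] at key
  have hzz : Continuous fun t => inner ℝ (E (z t)) (z t) := by fun_prop
  have hmint : m * (∫ t in 0..T, ‖r t - s‖ ^ 2) ≤ ∫ t in 0..T, inner ℝ (E (z t)) (z t) := by
    rw [← intervalIntegral.integral_const_mul]
    have : ∫ t in 0..T, m * ‖r t - s‖ ^ 2 = ∫ t in 0..T, m * ‖z t‖ ^ 2 := by
      refine intervalIntegral.integral_congr fun t ht => ?_
      rw [uIcc_of_le hT.le] at ht
      simp only [hze t ht]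
    rw [this]
    exact intervalIntegral.integral_mono_on hT.le
      ((continuous_const.mul (hzc.norm.pow 2)).intervalIntegrable _ _)
      (hzz.intervalIntegrable _ _) fun t _ => hm (z t)
  have hmT := hm (z T)
  rw [hze T ⟨hT.le, le_rfl⟩] at hmT key
  set X := ∫ t in 0..T, ‖u t - uσ‖ ^ 2 with hX
  have hX0 : 0 ≤ X := intervalIntegral.integral_nonneg hT.le fun t _ => by positivity
  set I := ∫ t in 0..T, ‖r t - s‖ ^ 2 with hI
  have hI0 : 0 ≤ I := intervalIntegral.integral_nonneg hT.le fun t _ => by positivity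
  set J := ∫ t in 0..T, inner ℝ (E (z t)) (z t) with hJ
  have hJ0 : 0 ≤ J := le_trans (by positivity) hmint
  have hKX : K + c * X ≤ (K + c) * (1 + X) := by nlinarith
  have n1 : 0 ≤ (K + c) / m * (1 + X) := by positivity
  have n2 : 0 ≤ (K + c) / (m * -ν) * (1 + X) := by positivity
  rw [add_mul]
  constructor
  · have : ‖r T - s‖ ^ 2 ≤ (K + c) / m * (1 + X) := by
      rw [div_mul_eq_mul_div, le_div_iff₀ hm0]
      nlinarith
    linarith
  · have : I ≤ (K + c) / (m * -ν) * (1 + X) := by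
      rw [div_mul_eq_mul_div, le_div_iff₀ (by positivity)]
      have : 0 ≤ inner ℝ (E (r T - s)) (r T - s) := le_trans (by positivity) hmT
      nlinarith
    linarith

/-! ### Expansion of the cost, static optimality and the adjoint state -/

variable {A₀ AL : Matrix (Fin 2) (Fin 2) ℝ} {c₀ cL : Fin 2 → ℝ}

/-- The linear functional `g₀ᵀ (u₊, R₋) + g_Lᵀ (u₋, R₊)`. -/
def linearCost (g₀ gL : Fin 2 → ℝ) (u R : Plane) : ℝ :=
  g₀ ⬝ᵥ ![u 0, R 1] + gL ⬝ᵥ ![u 1, R 0]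

/-- The gradient of `½ zᵀ A z + cᵀ z` at `z`. -/
def quadraticGradient (A : Matrix (Fin 2) (Fin 2) ℝ) (c z : Fin 2 → ℝ) : Fin 2 → ℝ :=
  A *ᵥ z + c

/-- The Taylor expansion of a quadratic polynomial is exact; symmetry of the matrices merges the
mixed terms into the gradient. -/
lemma runningCost_add (hA₀ : A₀.PosDef) (hAL : AL.PosDef) (u R w ρ : Plane) :
    runningCost A₀ AL c₀ cL (u + w) (R + ρ) = runningCost A₀ AL c₀ cL u R
      + linearCost (quadraticGradient A₀ c₀ ![u 0, R 1]) (quadraticGradient AL cL ![u 1, R 0]) w ρ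
      + runningCost A₀ AL 0 0 w ρ := by
  have h0 : A₀ 1 0 = A₀ 0 1 := by simpa using hA₀.isHermitian.apply 0 1
  have hL : AL 1 0 = AL 0 1 := by simpa using hAL.isHermitian.apply 0 1
  simp [runningCost, quadratic, linearCost, quadraticGradient, dotProduct, Matrix.mulVec,
    Fin.sum_univ_two, h0, hL]
  ring

lemma runningCost_smul (ε : ℝ) (w ρ : Plane) :
    runningCost A₀ AL 0 0 (ε • w) (ε • ρ) = ε ^ 2 * runningCost A₀ AL 0 0 w ρ := by
  simp [runningCost, quadratic, dotProduct, Matrix.mulVec, Fin.sum_univ_two]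
  ring

/-- The smallest eigenvalue of A is at least det A / tr A, and the factor 1/2 comes from
`quadratic`. By Cayley–Hamilton, |Az|² = tr A · zᵀAz - det A · |z|², and the two squares used are
the components of Az. -/
lemma exists_quadratic_lower_bound {A : Matrix (Fin 2) (Fin 2) ℝ} (hA : A.PosDef) :
    ∃ α > 0, ∀ z : Fin 2 → ℝ, α * (z 0 ^ 2 + z 1 ^ 2) ≤ quadratic A 0 z := by
  have hsym : A 1 0 = A 0 1 := by simpa using hA.isHermitian.apply 0 1
  have h0 : 0 < A 0 0 := hA.diag_pos
  have h1 : 0 < A 1 1 := hA.diag_pos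
  have hdet : 0 < A 0 0 * A 1 1 - A 0 1 * A 0 1 := by
    have := hA.det_pos
    rwa [Matrix.det_fin_two, hsym] at this
  refine ⟨(A 0 0 * A 1 1 - A 0 1 * A 0 1) / (2 * (A 0 0 + A 1 1)), by positivity, fun z => ?_⟩
  rw [div_mul_eq_mul_div, div_le_iff₀ (by positivity)]
  simp only [quadratic, dotProduct, Matrix.mulVec, Fin.sum_univ_two, hsym, Pi.zero_apply, zero_mul,
    add_zero]
  nlinarith [sq_nonneg (A 0 0 * z 0 + A 0 1 * z 1), sq_nonneg (A 0 1 * z 0 + A 1 1 * z 1)]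

lemma exists_runningCost_lower_bound (hA₀ : A₀.PosDef) (hAL : AL.PosDef) :
    ∃ α > 0, ∀ w ρ : Plane, α * ‖w‖ ^ 2 ≤ runningCost A₀ AL 0 0 w ρ := by
  obtain ⟨α, hα, h0⟩ := exists_quadratic_lower_bound hA₀
  obtain ⟨β, hβ, h1⟩ := exists_quadratic_lower_bound hAL
  refine ⟨min α β, lt_min hα hβ, fun w ρ => ?_⟩
  have a0 := h0 ![w 0, ρ 1]
  have a1 := h1 ![w 1, ρ 0]
  simp only [Matrix.cons_val_zero, Matrix.cons_val_one] at a0 a1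
  have b0 := mul_le_mul_of_nonneg_right (min_le_left α β) (sq_nonneg (w 0))
  have b1 := mul_le_mul_of_nonneg_right (min_le_right α β) (sq_nonneg (w 1))
  have c0 : 0 ≤ α * ρ 1 ^ 2 := by positivity
  have c1 : 0 ≤ β * ρ 0 ^ 2 := by positivity
  rw [norm_plane_sq, runningCost]
  linarith

lemma isStaticSolution_of_hasDerivWithinAt (h : Regular L dp dm M) {η₀ : ℝ} {f : ℝ → Fin 2 → ℝ}
    (hf : ∀ x ∈ Icc 0 L, HasDerivWithinAt f (staticMatrix dp dm M η₀ x *ᵥ f x) (Icc 0 L) x) :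
    IsStaticSolution L dp dm M η₀ !₂[f 0 0, f L 1] fun x => WithLp.toLp 2 (f x) := by
  have hd : ∀ x ∈ Icc 0 L, HasDerivWithinAt (fun x => (WithLp.toLp 2 (f x) : Plane))
      (WithLp.toLp 2 (staticMatrix dp dm M η₀ x *ᵥ f x)) (Icc 0 L) x := fun x hx =>
    (PiLp.continuousLinearEquiv 2 ℝ fun _ : Fin 2 => ℝ).symm.hasFDerivAt.comp_hasDerivWithinAt x
      (hf x hx)
  refine ⟨fun x hx => (hd x hx).differentiableWithinAt, fun x hx => ?_, rfl, rfl⟩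
  rw [(hd x hx).derivWithin (uniqueDiffOn_Icc h.pos x hx), speedMatrix_mulVec]
  ext i
  simp only [staticMatrix_mulVec, Pi.smul_apply, smul_eq_mul]
  exact mul_div_cancel₀ _ (h.speed_ne i hx)

/-- There is a static solution with prescribed values at `x = L`. -/
lemma exists_static_of_right (h : Regular L dp dm M) (η₀ : ℝ) (v : Fin 2 → ℝ) :
    ∃ f : ℝ → Fin 2 → ℝ, f L = v ∧
      ∀ x ∈ Icc 0 L, HasDerivWithinAt f (staticMatrix dp dm M η₀ x *ᵥ f x) (Icc 0 L) x := by
  have hmap : MapsTo (fun x => L - x) (Icc 0 L) (Icc 0 L) := fun x hx =>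
    ⟨by linarith [hx.2], by linarith [hx.1]⟩
  obtain ⟨f, hf0, hf⟩ := exists_linear_ode_solution h.pos.le
    (B := fun x => -staticMatrix dp dm M η₀ (L - x))
    (((h.continuousOn_staticMatrix η₀).comp (by fun_prop) hmap).neg) v
  refine ⟨fun x => f (L - x), by simp [hf0], fun x hx => ?_⟩
  have h1 : HasDerivWithinAt (fun x => L - x) (-1) (Icc 0 L) x :=
    ((hasDerivAt_id x).const_sub L).hasDerivWithinAt
  refine ((hf (L - x) (hmap hx)).scomp x h1 hmap).congr_deriv ?_
  simp [Matrix.neg_mulVec]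

lemma IsStaticSolution.add_smul (h : Regular L dp dm M) {η₀ : ℝ} {u w : Plane} {r ρ : ℝ → Plane}
    (hr : IsStaticSolution L dp dm M η₀ u r) (hρ : IsStaticSolution L dp dm M η₀ w ρ) (ε : ℝ) :
    IsStaticSolution L dp dm M η₀ (u + ε • w) (fun x => r x + ε • ρ x) := by
  have hd : ∀ x ∈ Icc 0 L, HasDerivWithinAt (fun x => r x + ε • ρ x)
      (derivWithin r (Icc 0 L) x + ε • derivWithin ρ (Icc 0 L) x) (Icc 0 L) x := fun x hx =>
    (hr.differentiableOn x hx).hasDerivWithinAt.add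
      ((hρ.differentiableOn x hx).hasDerivWithinAt.const_smul ε)
  refine ⟨fun x hx => (hd x hx).differentiableWithinAt, fun x hx => ?_, ?_, ?_⟩
  · rw [(hd x hx).derivWithin (uniqueDiffOn_Icc h.pos x hx), WithLp.ofLp_add, WithLp.ofLp_smul,
      WithLp.ofLp_add, WithLp.ofLp_smul, Matrix.mulVec_add, Matrix.mulVec_add, Matrix.mulVec_smul,
      Matrix.mulVec_smul, hr.ode x hx, hρ.ode x hx, smul_add, smul_comm]
  · simp [hr.left, hρ.left]
  · simp [hr.right, hρ.right]

/-- For small ε of sign opposite to a, the linear term wins; dividing by |b| + 1 > b makes ε small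
enough. -/
lemma eq_zero_of_forall_mul_add_nonneg {a b : ℝ} (h : ∀ ε : ℝ, 0 ≤ ε * a + ε ^ 2 * b) : a = 0 := by
  by_contra ha
  have h1 := h (-a / (|b| + 1))
  have hb : 0 < |b| + 1 := by positivity
  have h2 : -a / (|b| + 1) * a + (-a / (|b| + 1)) ^ 2 * b
      = a ^ 2 * (b - (|b| + 1)) / (|b| + 1) ^ 2 := by
    field_simp
    ring
  rw [h2] at h1
  have h3 : a ^ 2 * (b - (|b| + 1)) / (|b| + 1) ^ 2 < 0 := by
    refine div_neg_of_neg_of_pos (mul_neg_of_pos_of_neg (by positivity) ?_) (by positivity)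
    linarith [le_abs_self b]
  linarith

/-- The first order optimality condition of the static problem. -/
lemma IsStaticOptimal.linearCost_eq_zero (h : Regular L dp dm M) {η₀ : ℝ} (hA₀ : A₀.PosDef)
    (hAL : AL.PosDef) {u w : Plane} {r ρ : ℝ → Plane}
    (hr : IsStaticOptimal L dp dm M η₀ A₀ AL c₀ cL u r)
    (hρ : IsStaticSolution L dp dm M η₀ w ρ) :
    linearCost (quadraticGradient A₀ c₀ ![u 0, r 0 1]) (quadraticGradient AL cL ![u 1, r L 0])
      w !₂[ρ L 0, ρ 0 1] = 0 := by
  refine eq_zero_of_forall_mul_add_nonneg (b := runningCost A₀ AL 0 0 w !₂[ρ L 0, ρ 0 1])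
    fun ε => ?_
  have h1 := hr.2 _ _ (hr.1.add_smul h hρ ε)
  have e1 : (!₂[(r L + ε • ρ L) 0, (r 0 + ε • ρ 0) 1] : Plane)
      = !₂[r L 0, r 0 1] + ε • !₂[ρ L 0, ρ 0 1] := by
    ext i
    fin_cases i <;> simp
  simp only [staticCost] at h1
  rw [e1, runningCost_add hA₀ hAL, runningCost_smul] at h1
  have e2 : linearCost (quadraticGradient A₀ c₀ ![u 0, (!₂[r L 0, r 0 1] : Plane) 1])
      (quadraticGradient AL cL ![u 1, (!₂[r L 0, r 0 1] : Plane) 0]) (ε • w)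
      (ε • !₂[ρ L 0, ρ 0 1])
      = ε * linearCost (quadraticGradient A₀ c₀ ![u 0, r 0 1])
        (quadraticGradient AL cL ![u 1, r L 0]) w !₂[ρ L 0, ρ 0 1] := by
    simp [linearCost, dotProduct, Fin.sum_univ_two]
    ring
  rw [e2] at h1
  linarith

/-- The adjoint state of the static problem represents the derivative of the dynamic cost at the
static optimum, up to a term at the final time. -/
theorem IsStaticOptimal.exists_adjoint (h : Regular L dp dm M) {η₀ : ℝ} (hA₀ : A₀.PosDef)
    (hAL : AL.PosDef) {uσ : Plane} {rσ : ℝ → Plane}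
    (hσ : IsStaticOptimal L dp dm M η₀ A₀ AL c₀ cL uσ rσ) :
    ∃ p : StateSpace L, ∀ T > 0, ∀ (u R : ℝ → Plane) (r : ℝ → StateSpace L),
      IsDynamicSolution L dp dm M η₀ T u r R →
      ∫ t in 0..T, linearCost (quadraticGradient A₀ c₀ ![uσ 0, rσ 0 1])
        (quadraticGradient AL cL ![uσ 1, rσ L 0]) (u t) (R t) = inner ℝ p (r T) := by
  have hL := h.pos.le
  set g₀ := quadraticGradient A₀ c₀ ![uσ 0, rσ 0 1] with hg₀
  set gL := quadraticGradient AL cL ![uσ 1, rσ L 0] with hgL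
  -- A solution of μ' = Nμ satisfies μ' + η₀ Mᵀ D⁻¹ μ = 0, so the volume terms of the weak forms
  -- vanish.
  let N : ℝ → Matrix (Fin 2) (Fin 2) ℝ := fun x =>
    Matrix.of fun i j => -(η₀ * M x j i / speed dp dm j x)
  have hN : ContinuousOn N (Icc 0 L) := by
    refine continuousOn_pi.2 fun i => continuousOn_pi.2 fun j => ?_
    exact ((continuousOn_const.mul (h.continuousOn_coupling j i)).div (h.continuousOn_speed j)
      fun x hx => h.speed_ne j hx).neg
  obtain ⟨μ, hμ0, hμ⟩ := exists_linear_ode_solution hL hN g₀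
  have hμc : ContinuousOn μ (Icc 0 L) := fun x hx => (hμ x hx).continuousWithinAt
  have hNμ : ∀ x, N x *ᵥ μ x + adjointCoupling dp dm M η₀ μ x = 0 := by
    intro x
    ext i
    simp only [N, adjointCoupling, Matrix.mulVec, dotProduct, Fin.sum_univ_two, Matrix.of_apply,
      Pi.add_apply, Pi.smul_apply, Matrix.transpose_apply, smul_eq_mul, Pi.zero_apply]
    ring
  have hNc : ContinuousOn (fun x => N x *ᵥ μ x) (Icc 0 L) := by
    refine continuousOn_pi.2 fun i => continuousOn_dotProduct (continuousOn_pi.1 hN i) hμc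
  -- Only μ(0) was prescribed. Static optimality forces μ(L): every vector is the value at L of some
  -- static solution, and on each the linear cost vanishes.
  have hμL : μ L = -![gL 1, gL 0] := by
    have hv : ∀ v : Fin 2 → ℝ, v ⬝ᵥ (μ L + ![gL 1, gL 0]) = 0 := by
      intro v
      obtain ⟨f, hfL, hf⟩ := exists_static_of_right h η₀ v
      have hs := isStaticSolution_of_hasDerivWithinAt h hf
      have h1 := hs.weak h hμ hNc
      simp only [hNμ, dotProduct_zero, intervalIntegral.integral_zero, hμ0] at h1
      have h2 := hσ.linearCost_eq_zero h hA₀ hAL hs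
      rw [← hg₀, ← hgL] at h2
      simp only [linearCost, dotProduct, Fin.sum_univ_two, hfL, Pi.add_apply] at h1 h2 ⊢
      simp at h1 h2 ⊢
      linarith
    have := dotProduct_eq_zero _ fun w => (dotProduct_comm _ w).trans (hv w)
    exact eq_neg_of_add_eq_zero_left this
  have hG : ContinuousOn (fun x => (WithLp.toLp 2 (fun i => μ x i / speed dp dm i x) : Plane))
      (Icc 0 L) := (PiLp.continuous_toLp 2 _).comp_continuousOn (h.continuousOn_div hμc)
  refine ⟨stateOf _ hG, fun T hT u R r hr => ?_⟩
  have key := hr.weak_static h hμ hNc ⟨hT.le, le_rfl⟩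
  simp only [hNμ, dotProduct_zero, intervalIntegral.integral_zero, hμ0, hμL] at key
  rw [inner_stateOf hL]
  have e : ∀ t, linearCost g₀ gL (u t) (R t)
      = -(![R t 0, u t 1] ⬝ᵥ (-![gL 1, gL 0]) - ![u t 0, R t 1] ⬝ᵥ g₀) := by
    intro t
    simp [linearCost, dotProduct, Fin.sum_univ_two]
    ring
  simp only [e, intervalIntegral.integral_neg]
  linarith

lemma intervalIntegrable_runningCost {T : ℝ} (hT : 0 ≤ T) {u R : ℝ → Plane}
    (hu : MemLp u 2 (volume.restrict (Ioo 0 T))) (hR : MemLp R 2 (volume.restrict (Ioo 0 T))) :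
    IntervalIntegrable (fun t => runningCost A₀ AL c₀ cL (u t) (R t)) volume 0 T := by
  have hquad : ∀ (A : Matrix (Fin 2) (Fin 2) ℝ) (c : Fin 2 → ℝ) {f g : ℝ → ℝ},
      MemLp f 2 (volume.restrict (Ioo 0 T)) → MemLp g 2 (volume.restrict (Ioo 0 T)) →
      IntervalIntegrable (fun t => quadratic A c ![f t, g t]) volume 0 T := by
    intro A c f g hf hg
    have h1 := intervalIntegrable_mul_of_memLp hT hf hf
    have h2 := intervalIntegrable_mul_of_memLp hT hf hg
    have h3 := intervalIntegrable_mul_of_memLp hT hg hg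
    have h4 := intervalIntegrable_of_memLp hT hf
    have h5 := intervalIntegrable_of_memLp hT hg
    have e : (fun t => quadratic A c ![f t, g t]) = fun t =>
        1 / 2 * A 0 0 * (f t * f t) + 1 / 2 * (A 0 1 + A 1 0) * (f t * g t)
          + 1 / 2 * A 1 1 * (g t * g t) + c 0 * f t + c 1 * g t := by
      ext t
      simp [quadratic, dotProduct, Matrix.mulVec, Fin.sum_univ_two]
      ring
    rw [e]
    exact ((((h1.const_mul _).add (h2.const_mul _)).add (h3.const_mul _)).add
      (h4.const_mul _)).add (h5.const_mul _)
  exact (hquad A₀ c₀ (memLp_apply hu 0) (memLp_apply hR 1)).add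
    (hquad AL cL (memLp_apply hu 1) (memLp_apply hR 0))

/-! ### The turnpike estimate -/

/-- The optimal dynamic cost exceeds `T` times the optimal static cost by a bounded amount. -/
theorem exists_dynamicCost_upper_bound (h : Regular L dp dm M) {η₀ : ℝ}
    {uσ : Plane} {rσ : ℝ → Plane} (hσ : IsStaticSolution L dp dm M η₀ uσ rσ) :
    ∃ K, ∀ T > 0, ∀ (u R : ℝ → Plane) (r : ℝ → StateSpace L),
      IsDynamicOptimal L dp dm M η₀ A₀ AL c₀ cL T u r R →
        dynamicCost A₀ AL c₀ cL T u R
          ≤ T * runningCost A₀ AL c₀ cL uσ !₂[rσ L 0, rσ 0 1] + K := by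
  obtain ⟨T₀, u', R', r', hu', hR', hsol, hend⟩ := exists_steering h hσ
  set j := runningCost A₀ AL c₀ cL uσ !₂[rσ L 0, rσ 0 1] with hj
  -- The excess cost of the steering control vanishes once the static state is reached, so its total
  -- is bounded independently of T.
  set φ : ℝ → ℝ := fun t => runningCost A₀ AL c₀ cL (u' t) (R' t) - j with hφ
  have hφi : ∀ T ≥ 0, IntervalIntegrable φ volume 0 T := fun T hT =>
    (intervalIntegrable_runningCost hT (hsol T).control_memLp (hsol T).trace_memLp).sub (by simp)
  have hφ0 : ∀ t ≥ T₀, φ t = 0 := fun t ht => by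
    simp only [hφ, (hend t ht).1, (hend t ht).2, hj, sub_self]
  -- Absolute values of the integrand also cover horizons T shorter than the steering time; |T₀|
  -- avoids assuming a sign of T₀.
  refine ⟨∫ t in 0..|T₀|, |φ t|, fun T hT u R r hopt => ?_⟩
  refine (hopt.2 u' r' R' (hsol T)).trans ?_
  have h1 : dynamicCost A₀ AL c₀ cL T u' R' = T * j + ∫ t in 0..T, φ t := by
    simp only [hφ]
    rw [intervalIntegral.integral_sub (intervalIntegrable_runningCost hT.le
      (hsol T).control_memLp (hsol T).trace_memLp) (by simp), dynamicCost]
    simp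
  rw [h1]
  refine add_le_add le_rfl ?_
  have habs : ∀ T ≥ 0, IntervalIntegrable (fun t => |φ t|) volume 0 T := fun T hT => (hφi T hT).abs
  have h2 : ∫ t in 0..T, φ t ≤ ∫ t in 0..T, |φ t| :=
    intervalIntegral.integral_mono_on hT.le (hφi T hT.le) (habs T hT.le) fun t _ => le_abs_self _
  refine h2.trans ?_
  rw [← sub_nonneg, intervalIntegral.integral_interval_sub_left (habs _ (abs_nonneg T₀))
    (habs T hT.le)]
  rcases le_total T |T₀| with hle | hle
  · exact intervalIntegral.integral_nonneg hle fun t _ => abs_nonneg _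
  · rw [intervalIntegral.integral_congr (g := fun _ => (0 : ℝ))]
    · simp
    intro t ht
    rw [uIcc_of_ge hle] at ht
    simp [hφ0 t ((le_abs_self T₀).trans ht.1)]

/-- The optimal dynamic control stays close to the optimal static control in `L²(0, T)`, uniformly
in the time horizon `T`. -/
theorem exists_control_bound (h : Regular L dp dm M) {η₀ ν : ℝ} {e : Fin 2 → ℝ → ℝ}
    (hd : IsDissipative L dp dm M η₀ e ν) (hA₀ : A₀.PosDef) (hAL : AL.PosDef)
    {uσ : Plane} {rσ : ℝ → Plane} (hσ : IsStaticOptimal L dp dm M η₀ A₀ AL c₀ cL uσ rσ) :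
    ∃ C > 0, ∀ T > 0, ∀ (u R : ℝ → Plane) (r : ℝ → StateSpace L),
      IsDynamicOptimal L dp dm M η₀ A₀ AL c₀ cL T u r R →
        ∫ t in 0..T, ‖u t - uσ‖ ^ 2 ≤ C := by
  obtain ⟨K, hK⟩ := exists_dynamicCost_upper_bound (A₀ := A₀) (AL := AL) (c₀ := c₀) (cL := cL)
    h hσ.1
  obtain ⟨p, hp⟩ := hσ.exists_adjoint h hA₀ hAL
  obtain ⟨α, hα, hlow⟩ := exists_runningCost_lower_bound hA₀ hAL
  obtain ⟨C, hC, hen⟩ := exists_energy_bound h hd hσ.1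
  set s := stateOf rσ hσ.1.continuousOn with hs
  refine ⟨2 / α * (|K| + ‖p‖ * ‖s‖ + α / 2 + ‖p‖ ^ 2 * C / (2 * α)), by positivity,
    fun T hT u R r hopt => ?_⟩
  have hdyn := hopt.1
  set Rσ : Plane := !₂[rσ L 0, rσ 0 1] with hRσ
  set g₀ := quadraticGradient A₀ c₀ ![uσ 0, rσ 0 1] with hg₀
  set gL := quadraticGradient AL cL ![uσ 1, rσ L 0] with hgL
  have hw : MemLp (fun t => u t - uσ) 2 (volume.restrict (Ioo 0 T)) :=
    hdyn.control_memLp.sub (memLp_const _)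
  have hρ : MemLp (fun t => R t - Rσ) 2 (volume.restrict (Ioo 0 T)) :=
    hdyn.trace_memLp.sub (memLp_const _)
  -- The static optimum is itself a static solution, so the linear cost of the deviation equals that
  -- of the dynamic pair.
  have hlin0 : linearCost g₀ gL uσ Rσ = 0 := hσ.linearCost_eq_zero h hA₀ hAL hσ.1
  have hlinsub : ∀ t, linearCost g₀ gL (u t - uσ) (R t - Rσ) = linearCost g₀ gL (u t) (R t) := by
    intro t
    rw [← sub_zero (linearCost g₀ gL (u t) (R t)), ← hlin0]
    simp [linearCost, dotProduct, Fin.sum_univ_two]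
    ring
  have hexp : ∀ t, runningCost A₀ AL c₀ cL (u t) (R t) = runningCost A₀ AL c₀ cL uσ Rσ
      + linearCost g₀ gL (u t) (R t) + runningCost A₀ AL 0 0 (u t - uσ) (R t - Rσ) := by
    intro t
    rw [← hlinsub]
    have := runningCost_add (c₀ := c₀) (cL := cL) hA₀ hAL uσ Rσ (u t - uσ) (R t - Rσ)
    rwa [add_sub_cancel, add_sub_cancel] at this
  have hqi : IntervalIntegrable (fun t => runningCost A₀ AL 0 0 (u t - uσ) (R t - Rσ)) volume 0 T :=
    intervalIntegrable_runningCost hT.le hw hρ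
  have hli : IntervalIntegrable (fun t => linearCost g₀ gL (u t) (R t)) volume 0 T := by
    have hu := fun i => intervalIntegrable_of_memLp hT.le (memLp_apply hdyn.control_memLp i)
    have hR := fun i => intervalIntegrable_of_memLp hT.le (memLp_apply hdyn.trace_memLp i)
    simp only [linearCost, dotProduct, Fin.sum_univ_two, Matrix.cons_val_zero, Matrix.cons_val_one]
    exact (((hu 0).const_mul _).add ((hR 1).const_mul _)).add
      (((hu 1).const_mul _).add ((hR 0).const_mul _))
  have hcost : dynamicCost A₀ AL c₀ cL T u R = T * runningCost A₀ AL c₀ cL uσ Rσ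
      + inner ℝ p (r T) + ∫ t in 0..T, runningCost A₀ AL 0 0 (u t - uσ) (R t - Rσ) := by
    rw [dynamicCost]
    simp only [hexp]
    rw [intervalIntegral.integral_add ((by simp : IntervalIntegrable _ _ _ _).add hli) hqi,
      intervalIntegral.integral_add (by simp) hli, hp T hT u R r hdyn]
    simp
  have hup := hK T hT u R r hopt
  rw [hcost] at hup
  set X := ∫ t in 0..T, ‖u t - uσ‖ ^ 2 with hX
  have hXi : IntervalIntegrable (fun t => ‖u t - uσ‖ ^ 2) volume 0 T := by
    simp only [norm_plane_sq]
    exact (intervalIntegrable_sq_of_memLp hT.le (memLp_apply hw 0)).add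
      (intervalIntegrable_sq_of_memLp hT.le (memLp_apply hw 1))
  have hαX : α * X ≤ ∫ t in 0..T, runningCost A₀ AL 0 0 (u t - uσ) (R t - Rσ) := by
    rw [hX, ← intervalIntegral.integral_const_mul]
    exact intervalIntegral.integral_mono_on hT.le (hXi.const_mul α) hqi fun t _ => hlow _ _
  have hN := (hen T hT u R r hdyn).1
  set N := ‖r T - s‖ with hNdef
  have hinner : -inner ℝ p (r T) ≤ ‖p‖ * ‖s‖ + ‖p‖ * N := by
    have h1 := neg_le_of_abs_le (abs_real_inner_le_norm p (r T))
    have h2 : ‖r T‖ ≤ N + ‖s‖ := by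
      have := norm_add_le (r T - s) s
      rwa [sub_add_cancel] at this
    nlinarith [norm_nonneg p]
  -- The weight α/(2C) is chosen so that N² ≤ C(1 + X) costs only α/2 · X, half of the coercivity.
  have hyoung : ‖p‖ * N ≤ α / (2 * C) * N ^ 2 + ‖p‖ ^ 2 * C / (2 * α) := by
    have : α / (2 * C) * N ^ 2 + ‖p‖ ^ 2 * C / (2 * α) - ‖p‖ * N
        = (α * N - C * ‖p‖) ^ 2 / (2 * α * C) := by
      field_simp
      ring
    have h2 : 0 ≤ (α * N - C * ‖p‖) ^ 2 / (2 * α * C) := by positivity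
    linarith
  have hN2 : α / (2 * C) * N ^ 2 ≤ α / 2 * (1 + X) := by
    calc α / (2 * C) * N ^ 2 ≤ α / (2 * C) * (C * (1 + X)) :=
          mul_le_mul_of_nonneg_left hN (by positivity)
      _ = α / 2 * (1 + X) := by field_simp
  have hfin : α / 2 * X ≤ |K| + ‖p‖ * ‖s‖ + α / 2 + ‖p‖ ^ 2 * C / (2 * α) := by
    linarith [le_abs_self K]
  calc X = 2 / α * (α / 2 * X) := by field_simp
    _ ≤ _ := mul_le_mul_of_nonneg_left hfin (by positivity)

lemma integral_norm_sub_sq_eq (hL : 0 ≤ L) {f : ℝ → Plane} (hf : ContinuousOn f (Icc 0 L))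
    (Y : StateSpace L) : ∫ x in 0..L, ‖Y x - f x‖ ^ 2 = ‖Y - stateOf f hf‖ ^ 2 := by
  rw [norm_state_sq hL]
  refine integral_congr_ae_Ioo hL ?_
  filter_upwards [Lp.coeFn_sub Y (stateOf f hf), coeFn_stateOf hf] with x h1 h2
  rw [h1, Pi.sub_apply, h2, norm_plane_sq, Fin.sum_univ_two]

end Turnpike

theorem theorem1
    (L : ℝ) (hL : 0 < L)
    (dp dm : ℝ → ℝ)
    (hdp : ContDiffOn ℝ 1 dp (Icc 0 L)) (hdm : ContDiffOn ℝ 1 dm (Icc 0 L))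
    (hsign : ∀ x ∈ Icc 0 L, dm x < 0 ∧ 0 < dp x)
    (M : ℝ → Matrix (Fin 2) (Fin 2) ℝ) (hM : ContinuousOn M (Icc 0 L))
    (η₀ : ℝ) (hη₀ : η₀ ≤ 0)
    (hforward : Turnpike.ForwardLyapunov L dp dm M η₀)
    (hbackward : Turnpike.BackwardLyapunov L dp dm M η₀)
    (A₀ AL : Matrix (Fin 2) (Fin 2) ℝ) (hA₀ : A₀.PosDef) (hAL : AL.PosDef)
    (c₀ cL : Fin 2 → ℝ)
    (uσ : Turnpike.Plane) (rσ : ℝ → Turnpike.Plane)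
    (hσ : Turnpike.IsStaticOptimal L dp dm M η₀ A₀ AL c₀ cL uσ rσ) :
    (∃ C > 0, ∀ T > 0, ∀ (u : ℝ → Turnpike.Plane) (r : ℝ → Turnpike.StateSpace L)
        (R : ℝ → Turnpike.Plane),
      Turnpike.IsDynamicOptimal L dp dm M η₀ A₀ AL c₀ cL T u r R →
        (1 / T * ∫ t in 0..T, ‖u t - uσ‖ ^ 2) ≤ C / T ∧
        (∫ s in 0..1, ‖u (T * s) - uσ‖ ^ 2) ≤ C / T) ∧
    (∃ D > 0, ∀ T > 0, ∀ (u : ℝ → Turnpike.Plane) (r : ℝ → Turnpike.StateSpace L)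
        (R : ℝ → Turnpike.Plane),
      Turnpike.IsDynamicOptimal L dp dm M η₀ A₀ AL c₀ cL T u r R →
        (∫ t in 0..T, ∫ x in 0..L, ‖r t x - rσ x‖ ^ 2) ≤ D) := by
  have h : Turnpike.Regular L dp dm M := by
    refine ⟨hL, fun i => ?_, fun x hx => (hsign x hx).2, fun x hx => (hsign x hx).1, hM⟩
    fin_cases i
    · exact hdp
    · exact hdm
  obtain ⟨e, ν, hd⟩ := hforward.exists_isDissipative hη₀
  obtain ⟨C, hC, hctrl⟩ := Turnpike.exists_control_bound h hd hA₀ hAL hσ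
  obtain ⟨D, hD, hstate⟩ := Turnpike.exists_energy_bound h hd hσ.1
  refine ⟨⟨C, hC, fun T hT u r R hopt => ?_⟩, D * (1 + C), by positivity,
    fun T hT u r R hopt => ?_⟩
  · have hX := hctrl T hT u R r hopt
    have h1 : 1 / T * ∫ t in 0..T, ‖u t - uσ‖ ^ 2 ≤ C / T := by
      rw [one_div_mul_eq_div]
      exact div_le_div_of_nonneg_right hX hT.le
    refine ⟨h1, ?_⟩
    -- The substitution t = Ts reduces the second estimate to the first.
    rw [intervalIntegral.integral_comp_mul_left (fun t => ‖u t - uσ‖ ^ 2) hT.ne', mul_zero,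
      mul_one, smul_eq_mul, ← one_div]
    exact h1
  · have hX := hctrl T hT u R r hopt
    simp only [Turnpike.integral_norm_sub_sq_eq hL.le hσ.1.continuousOn]
    refine (hstate T hT u R r hopt.1).2.trans ?_
    exact mul_le_mul_of_nonneg_left (by linarith) hD.le
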